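/- **Setting.** Let $\hbar>0$ and let $w\in L^\infty(\mathbb R^3)$ be real-valued and even, $w(-x)=w(x)$ for a.e. $x$. For $N\ge1$ let $\mathcal H^{(N)}=L^2_S(\mathbb R^{3N})$ be the space of totally symmetric functions in $L^2(\mathbb R^{3N})$, with orthogonal projection $P_S:L^2(\mathbb R^{3N})\to\mathcal H^{(N)}$, and let $$H_N=H_N^0+W_N,\qquad H_N^0=-\sum_{i=1}^N\frac{\hbar^2}{2}\Delta_i,\qquad W_N=\frac1N\sum_{1\le i<j\le N}w(x_i-x_j),$$ with domain the symmetric functions in $H^2(\mathbb R^{3N})$. For $q\ge 0$ and a bounded operator $b$ on $L^2(\mathbb R^{3q})$ put $$A_N^{(q)}(b)=\frac{N(N-1)\cdots(N-q+1)}{N^q}\,P_S\,(b\otimes I^{(N-q)})\,P_S\quad\text{on }\mathcal H^{(N)},$$ where $b$ acts on the first $q$ particles; this is $0$ for $q>N$. A bounded operator $a$ on $L^2_S(\mathbb R^{3p})$ is identified with the operator $P_S\,a\,P_S$ on $L^2(\mathbb R^{3p})$. Given such an $a=a^{(p)}$, write $A_N^{(p)}=A_N^{(p)}(a^{(p)})$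 and, for $t\in\mathbb R$, $$A^{(p)}_t=e^{iH_N^0t/\hbar}A_N^{(p)}e^{-iH_N^0t/\hbar}.$$ For $i\ne j$ let $w^{ij}_s=e^{iH^0s/\hbar}\,w(x_i-x_j)\,e^{-iH^0s/\hbar}$, with $H^0$ the free Hamiltonian of the particles considered. The tree amplitudes (which also depend on $t$) are the bounded operators $g^{(n;p)}_{t_1,\dots,t_n}$ on $L^2(\mathbb R^{3(p+n)})$ given by $$g^{(0;p)}=e^{iH_p^0t/\hbar}a^{(p)}e^{-iH_p^0t/\hbar},\qquad g^{(n;p)}_{t_1,\dots,t_n}=\frac i\hbar\sum_{i=1}^{p+n-1}\bigl[w^{i\,p+n}_{t_n},\,g^{(n-1;p)}_{t_1,\dots,t_{n-1}}\otimes I\bigr]\quad(n\ge1).$$ **Proposition.** For every $p\ge0$ and $\kappa<1$ there is a constant $C=C(p,\kappa)$ such that the following holds for all $\hbar$, $w$ as above, all $t\in\mathbb R$ with $\frac{4\|w\|_\infty}{\hbar}|t|\le\kappa$, all bounded operators $a^{(p)}$ on $L^2_S(\mathbb R^{3p})$ and all $N\ge\max(1,p)$. (In particular, every $t$ with $|t|<(4\|w\|_\infty/\hbar)^{-1}$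 is covered, with a constant independent of $N$.) 1. $H_N$ generates a strongly continuous one-parameter unitary group $e^{-iH_Nt/\hbar}$ on $\mathcal H^{(N)}$ (its infinitesimal generator is exactly $-\frac i\hbar H_N$). 2. For every $n\ge0$ the operators $A_N^{(p+n)}(g^{(n;p)}_{t_1,\dots,t_n})$ depend strongly continuously on $(t_1,\dots,t_n)\in\mathbb R^n$, and their strong time-ordered integrals $$B_n=\int_0^t dt_1\int_0^{t_1}dt_2\cdots\int_0^{t_{n-1}}dt_n\,A_N^{(p+n)}\bigl(g^{(n;p)}_{t_1,\dots,t_n}\bigr)$$ are bounded operators on $\mathcal H^{(N)}$ with, for $n\ge1$, $\|B_n\|\le 2^p\,\|a^{(p)}\|\,\bigl(\tfrac{4\|w\|_\infty}{\hbar}|t|\bigr)^n$. Hence $\sum_{n\ge1}B_n$ converges absolutely in operator norm, uniformly in $N$. 3. The Heisenberg-picture operator satisfies $$e^{iH_Nt/\hbar}A_N^{(p)}e^{-iH_Nt/\hbar}=A^{(p)}_t+\sum_{n=1}^\infty B_n+O(1/N)$$ in operator norm; more precisely $$\Bigl\|e^{iH_Nt/\hbar}A_N^{(p)}e^{-iH_Nt/\hbar}-A^{(p)}_t-\sum_{n=1}^\infty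 B_n\Bigr\|\le\frac{C\,\|a^{(p)}\|}{N}.$$ -/

import Mathlib

open MeasureTheory
open scoped ENNReal InnerProductSpace

noncomputable section

namespace MeanField

/-- The one-particle space `ℝ³`. -/
abbrev Pt : Type := EuclideanSpace ℝ (Fin 3)

/-- The configuration space `ℝ^{3N}` of `N` particles; the `k`-th coordinate of the `i`-th
particle has index `(i, k)`. -/
abbrev Config (N : ℕ) : Type := EuclideanSpace ℝ (Fin N × Fin 3)

/-- The Hilbert space `L²(ℝ^{3N})`. -/
abbrev L2 (N : ℕ) : Type := Lp ℂ 2 (volume : Measure (Config N))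

/-- The space of (classes of) essentially bounded real functions on `ℝ³`, normed by the essential
supremum. -/
abbrev Potential : Type := Lp ℝ ∞ (volume : Measure Pt)

/-! ### Permutations and the symmetric subspace -/

/-- The coordinate permutation `(x₁, …, x_N) ↦ (x_{σ 1}, …, x_{σ N})` as an isometry. -/
def permConfig {N : ℕ} (σ : Equiv.Perm (Fin N)) : Config N ≃ₗᵢ[ℝ] Config N :=
  LinearIsometryEquiv.piLpCongrLeft 2 ℝ ℝ (Equiv.prodCongr σ.symm (Equiv.refl (Fin 3)))

theorem permConfig_apply {N : ℕ} (σ : Equiv.Perm (Fin N)) (x : Config N) (i : Fin N) (k : Fin 3) :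
    permConfig σ x (i, k) = x (σ i, k) := by
  simp [permConfig, LinearIsometryEquiv.piLpCongrLeft_apply, Equiv.piCongrLeft'_apply]

/-- The action of a permutation on wave functions,
`(x₁, …, x_N) ↦ ψ(x_{σ 1}, …, x_{σ N})`. -/
def permOp {N : ℕ} (σ : Equiv.Perm (Fin N)) : L2 N →ₗᵢ[ℂ] L2 N :=
  Lp.compMeasurePreservingₗᵢ ℂ (permConfig σ) (permConfig σ).measurePreserving

/-- The totally symmetric wave functions, as a subspace of `L²(ℝ^{3N})`. -/
def symmetric (N : ℕ) : Submodule ℂ (L2 N) :=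
  ⨅ σ : Equiv.Perm (Fin N),
    LinearMap.ker ((permOp σ).toContinuousLinearMap - ContinuousLinearMap.id ℂ (L2 N)).toLinearMap

theorem mem_symmetric {N : ℕ} (ψ : L2 N) :
    ψ ∈ symmetric N ↔ ∀ σ : Equiv.Perm (Fin N), permOp σ ψ = ψ := by
  simp [symmetric, Submodule.mem_iInf, sub_eq_zero]

instance completeSpace_symmetric (N : ℕ) : CompleteSpace (symmetric N) := by
  have h : IsClosed (symmetric N : Set (L2 N)) := by
    have : (symmetric N : Set (L2 N)) =
        ⋂ σ : Equiv.Perm (Fin N), {ψ | permOp σ ψ = ψ} := by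
      ext ψ
      simp [mem_symmetric]
    rw [this]
    exact isClosed_iInter fun σ => isClosed_eq (permOp σ).continuous continuous_id
  exact h.completeSpace_coe

/-- The bosonic Hilbert space `L²_S(ℝ^{3N})`. -/
abbrev L2S (N : ℕ) : Type := symmetric N

/-- The inclusion of `L²_S` in `L²`. -/
def incl (N : ℕ) : L2S N →L[ℂ] L2 N := (symmetric N).subtypeL

/-- The orthogonal projection `P_S` of `L²` onto `L²_S`. -/
def symProj (N : ℕ) : L2 N →L[ℂ] L2S N := (symmetric N).orthogonalProjectionOnto

/-- An operator `a` on `L²_S` regarded as the operator `P_S a P_S` on `L²`. -/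
def extendOp {N : ℕ} (a : L2S N →L[ℂ] L2S N) : L2 N →L[ℂ] L2 N :=
  incl N ∘L a ∘L symProj N

/-- The compression `P_S T P_S` of an operator on `L²` to `L²_S`; it is the restriction of `T` to
`L²_S` when `T` leaves `L²_S` invariant. -/
def compress {N : ℕ} (T : L2 N →L[ℂ] L2 N) : L2S N →L[ℂ] L2S N :=
  symProj N ∘L T ∘L incl N

/-! ### Operators acting on the first particles only -/

/-- The first `q` particles of a configuration of `N` particles. -/
def headPart {q N : ℕ} (h : q ≤ N) (x : Config N) : Config q :=
  WithLp.toLp 2 fun ik => x (Fin.castLE h ik.1, ik.2)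

/-- The last `N - q` particles of a configuration of `N` particles. -/
def tailPart {q N : ℕ} (h : q ≤ N) (x : Config N) : Config (N - q) :=
  WithLp.toLp 2 fun ik => x (Fin.cast (Nat.add_sub_cancel' h) (Fin.natAdd q ik.1), ik.2)

theorem measurePreserving_headPart_tailPart {q N : ℕ} (h : q ≤ N) :
    MeasurePreserving (fun x : Config N => (headPart h x, tailPart h x)) volume
      (volume.prod volume) := by
  let e : (Fin q × Fin 3) ⊕ (Fin (N - q) × Fin 3) ≃ Fin N × Fin 3 :=
    (Equiv.sumProdDistrib (Fin q) (Fin (N - q)) (Fin 3)).symm.trans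
      (Equiv.prodCongr (finSumFinEquiv.trans (finCongr (Nat.add_sub_cancel' h))) (Equiv.refl _))
  have h1 : MeasurePreserving (LinearIsometryEquiv.piLpCongrLeft 2 ℝ ℝ e.symm) :=
    LinearIsometryEquiv.measurePreserving _
  have h2 := (PiLp.volume_preserving_ofLp ((Fin q × Fin 3) ⊕ (Fin (N - q) × Fin 3))).comp h1
  have h3 := (volume_measurePreserving_sumPiEquivProdPi
    (fun _ : (Fin q × Fin 3) ⊕ (Fin (N - q) × Fin 3) => ℝ)).comp h2
  have h4 := ((PiLp.volume_preserving_toLp (Fin q × Fin 3)).prod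
    (PiLp.volume_preserving_toLp (Fin (N - q) × Fin 3))).comp h3
  exact h4

theorem memLp_tensor {q N : ℕ} (h : q ≤ N) (f : L2 q) (g : L2 (N - q)) :
    MemLp (fun x : Config N => f (headPart h x) * g (tailPart h x)) 2 volume := by
  have hp : MemLp (fun z : Config q × Config (N - q) => f z.1 * g z.2) 2
      ((volume : Measure (Config q)).prod (volume : Measure (Config (N - q)))) := by
    have hm : AEStronglyMeasurable (fun z : Config q × Config (N - q) => f z.1 * g z.2)
        ((volume : Measure (Config q)).prod (volume : Measure (Config (N - q)))) :=
      (Lp.aestronglyMeasurable f).comp_fst.mul (Lp.aestronglyMeasurable g).comp_snd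
    rw [memLp_two_iff_integrable_sq_norm hm]
    have hf := (memLp_two_iff_integrable_sq_norm (Lp.aestronglyMeasurable f)).1 (Lp.memLp f)
    have hg := (memLp_two_iff_integrable_sq_norm (Lp.aestronglyMeasurable g)).1 (Lp.memLp g)
    simpa [mul_pow] using hf.mul_prod hg
  exact hp.comp_measurePreserving (measurePreserving_headPart_tailPart h)

/-- The tensor product `f ⊗ g`, i.e. the wave function
`(x₁, …, x_N) ↦ f(x₁, …, x_q) g(x_{q+1}, …, x_N)`. -/
def tensor {q N : ℕ} (h : q ≤ N) (f : L2 q) (g : L2 (N - q)) : L2 N :=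
  (memLp_tensor h f g).toLp

theorem inner_tensor {q N : ℕ} (h : q ≤ N) (f f' : L2 q) (g g' : L2 (N - q)) :
    ⟪tensor h f g, tensor h f' g'⟫_ℂ = ⟪f, f'⟫_ℂ * ⟪g, g'⟫_ℂ := by
  have hmp := measurePreserving_headPart_tailPart h
  have e1 : ⟪tensor h f g, tensor h f' g'⟫_ℂ =
      ∫ x : Config N, (fun z : Config q × Config (N - q) =>
        ⟪f z.1, f' z.1⟫_ℂ * ⟪g z.2, g' z.2⟫_ℂ) (headPart h x, tailPart h x) := by
    rw [L2.inner_def]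
    refine integral_congr_ae ?_
    filter_upwards [(memLp_tensor h f g).coeFn_toLp, (memLp_tensor h f' g').coeFn_toLp]
      with x hx hx'
    change ⟪(memLp_tensor h f g).toLp _ x, (memLp_tensor h f' g').toLp _ x⟫_ℂ = _
    rw [hx, hx']
    simp only [RCLike.inner_apply, map_mul]
    ring
  have hm : AEStronglyMeasurable (fun z : Config q × Config (N - q) =>
      ⟪f z.1, f' z.1⟫_ℂ * ⟪g z.2, g' z.2⟫_ℂ) (volume.prod volume) :=
    ((Lp.aestronglyMeasurable f).inner (Lp.aestronglyMeasurable f')).comp_fst.mul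
      ((Lp.aestronglyMeasurable g).inner (Lp.aestronglyMeasurable g')).comp_snd
  have e2 := integral_map (f := fun z : Config q × Config (N - q) =>
      ⟪f z.1, f' z.1⟫_ℂ * ⟪g z.2, g' z.2⟫_ℂ) hmp.measurable.aemeasurable (hmp.map_eq ▸ hm)
  rw [e1, ← e2, hmp.map_eq,
    integral_prod_mul (fun x => ⟪f x, f' x⟫_ℂ) (fun y => ⟪g y, g' y⟫_ℂ), ← L2.inner_def,
    ← L2.inner_def]

theorem quasi_head {q N : ℕ} (h : q ≤ N) :
    Measure.QuasiMeasurePreserving (headPart (q := q) h) volume volume :=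
  Measure.quasiMeasurePreserving_fst.comp
    (measurePreserving_headPart_tailPart h).quasiMeasurePreserving

theorem quasi_tail {q N : ℕ} (h : q ≤ N) :
    Measure.QuasiMeasurePreserving (tailPart (q := q) h) volume volume :=
  Measure.quasiMeasurePreserving_snd.comp
    (measurePreserving_headPart_tailPart h).quasiMeasurePreserving

theorem tensor_coe {q N : ℕ} (h : q ≤ N) (f : L2 q) (g : L2 (N - q)) :
    tensor h f g =ᵐ[volume] fun x => f (headPart h x) * g (tailPart h x) :=
  (memLp_tensor h f g).coeFn_toLp

/-- The tensor product as a bilinear map. -/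
def tensorLin {q N : ℕ} (h : q ≤ N) : L2 q →ₗ[ℂ] L2 (N - q) →ₗ[ℂ] L2 N :=
  LinearMap.mk₂ ℂ (tensor h)
    (fun f f' g => by
      refine Lp.ext ?_
      filter_upwards [tensor_coe h (f + f') g, tensor_coe h f g, tensor_coe h f' g,
        Lp.coeFn_add (tensor h f g) (tensor h f' g),
        (quasi_head h).ae (Lp.coeFn_add f f')] with x h1 h2 h3 h4 h5
      rw [h1, h4, Pi.add_apply, h2, h3, h5, Pi.add_apply, add_mul])
    (fun c f g => by
      refine Lp.ext ?_
      filter_upwards [tensor_coe h (c • f) g, tensor_coe h f g,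
        Lp.coeFn_smul c (tensor h f g), (quasi_head h).ae (Lp.coeFn_smul c f)] with x h1 h2 h4 h5
      rw [h1, h4, Pi.smul_apply, h2, h5, Pi.smul_apply, smul_mul_assoc])
    (fun f g g' => by
      refine Lp.ext ?_
      filter_upwards [tensor_coe h f (g + g'), tensor_coe h f g, tensor_coe h f g',
        Lp.coeFn_add (tensor h f g) (tensor h f g'),
        (quasi_tail h).ae (Lp.coeFn_add g g')] with x h1 h2 h3 h4 h5
      rw [h1, h4, Pi.add_apply, h2, h3, h5, Pi.add_apply, mul_add])
    (fun c f g => by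
      refine Lp.ext ?_
      filter_upwards [tensor_coe h f (c • g), tensor_coe h f g,
        Lp.coeFn_smul c (tensor h f g), (quasi_tail h).ae (Lp.coeFn_smul c g)] with x h1 h2 h4 h5
      rw [h1, h4, Pi.smul_apply, h2, h5, Pi.smul_apply, mul_smul_comm])

theorem norm_tensor {q N : ℕ} (h : q ≤ N) (f : L2 q) (g : L2 (N - q)) :
    ‖tensor h f g‖ = ‖f‖ * ‖g‖ := by
  have h1 := inner_tensor h f f g g
  rw [inner_self_eq_norm_sq_to_K, inner_self_eq_norm_sq_to_K, inner_self_eq_norm_sq_to_K] at h1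
  have h2 : ‖tensor h f g‖ ^ 2 = (‖f‖ * ‖g‖) ^ 2 := by
    rw [mul_pow]
    exact_mod_cast h1
  exact (sq_eq_sq₀ (norm_nonneg _) (by positivity)).1 h2

theorem exists_amplify {q N : ℕ} (h : q ≤ N) (b : L2 q →L[ℂ] L2 q) :
    ∃ T : L2 N →L[ℂ] L2 N, ∀ f g, T (tensor h f g) = tensor h (b f) g := by
  obtain ⟨s, e, -⟩ := exists_hilbertBasis ℂ (L2 (N - q))
  let V : s → L2 q →ₗᵢ[ℂ] L2 N := fun k =>
    { toLinearMap := (tensorLin h).flip (e k)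
      norm_map' := fun f => by
        change ‖tensor h f (e k)‖ = ‖f‖
        rw [norm_tensor, e.orthonormal.1 k, mul_one] }
  have hV : OrthogonalFamily ℂ (fun _ : s => L2 q) V := by
    intro i j hij f f'
    change ⟪tensor h f (e i), tensor h f' (e j)⟫_ℂ = 0
    rw [inner_tensor, e.orthonormal.2 hij, mul_zero]
  have hmem : ∀ u : lp (fun _ : s => L2 q) 2, Memℓp (fun k => b (u k)) 2 := by
    intro u
    refine memℓp_gen ?_
    have hu := (lp.memℓp u).summable (by norm_num)
    refine Summable.of_nonneg_of_le (fun k => by positivity) (fun k => ?_)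
      (hu.mul_left (‖b‖ ^ (2 : ℝ≥0∞).toReal))
    rw [← Real.mul_rpow (norm_nonneg _) (norm_nonneg _)]
    exact Real.rpow_le_rpow (norm_nonneg _) (b.le_opNorm _) (by norm_num)
  let M : lp (fun _ : s => L2 q) 2 →ₗ[ℂ] lp (fun _ : s => L2 q) 2 :=
    { toFun := fun u => ⟨fun k => b (u k), hmem u⟩
      map_add' := fun u v => by ext1; funext k; simp; rfl
      map_smul' := fun c u => by ext1; funext k; simp }
  have hM : ∀ u, ‖M u‖ ≤ ‖b‖ * ‖u‖ := by
    intro u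
    refine lp.norm_le_of_forall_sum_le (by norm_num) (by positivity) (fun F => ?_)
    rw [Real.mul_rpow (norm_nonneg _) (norm_nonneg _)]
    calc ∑ k ∈ F, ‖M u k‖ ^ (2 : ℝ≥0∞).toReal
        ≤ ∑ k ∈ F, ‖b‖ ^ (2 : ℝ≥0∞).toReal * ‖u k‖ ^ (2 : ℝ≥0∞).toReal := by
          refine Finset.sum_le_sum fun k _ => ?_
          rw [← Real.mul_rpow (norm_nonneg _) (norm_nonneg _)]
          exact Real.rpow_le_rpow (norm_nonneg _) (b.le_opNorm _) (by norm_num)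
      _ ≤ _ := by
          rw [← Finset.mul_sum]
          exact mul_le_mul_of_nonneg_left (lp.sum_rpow_le_norm_rpow (by norm_num) u F)
            (by positivity)
  let J := hV.linearIsometry
  let Mc := M.mkContinuous ‖b‖ hM
  refine ⟨J.toContinuousLinearMap ∘L Mc ∘L J.toContinuousLinearMap.adjoint, fun f g => ?_⟩
  have hk : ∀ k, (J.toContinuousLinearMap.adjoint (tensor h f g)) k = ⟪e k, g⟫_ℂ • f := by
    intro k
    classical
    refine ext_inner_left ℂ fun v => ?_
    have h1 := lp.inner_single_left (𝕜 := ℂ) k v (J.toContinuousLinearMap.adjoint (tensor h f g))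
    rw [← h1, ContinuousLinearMap.adjoint_inner_right]
    change ⟪hV.linearIsometry _, _⟫_ℂ = _
    rw [hV.linearIsometry_apply_single]
    change ⟪tensor h v (e k), tensor h f g⟫_ℂ = _
    rw [inner_tensor, inner_smul_right, mul_comm]
  have hs := hV.hasSum_linearIsometry (Mc (J.toContinuousLinearMap.adjoint (tensor h f g)))
  have hterm : (fun k => V k ((Mc (J.toContinuousLinearMap.adjoint (tensor h f g))) k)) =
      fun k => tensorLin h (b f) (⟪e k, g⟫_ℂ • e k) := by
    funext k
    change tensorLin h (b ((J.toContinuousLinearMap.adjoint (tensor h f g)) k)) (e k) = _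
    rw [hk, map_smul, map_smul, map_smul, LinearMap.smul_apply]
  rw [hterm] at hs
  have hg : HasSum (fun k => ⟪e k, g⟫_ℂ • e k) g := by
    simpa [e.repr_apply_apply] using e.hasSum_repr g
  let tl : L2 (N - q) →L[ℂ] L2 N := (tensorLin h (b f)).mkContinuous ‖b f‖
    (fun u => (norm_tensor h (b f) u).le)
  have hs' : HasSum (fun k => tensorLin h (b f) (⟪e k, g⟫_ℂ • e k)) (tensorLin h (b f) g) :=
    tl.hasSum hg
  exact hs.unique hs'

/-- The operator `b ⊗ I` on `L²(ℝ^{3N})`, where `b` acts on the first `q` particles: the bounded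
operator with `(b ⊗ I)(f ⊗ g) = (b f) ⊗ g` for all `f`, `g`. -/
def amplify {q N : ℕ} (h : q ≤ N) (b : L2 q →L[ℂ] L2 q) : L2 N →L[ℂ] L2 N :=
  (exists_amplify h b).choose

theorem amplify_tensor {q N : ℕ} (h : q ≤ N) (b : L2 q →L[ℂ] L2 q) (f : L2 q) (g : L2 (N - q)) :
    amplify h b (tensor h f g) = tensor h (b f) g :=
  (exists_amplify h b).choose_spec f g

/-- The observable `A_N^{(q)}(b) = N(N-1)⋯(N-q+1) N^{-q} P_S (b ⊗ I) P_S` on `L²_S(ℝ^{3N})`. It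
vanishes for `q > N`. -/
def observable {q : ℕ} (N : ℕ) (b : L2 q →L[ℂ] L2 q) : L2S N →L[ℂ] L2S N :=
  if h : q ≤ N then
    ((N.descFactorial q : ℂ) / (N : ℂ) ^ q) • compress (amplify h b)
  else 0

/-! ### Free evolution and interaction -/

/-- Multiplication by an essentially bounded function, as an operator on `L²(ℝ^{3N})`. -/
def mulOp {N : ℕ} {f : Config N → ℂ} (hf : MemLp f ∞ volume) : L2 N →L[ℂ] L2 N :=
  (ContinuousLinearMap.mul ℂ ℂ).holderL volume ∞ 2 2 (MemLp.toLp f hf)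

theorem mulOp_coe {N : ℕ} {f : Config N → ℂ} (hf : MemLp f ∞ volume) (ψ : L2 N) :
    mulOp hf ψ =ᵐ[volume] fun x => f x * ψ x := by
  have h1 : mulOp hf ψ =ᵐ[volume] fun x => MemLp.toLp f hf x * ψ x :=
    (ContinuousLinearMap.mul ℂ ℂ).coeFn_holder (r := 2) (MemLp.toLp f hf) ψ
  filter_upwards [h1, hf.coeFn_toLp] with x hx hx'
  rw [hx, hx']

/-- The Fourier symbol of `-(ħ²/2) ∑ᵢ Δᵢ`. Since `𝓕ψ(ξ) = ∫ e^{-2πi⟨x,ξ⟩} ψ(x) dx`, the symbol of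
`-Δ` is `(2π|ξ|)²`. -/
def kineticSymbol (ħ : ℝ) (N : ℕ) (ξ : Config N) : ℝ :=
  ħ ^ 2 / 2 * (2 * Real.pi * ‖ξ‖) ^ 2

/-- The Fourier transform on `L²(ℝ^{3N})`, a unitary operator. -/
def fourierL2 (N : ℕ) : L2 N ≃ₗᵢ[ℂ] L2 N :=
  Lp.fourierTransformₗᵢ (Config N) ℂ

/-- Multiplication by a real function `m` in `L²(ℝ^{3N})`, on the maximal domain
`{φ ∈ L² | m φ ∈ L²}`. -/
def mulMax {N : ℕ} (m : Config N → ℝ) : L2 N →ₗ.[ℂ] L2 N where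
  domain :=
    { carrier := {φ | MemLp (fun ξ => (m ξ : ℂ) * φ ξ) 2 volume}
      zero_mem' := by
        refine (memLp_congr_ae ?_).2 (MemLp.zero (ε := ℂ))
        filter_upwards [Lp.coeFn_zero ℂ 2 (volume : Measure (Config N))] with ξ hξ
        simp
      add_mem' := fun {ψ φ} hψ hφ => by
        refine (memLp_congr_ae ?_).2 (MemLp.add hψ hφ)
        filter_upwards [Lp.coeFn_add ψ φ] with ξ hξ
        rw [hξ, Pi.add_apply, mul_add]
        rfl
      smul_mem' := fun c ψ hψ => by
        refine (memLp_congr_ae ?_).2 (MemLp.const_smul hψ c)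
        filter_upwards [Lp.coeFn_smul c ψ] with ξ hξ
        simp [hξ, mul_left_comm] }
  toFun :=
    { toFun := fun ψ => MemLp.toLp _ ψ.2
      map_add' := fun ψ φ => by
        rw [← MemLp.toLp_add]
        refine MemLp.toLp_congr _ _ ?_
        filter_upwards [Lp.coeFn_add (ψ : L2 N) (φ : L2 N)] with ξ hξ
        simp only [Submodule.coe_add, hξ, Pi.add_apply, mul_add]
      map_smul' := fun c ψ => by
        refine Eq.trans ?_ (MemLp.toLp_const_smul c ψ.2)
        refine MemLp.toLp_congr _ _ ?_
        filter_upwards [Lp.coeFn_smul c (ψ : L2 N)] with ξ hξ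
        simp only [Submodule.coe_smul, hξ, Pi.smul_apply, smul_eq_mul, mul_left_comm] }

/-- The kinetic energy `H_N⁰ = -(ħ²/2) ∑ᵢ Δᵢ` in `L²(ℝ^{3N})`, with the Sobolev space `H²` (those
`ψ` with `|ξ|² 𝓕ψ ∈ L²`, when `ħ ≠ 0`) as its domain. -/
def kinetic (ħ : ℝ) (N : ℕ) : L2 N →ₗ.[ℂ] L2 N where
  domain := (mulMax (kineticSymbol ħ N)).domain.comap (fourierL2 N).toLinearEquiv.toLinearMap
  toFun := (fourierL2 N).symm.toLinearEquiv.toLinearMap ∘ₗ (mulMax (kineticSymbol ħ N)).toFun ∘ₗ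
    (fourierL2 N).toLinearEquiv.toLinearMap.submoduleComap _

theorem memLp_freePhase (ħ : ℝ) (N : ℕ) (t : ℝ) :
    MemLp (fun ξ : Config N => Complex.exp (-Complex.I * (t / ħ * kineticSymbol ħ N ξ : ℝ))) ∞
      volume := by
  refine memLp_top_of_bound (Continuous.aestronglyMeasurable ?_) 1 (Filter.Eventually.of_forall ?_)
  · unfold kineticSymbol
    fun_prop
  · intro ξ
    rw [show -Complex.I * ((t / ħ * kineticSymbol ħ N ξ : ℝ) : ℂ) =
      ((-(t / ħ * kineticSymbol ħ N ξ) : ℝ) : ℂ) * Complex.I by push_cast; ring,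
      Complex.norm_exp_ofReal_mul_I]

/-- The free propagator `e^{-i H_N⁰ t / ħ}` on `L²(ℝ^{3N})`: the Fourier multiplier with symbol
`e^{-i t h(ξ) / ħ}`, where `h` is the symbol of `H_N⁰`. -/
def free (ħ : ℝ) (N : ℕ) (t : ℝ) : L2 N →L[ℂ] L2 N :=
  ((fourierL2 N).symm.toContinuousLinearEquiv : L2 N →L[ℂ] L2 N) ∘L
    mulOp (memLp_freePhase ħ N t) ∘L
    ((fourierL2 N).toContinuousLinearEquiv : L2 N →L[ℂ] L2 N)

/-- The relative position `x_i - x_j`, as a linear map. -/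
def relPos {N : ℕ} (i j : Fin N) : Config N →ₗ[ℝ] Pt where
  toFun x := WithLp.toLp 2 fun k => x (i, k) - x (j, k)
  map_add' x y := by ext k; simp; ring
  map_smul' c x := by ext k; simp; ring

theorem memLp_pair (w : Potential) {N : ℕ} {i j : Fin N} (h : i ≠ j) :
    MemLp (fun x : Config N => ((w (relPos i j x) : ℝ) : ℂ)) ∞ volume := by
  have hsurj : Function.Surjective (relPos i j) := by
    intro y
    refine ⟨WithLp.toLp 2 fun ik => if ik.1 = i then y ik.2 else 0, ?_⟩
    ext k
    simp [relPos, h.symm]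
  have hq : Measure.QuasiMeasurePreserving (relPos i j) volume volume := by
    refine ⟨(relPos i j).continuous_of_finiteDimensional.measurable, ?_⟩
    obtain ⟨c, -, -, hc⟩ := (relPos i j).exists_map_addHaar_eq_smul_addHaar'
      (volume : Measure (Config N)) (volume : Measure Pt) hsurj
    rw [hc]
    exact Measure.smul_absolutelyContinuous
  have hw : ∀ᵐ y : Pt, ‖w y‖ ≤ ‖w‖ := by
    have h1 := ae_le_eLpNormEssSup (f := w) (μ := (volume : Measure Pt))
    filter_upwards [h1] with y hy
    rw [Lp.norm_def, eLpNorm_exponent_top, ← toReal_enorm]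
    refine ENNReal.toReal_mono ?_ hy
    rw [← eLpNorm_exponent_top]
    exact (Lp.memLp w).2.ne
  refine memLp_top_of_bound ?_ ‖w‖ ?_
  · exact Complex.continuous_ofReal.comp_aestronglyMeasurable
      ((Lp.aestronglyMeasurable w).comp_quasiMeasurePreserving hq)
  · filter_upwards [hq.ae hw] with x hx
    simpa using hx

/-- The operator `w^{ij}` of multiplication by `w(x_i - x_j)` on `L²(ℝ^{3N})`, for `i ≠ j`. -/
def pairOp (w : Potential) {N : ℕ} (i j : Fin N) : L2 N →L[ℂ] L2 N :=
  if h : i ≠ j then mulOp (memLp_pair w h) else 0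

/-- The free Heisenberg evolution `w^{ij}_s = e^{i H⁰ s / ħ} w^{ij} e^{-i H⁰ s / ħ}`. -/
def pairOpAt (ħ : ℝ) (w : Potential) {N : ℕ} (i j : Fin N) (s : ℝ) : L2 N →L[ℂ] L2 N :=
  free ħ N (-s) ∘L pairOp w i j ∘L free ħ N s

/-- The interaction `W_N = (1/N) ∑_{i<j} w(x_i - x_j)` on `L²(ℝ^{3N})`. -/
def interaction (w : Potential) (N : ℕ) : L2 N →L[ℂ] L2 N :=
  (1 / (N : ℂ)) • ∑ j : Fin N, ∑ i ∈ Finset.Iio j, pairOp w i j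

/-- The Hamiltonian `H_N = H_N⁰ + W_N` in `L²_S(ℝ^{3N})`, with domain `H²_S`. Both terms commute with
permutations of the particles when `w` is even, so that the projection `P_S` only records that the
value lies in `L²_S`. -/
def hamiltonian (ħ : ℝ) (w : Potential) (N : ℕ) : L2S N →ₗ.[ℂ] L2S N where
  domain := (kinetic ħ N).domain.comap (incl N).toLinearMap
  toFun := (symProj N).toLinearMap ∘ₗ
    ((kinetic ħ N).toFun ∘ₗ (incl N).toLinearMap.submoduleComap _ +
      (interaction w N).toLinearMap ∘ₗ (incl N).toLinearMap ∘ₗ Submodule.subtype _)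

/-! ### The unitary group generated by a Hamiltonian -/

/-- `U t = e^{-i T t / ħ}`: the family `U` is a strongly continuous one-parameter group of unitary
operators with infinitesimal generator exactly `-(i/ħ) T`. There is at most one such group, and by
Stone's theorem there is one exactly if `T` is self-adjoint. -/
structure IsUnitaryGroup {H : Type*} [NormedAddCommGroup H] [InnerProductSpace ℂ H]
    [CompleteSpace H] (ħ : ℝ) (T : H →ₗ.[ℂ] H) (U : ℝ → H →L[ℂ] H) : Prop where
  zero : U 0 = ContinuousLinearMap.id ℂ H
  add : ∀ s t, U (s + t) = U s ∘L U t
  unitary : ∀ t, U t ∈ unitary (H →L[ℂ] H)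
  continuous : ∀ ψ, Continuous fun t => U t ψ
  generator : ∀ ψ φ : H, HasDerivAt (fun t => U t ψ) φ 0 ↔
    ∃ hψ : ψ ∈ T.domain, φ = (-Complex.I / ħ) • T ⟨ψ, hψ⟩

open Classical in
/-- The unitary group `t ↦ e^{-i T t / ħ}` (zero if `T` does not generate one). -/
def unitaryGroup {H : Type*} [NormedAddCommGroup H] [InnerProductSpace ℂ H]
    [CompleteSpace H] (ħ : ℝ) (T : H →ₗ.[ℂ] H) : ℝ → H →L[ℂ] H :=
  if h : ∃ U, IsUnitaryGroup ħ T U then h.choose else 0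

/-- The propagator `e^{-i H_N t / ħ}` on `L²_S(ℝ^{3N})`. -/
def propagator (ħ : ℝ) (w : Potential) (N : ℕ) : ℝ → L2S N →L[ℂ] L2S N :=
  unitaryGroup ħ (hamiltonian ħ w N)

/-- The Heisenberg evolution `e^{i H_N t / ħ} A e^{-i H_N t / ħ}`. -/
def heisenberg (ħ : ℝ) (w : Potential) (N : ℕ) (t : ℝ) (A : L2S N →L[ℂ] L2S N) :
    L2S N →L[ℂ] L2S N :=
  propagator ħ w N (-t) ∘L A ∘L propagator ħ w N t

/-- The free Heisenberg evolution `A_t = e^{i H_N⁰ t / ħ} A e^{-i H_N⁰ t / ħ}` on `L²_S(ℝ^{3N})`,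
which `e^{-i H_N⁰ t / ħ}` leaves invariant. -/
def freeHeisenberg (ħ : ℝ) (N : ℕ) (t : ℝ) (A : L2S N →L[ℂ] L2S N) : L2S N →L[ℂ] L2S N :=
  compress (free ħ N (-t)) ∘L A ∘L compress (free ħ N t)

/-! ### Tree amplitudes and time-ordered integrals -/

/-- The tree amplitudes `g^{(n;p)}_{t₁,…,t_n}` at time `t`: `g^{(0;p)}` is the freely evolved `a_t`
and
`g^{(n;p)}_{t₁,…,t_n} = (i/ħ) ∑_{i ≤ p+n-1} [w^{i,p+n}_{t_n}, g^{(n-1;p)}_{t₁,…,t_{n-1}} ⊗ I]`. -/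
def treeAmplitude (ħ : ℝ) (w : Potential) {p : ℕ} (a : L2S p →L[ℂ] L2S p) (t : ℝ) :
    (n : ℕ) → (Fin n → ℝ) → (L2 (p + n) →L[ℂ] L2 (p + n))
  | 0, _ => free ħ p (-t) ∘L extendOp a ∘L free ħ p t
  | n + 1, τ =>
      let G : L2 (p + n + 1) →L[ℂ] L2 (p + n + 1) :=
        amplify (Nat.le_succ (p + n)) (treeAmplitude ħ w a t n (Fin.init τ))
      (Complex.I / ħ) • ∑ i : Fin (p + n),
        (pairOpAt ħ w i.castSucc (Fin.last (p + n)) (τ (Fin.last n)) ∘L G -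
          G ∘L pairOpAt ħ w i.castSucc (Fin.last (p + n)) (τ (Fin.last n)))

/-- The time-ordered integral `∫₀ᵗ dt₁ ∫₀^{t₁} dt₂ ⋯ ∫₀^{t_{n-1}} dt_n f(t₁, …, t_n)`. -/
def timeOrdered {X : Type*} [NormedAddCommGroup X] [NormedSpace ℝ X] :
    (n : ℕ) → ℝ → ((Fin n → ℝ) → X) → X
  | 0, _, f => f Fin.elim0
  | n + 1, t, f => ∫ s in (0 : ℝ)..t, timeOrdered n s fun τ => f (Fin.cons s τ)

/-- `B` is the time-ordered integral of the operator-valued function `F`, in the strong sense: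
`F` is strongly continuous and `B ψ = ∫₀ᵗ dt₁ ⋯ ∫₀^{t_{n-1}} dt_n F(t₁, …, t_n) ψ` for all `ψ`. -/
structure IsTimeOrderedIntegral {H : Type*} [NormedAddCommGroup H] [InnerProductSpace ℂ H]
    {n : ℕ} (t : ℝ) (F : (Fin n → ℝ) → H →L[ℂ] H) (B : H →L[ℂ] H) : Prop where
  continuous : ∀ ψ, Continuous fun τ => F τ ψ
  apply_eq : ∀ ψ, B ψ = timeOrdered n t fun τ => F τ ψ

end MeanField

end

open MeanField

/-! The proof is an iterated Duhamel expansion in the interaction picture. Write `e^{-iH_N t/ħ}` as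
the free propagator times `V t`, where `V` solves `V' = -(i/ħ) W_s V` with `W_s` the freely evolved
interaction on the bosonic space. The Heisenberg operator becomes `V(t)* A_t V(t)`, and `A_t` is the
observable of `g^{(0;p)}` (`observable_free_conj`). For fixed `X` the derivative of `V(s)* X V(s)`
is `V(s)* (i/ħ)[W_s, X] V(s)`, so everything rests on the commutator of `W_s` with an observable
`A_N^{(q)}(b)`.

Call the first `q` particles the head and the others the tail. Pairs inside the tail commute with `b
⊗ I`. Pairs joining head and tail give, by bosonic symmetry, `N - q` equal contributions for each
head particle. Since `N(N-1)⋯(N-q+1) N^{-q} · (N-q)/N` is the prefactor of order `q + 1`, their sum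
is exactly the observable of the next tree amplitude (`observable_treeStep`). Pairs inside the head,
the loop terms, are only `O(q²)` in number against the factor `1/N`; this is the whole error
(`norm_commutator_observable_sub_le`). As observables of order above `N` vanish, the expansion stops
by itself and leaves no remainder (`norm_sub_sum_timeOrderedIntegral_le`).

For the estimates, the `n`-th tree amplitude is bounded by `p(p+1)⋯(p+n-1) (2‖w‖/ħ)^n ‖a‖`, and the
rising factorial is at most `n! 2^{p+n}`. The volume `|t|^n/n!` of the time simplex cancels `n!`,
leaving a geometric series in `4‖w‖|t|/ħ ≤ κ`. The loop errors only add the factor `(p+m)²/N`,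
whence a constant depending on `p` and `κ` alone.

The unbounded part of `H_N` enters only through the free group, computed explicitly in Fourier space
with its exact generator. A bounded perturbation keeps the domain (`IsUnitaryGroup.perturb`), and a
unitary group is determined by its generator, which identifies `propagator`. Since `b ⊗ I` is known
only on product functions, its algebra comes from the density of their span (`ext_tensor`). -/

noncomputable section

namespace MeanField

/-! ### Time-ordered integrals -/

section TimeOrdered

variable {X : Type*} [NormedAddCommGroup X] [NormedSpace ℝ X]

/-- The recursion peels off the outermost time, whereas each Duhamel step creates a new innermost
one. The upper limit, the last entry of `(t, τ)`, is `t` itself when `n = 0`. -/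
theorem timeOrdered_succ_eq_snoc (n : ℕ) (t : ℝ) (f : (Fin (n + 1) → ℝ) → X) :
    timeOrdered (n + 1) t f = timeOrdered n t fun τ =>
      ∫ r in (0 : ℝ)..(Fin.cons t τ : Fin (n + 1) → ℝ) (Fin.last n),
        f (Fin.snoc (α := fun _ => ℝ) τ r) := by
  induction n generalizing t with
  | zero =>
    change (∫ s in (0 : ℝ)..t, f (Fin.cons s Fin.elim0)) =
      ∫ r in (0 : ℝ)..t, f (Fin.snoc (α := fun _ => ℝ) Fin.elim0 r)
    congr 1
    funext s
    congr 1
    funext i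
    fin_cases i
    rfl
  | succ n ih =>
    change (∫ s in (0 : ℝ)..t, timeOrdered (n + 1) s fun τ => f (Fin.cons s τ)) =
      ∫ s in (0 : ℝ)..t, timeOrdered n s fun τ =>
        ∫ r in (0 : ℝ)..(Fin.cons t (Fin.cons s τ) : Fin (n + 2) → ℝ) (Fin.last (n + 1)),
          f (Fin.snoc (α := fun _ => ℝ) (Fin.cons s τ) r)
    congr 1
    funext s
    rw [ih]
    congr 1
    funext τ
    rw [← Fin.succ_last, Fin.cons_succ]
    congr 1
    funext r
    rw [Fin.cons_snoc_eq_snoc_cons]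

/-- The parameter space is arbitrary because the induction turns the outermost time into a further
parameter. -/
theorem continuous_timeOrdered (n : ℕ) {Y : Type} [TopologicalSpace Y] [LocallyCompactSpace Y]
    {f : Y → (Fin n → ℝ) → X} (hf : Continuous fun z : Y × (Fin n → ℝ) => f z.1 z.2) :
    Continuous fun z : Y × ℝ => timeOrdered n z.2 (f z.1) := by
  induction n generalizing Y with
  | zero => exact hf.comp (continuous_fst.prodMk continuous_const)
  | succ n ih =>
    have h1 := ih (Y := Y × ℝ) (f := fun z τ => f z.1 (Fin.cons z.2 τ))
      (hf.comp (f := fun z : (Y × ℝ) × (Fin n → ℝ) =>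
        (z.1.1, (Fin.cons z.1.2 z.2 : Fin (n + 1) → ℝ))) (Continuous.prodMk (by fun_prop) (Continuous.finCons (by fun_prop) (by fun_prop))))
    have h2 : Continuous (Function.uncurry fun (z : Y × ℝ) (s : ℝ) =>
        timeOrdered n s fun τ => f z.1 (Fin.cons s τ)) :=
      h1.comp (f := fun x : (Y × ℝ) × ℝ => ((x.1.1, x.2), x.2)) (by fun_prop)
    exact intervalIntegral.continuous_parametric_intervalIntegral_of_continuous h2 continuous_snd

theorem continuous_timeOrdered_cons {n : ℕ} {f : (Fin (n + 1) → ℝ) → X} (hf : Continuous f) :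
    Continuous fun s => timeOrdered n s fun τ => f (Fin.cons s τ) := by
  refine (continuous_timeOrdered n (Y := ℝ) (f := fun s τ => f (Fin.cons s τ)) ?_).comp
    (f := fun s : ℝ => (s, s)) (by fun_prop)
  exact hf.comp (Continuous.finCons (by fun_prop) (by fun_prop))

theorem continuous_comp_cons {X : Type*} [TopologicalSpace X] {n : ℕ} {f : (Fin (n + 1) → ℝ) → X} (hf : Continuous f) (s : ℝ) :
    Continuous fun τ : Fin n → ℝ => f (Fin.cons s τ) :=
  hf.comp (Continuous.finCons (by fun_prop) (by fun_prop))

theorem timeOrdered_add (n : ℕ) (t : ℝ) {f g : (Fin n → ℝ) → X} (hf : Continuous f)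
    (hg : Continuous g) :
    timeOrdered n t (fun τ => f τ + g τ) = timeOrdered n t f + timeOrdered n t g := by
  induction n generalizing t with
  | zero => rfl
  | succ n ih =>
    simp only [timeOrdered]
    rw [← intervalIntegral.integral_add
      (continuous_timeOrdered_cons hf).continuousOn.intervalIntegrable
      (continuous_timeOrdered_cons hg).continuousOn.intervalIntegrable]
    congr 1
    funext s
    exact ih s (continuous_comp_cons hf s) (continuous_comp_cons hg s)

theorem timeOrdered_smul {𝕜 : Type*} [RCLike 𝕜] [NormedSpace 𝕜 X] [SMulCommClass ℝ 𝕜 X]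
    (n : ℕ) (t : ℝ) (c : 𝕜) (f : (Fin n → ℝ) → X) :
    timeOrdered n t (fun τ => c • f τ) = c • timeOrdered n t f := by
  induction n generalizing t with
  | zero => rfl
  | succ n ih =>
    simp only [timeOrdered, ih]
    exact intervalIntegral.integral_smul _ _

theorem ContinuousLinearMap.map_timeOrdered {Y : Type*} [NormedAddCommGroup Y] [NormedSpace ℝ Y]
    [CompleteSpace X] [CompleteSpace Y] (L : X →L[ℝ] Y) (n : ℕ) (t : ℝ) {f : (Fin n → ℝ) → X}
    (hf : Continuous f) :
    L (timeOrdered n t f) = timeOrdered n t fun τ => L (f τ) := by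
  induction n generalizing t with
  | zero => rfl
  | succ n ih =>
    simp only [timeOrdered]
    rw [← L.intervalIntegral_comp_comm
      (continuous_timeOrdered_cons hf).continuousOn.intervalIntegrable]
    congr 1
    funext s
    exact ih s (continuous_comp_cons hf s)

theorem abs_integral_abs_pow (n : ℕ) (t : ℝ) :
    |∫ s in (0 : ℝ)..t, |s| ^ n| = |t| ^ (n + 1) / (n + 1) := by
  wlog ht : 0 ≤ t generalizing t
  · have h := this (-t) (by linarith)
    rw [abs_neg] at h
    have h2 := intervalIntegral.integral_comp_neg (fun s : ℝ => |s| ^ n) (a := 0) (b := t)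
    simp only [abs_neg, neg_zero] at h2
    rw [← h, h2, intervalIntegral.integral_symm, abs_neg]
  · have h : ∫ s in (0 : ℝ)..t, |s| ^ n = ∫ s in (0 : ℝ)..t, s ^ n := by
      refine intervalIntegral.integral_congr fun s hs => ?_
      rw [Set.uIcc_of_le ht] at hs
      simp [abs_of_nonneg hs.1]
    rw [h, integral_pow, abs_of_nonneg ht, abs_of_nonneg]
    · simp
    · simp; positivity

/-- The factor is the volume of the time simplex; the absolute value covers negative `t`. -/
theorem norm_timeOrdered_le (n : ℕ) (t : ℝ) {f : (Fin n → ℝ) → X} {M : ℝ}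
    (hM : ∀ τ, ‖f τ‖ ≤ M) :
    ‖timeOrdered n t f‖ ≤ |t| ^ n / n.factorial * M := by
  induction n generalizing t with
  | zero => simpa [timeOrdered] using hM _
  | succ n ih =>
    have hM0 : 0 ≤ M := (norm_nonneg _).trans (hM 0)
    have h1 : ∀ s, ‖timeOrdered n s fun τ => f (Fin.cons s τ)‖ ≤ M / n.factorial * |s| ^ n := by
      intro s
      refine (ih s fun τ => hM _).trans (le_of_eq (by ring))
    have h2 := intervalIntegral.norm_integral_le_abs_of_norm_le (μ := volume) (a := 0) (b := t)
      (Filter.Eventually.of_forall h1)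
      (Continuous.intervalIntegrable (by fun_prop) _ _)
    refine h2.trans (le_of_eq ?_)
    rw [intervalIntegral.integral_const_mul, abs_mul, abs_integral_abs_pow, abs_of_nonneg
      (by positivity), Nat.factorial_succ]
    push_cast
    field_simp

end TimeOrdered

/-! ### Strongly continuous families of operators -/

section Strong

variable {H K : Type*} [NormedAddCommGroup H] [InnerProductSpace ℂ H]
  [NormedAddCommGroup K] [InnerProductSpace ℂ K]

/-- Split `T y (x y)` into `T y (x y - x y₀)`, controlled by the uniform bound, and `T y (x y₀)`.
This lets strongly continuous families be composed without continuity in norm. -/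
theorem continuous_apply_of_bounded {Y : Type*} [TopologicalSpace Y] {T : Y → H →L[ℂ] K} {M : ℝ}
    (hM : ∀ y, ‖T y‖ ≤ M) (hT : ∀ ψ, Continuous fun y => T y ψ) {x : Y → H} (hx : Continuous x) :
    Continuous fun y => T y (x y) := by
  refine continuous_iff_continuousAt.2 fun y₀ => ?_
  have h1 : Filter.Tendsto (fun y => T y (x y - x y₀)) (nhds y₀) (nhds 0) := by
    refine squeeze_zero_norm (a := fun y => M * ‖x y - x y₀‖) (fun y => ?_) ?_
    · exact ((T y).le_opNorm _).trans (mul_le_mul_of_nonneg_right (hM y) (norm_nonneg _))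
    · have : Continuous fun y => M * ‖x y - x y₀‖ := by fun_prop
      simpa using this.tendsto y₀
  have h2 := h1.add ((hT (x y₀)).tendsto y₀)
  simpa [ContinuousAt] using h2

/-- By the uniform bound, `y ↦ T y ψ` is a uniform limit of the orbits of vectors in the span. -/
theorem continuous_apply_of_dense {Y : Type*} [TopologicalSpace Y] {T : Y → H →L[ℂ] K} {M : ℝ}
    (hM : ∀ y, ‖T y‖ ≤ M) {D : Set H} (hD : Dense (Submodule.span ℂ D : Set H))
    (hT : ∀ ψ ∈ D, Continuous fun y => T y ψ) (ψ : H) : Continuous fun y => T y ψ := by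
  have hspan : ∀ ψ ∈ Submodule.span ℂ D, Continuous fun y => T y ψ := by
    intro ψ hψ
    induction hψ using Submodule.span_induction with
    | mem x hx => exact hT x hx
    | zero => simpa using continuous_const
    | add x y _ _ hx hy =>
      simp only [map_add]
      exact Continuous.add hx hy
    | smul c x _ hx =>
      simp only [map_smul]
      exact Continuous.const_smul hx c
  obtain ⟨u, hu, hlim⟩ := mem_closure_iff_seq_limit.1 (hD ψ)
  have h0 : Filter.Tendsto (fun n => M * ‖u n - ψ‖) Filter.atTop (nhds 0) := by
    have := ((tendsto_iff_norm_sub_tendsto_zero.1 hlim).const_mul M)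
    simpa using this
  refine continuous_of_uniform_approx_of_continuous fun U hU => ?_
  obtain ⟨ε, hε, hεU⟩ := Metric.mem_uniformity_dist.1 hU
  obtain ⟨n, hn⟩ := (h0.eventually (gt_mem_nhds hε)).exists
  refine ⟨fun y => T y (u n), hspan _ (hu n), fun y => hεU ?_⟩
  rw [dist_comm, dist_eq_norm, ← map_sub]
  exact (((T y).le_opNorm _).trans (mul_le_mul_of_nonneg_right (hM y) (norm_nonneg _))).trans_lt hn

end Strong

/-! ### Strong integrals of operators and the iterated Duhamel expansion -/

section Expansion

variable {H : Type*} [NormedAddCommGroup H] [InnerProductSpace ℂ H]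

theorem exists_isTimeOrderedIntegral {n : ℕ} (t : ℝ) {F : (Fin n → ℝ) → H →L[ℂ] H} {M : ℝ}
    (hM : ∀ τ, ‖F τ‖ ≤ M) (hF : ∀ ψ, Continuous fun τ => F τ ψ) :
    ∃ B : H →L[ℂ] H, IsTimeOrderedIntegral t F B ∧ ‖B‖ ≤ |t| ^ n / n.factorial * M := by
  have hM0 : 0 ≤ M := (norm_nonneg _).trans (hM 0)
  let L : H →ₗ[ℂ] H :=
    { toFun := fun ψ => timeOrdered n t fun τ => F τ ψ
      map_add' := fun ψ φ => by
        simp only [map_add]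
        exact timeOrdered_add n t (hF ψ) (hF φ)
      map_smul' := fun c ψ => by
        simp only [map_smul]
        exact timeOrdered_smul n t c _ }
  have hL : ∀ ψ, ‖L ψ‖ ≤ |t| ^ n / n.factorial * M * ‖ψ‖ := fun ψ => by
    rw [mul_assoc]
    exact norm_timeOrdered_le n t fun τ =>
      ((F τ).le_opNorm _).trans (mul_le_mul_of_nonneg_right (hM τ) (norm_nonneg _))
  exact ⟨L.mkContinuous _ hL, ⟨hF, fun ψ => rfl⟩, L.mkContinuous_norm_le (by positivity) hL⟩

/-- The interaction-picture propagators `V s` of the bounded family `W s`. -/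
structure IsInteractionPropagator (ħ : ℝ) (W V : ℝ → H →L[ℂ] H) : Prop where
  zero : V 0 = ContinuousLinearMap.id ℂ H
  norm_apply : ∀ s ψ, ‖V s ψ‖ = ‖ψ‖
  hasDerivAt : ∀ ψ s, HasDerivAt (fun s => V s ψ) ((-Complex.I / ħ) • W s (V s ψ)) s

theorem IsInteractionPropagator.continuous {ħ : ℝ} {W V : ℝ → H →L[ℂ] H}
    (hV : IsInteractionPropagator ħ W V) (ψ : H) : Continuous fun s => V s ψ :=
  continuous_iff_continuousAt.2 fun s => (hV.hasDerivAt ψ s).continuousAt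

/-- The Heisenberg equation in weak form: only orbits `V s ψ` are differentiated, so no norm
differentiability of `V` is needed. Symmetry of `W s` moves it across the inner product to form the
commutator. -/
theorem IsInteractionPropagator.hasDerivAt_inner {ħ : ℝ} {W V : ℝ → H →L[ℂ] H}
    (hV : IsInteractionPropagator ħ W V) (hW : ∀ s x y, ⟪W s x, y⟫_ℂ = ⟪x, W s y⟫_ℂ)
    (X : H →L[ℂ] H) (φ ψ : H) (s : ℝ) :
    HasDerivAt (fun s => ⟪V s φ, X (V s ψ)⟫_ℂ)
      ⟪V s φ, ((Complex.I / ħ) • (W s ∘L X - X ∘L W s)) (V s ψ)⟫_ℂ s := by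
  have h1 := (hV.hasDerivAt φ s).inner ℂ
    ((X.restrictScalars ℝ).hasFDerivAt.comp_hasDerivAt s (hV.hasDerivAt ψ s))
  refine h1.congr_deriv ?_
  simp only [ContinuousLinearMap.coe_restrictScalars', Function.comp_apply, map_smul,
    inner_smul_left, inner_smul_right, hW, smul_apply,
    sub_apply, ContinuousLinearMap.comp_apply, inner_sub_right]
  simp
  ring

/-- Test with `φ = D ψ` and cancel one factor `‖D ψ‖`. -/
theorem norm_le_of_forall_inner_le {D : H →L[ℂ] H} {M : ℝ} (hM0 : 0 ≤ M)
    (h : ∀ φ ψ, ‖⟪φ, D ψ⟫_ℂ‖ ≤ M * ‖φ‖ * ‖ψ‖) : ‖D‖ ≤ M := by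
  refine D.opNorm_le_bound hM0 fun ψ => ?_
  have h1 := h (D ψ) ψ
  rw [inner_self_eq_norm_sq_to_K] at h1
  have h2 : ‖D ψ‖ * ‖D ψ‖ ≤ ‖D ψ‖ * (M * ‖ψ‖) := by
    have : ‖((‖D ψ‖ : ℝ) : ℂ) ^ 2‖ = ‖D ψ‖ * ‖D ψ‖ := by simp [sq]
    calc _ = _ := this.symm
      _ ≤ _ := h1
      _ = _ := by ring
  rcases (norm_nonneg (D ψ)).eq_or_lt with h0 | h0
  · rw [← h0]; positivity
  · exact le_of_mul_le_mul_left h2 h0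

/-- Iterated Duhamel expansion, with errors: if the commutator of `W s` with `F m τ` is
`F (m + 1) (τ, s)` up to an error of norm at most `e m`, and `F M = 0`, then the conjugation of `F 0`
by the propagator is the sum of the time-ordered integrals up to the integrated errors. -/
theorem norm_sub_sum_timeOrderedIntegral_le [CompleteSpace H] {ħ : ℝ} {W V : ℝ → H →L[ℂ] H}
    (hV : IsInteractionPropagator ħ W V) (hW : ∀ s x y, ⟪W s x, y⟫_ℂ = ⟪x, W s y⟫_ℂ)
    (hWc : ∀ ψ, Continuous fun s => W s ψ) {k : ℝ} (hWb : ∀ s, ‖W s‖ ≤ k) (t : ℝ)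
    (F : (m : ℕ) → (Fin m → ℝ) → H →L[ℂ] H) {b e : ℕ → ℝ} (hFb : ∀ m τ, ‖F m τ‖ ≤ b m)
    (B : ℕ → H →L[ℂ] H) (hB : ∀ m, IsTimeOrderedIntegral t (F m) (B m))
    (he : ∀ m τ s, ‖(Complex.I / ħ) • (W s ∘L F m τ - F m τ ∘L W s) -
      F (m + 1) (Fin.snoc (α := fun _ => ℝ) τ s)‖ ≤ e m)
    {M : ℕ} (hM : ∀ τ, F M τ = 0) :
    ‖(V t).adjoint ∘L F 0 Fin.elim0 ∘L V t - ∑ m ∈ Finset.range M, B m‖ ≤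
      ∑ m ∈ Finset.range M, |t| ^ (m + 1) / (m + 1).factorial * e m := by
  have he0 : ∀ m, 0 ≤ e m := fun m => (norm_nonneg _).trans (he m 0 0)
  refine norm_le_of_forall_inner_le (Finset.sum_nonneg fun m _ => by
    have := he0 m; positivity) fun φ ψ => ?_
  have hinit : ∀ m, Continuous fun τ : Fin (m + 1) → ℝ => Fin.init τ := fun m =>
    continuous_pi fun i => by unfold Fin.init; fun_prop
  have hsnoc : ∀ m (τ : Fin m → ℝ), Continuous fun r : ℝ => Fin.snoc (α := fun _ => ℝ) τ r := by
    refine fun m τ => continuous_pi fun i => ?_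
    refine Fin.lastCases ?_ (fun j => ?_) i
    · simp only [Fin.snoc_last]; fun_prop
    · simp only [Fin.snoc_castSucc]; fun_prop
  have hlast : ∀ m, Continuous fun τ : Fin m → ℝ =>
      (Fin.cons t τ : Fin (m + 1) → ℝ) (Fin.last m) := by
    intro m
    cases m with
    | zero => exact continuous_const
    | succ m => simp only [← Fin.succ_last, Fin.cons_succ]; fun_prop
  have hVc : ∀ {Y : Type} [TopologicalSpace Y] (l : Y → ℝ) (ψ : H), Continuous l →
      Continuous fun y => V (l y) ψ := fun l ψ hl => (hV.continuous ψ).comp hl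
  -- The defect of the `m`-th commutator identity, as a function of all `m + 1` times.
  let D : (m : ℕ) → (Fin (m + 1) → ℝ) → H →L[ℂ] H := fun m τ =>
    (Complex.I / ħ) • (W (τ (Fin.last m)) ∘L F m (Fin.init τ) -
      F m (Fin.init τ) ∘L W (τ (Fin.last m))) - F (m + 1) τ
  have hDb : ∀ m τ, ‖D m τ‖ ≤ e m := fun m τ => by
    have := he m (Fin.init τ) (τ (Fin.last m))
    rwa [Fin.snoc_init_self] at this
  have hDc : ∀ m ψ, Continuous fun τ => D m τ ψ := by
    intro m ψ
    have a1 : Continuous fun τ : Fin (m + 1) → ℝ => F m (Fin.init τ) ψ :=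
      ((hB m).continuous ψ).comp (hinit m)
    have a2 : Continuous fun τ : Fin (m + 1) → ℝ =>
        W (τ (Fin.last m)) (F m (Fin.init τ) ψ) :=
      continuous_apply_of_bounded (fun τ => hWb _)
        (fun ψ => (hWc ψ).comp (continuous_apply (Fin.last m))) a1
    have a3 : Continuous fun τ : Fin (m + 1) → ℝ =>
        F m (Fin.init τ) (W (τ (Fin.last m)) ψ) :=
      continuous_apply_of_bounded (fun τ => hFb _ _)
        (fun ψ => ((hB m).continuous ψ).comp (hinit m))
        ((hWc ψ).comp (continuous_apply (Fin.last m)))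
    exact ((a2.sub a3).const_smul (Complex.I / (ħ : ℂ))).sub ((hB (m + 1)).continuous ψ)
  -- The innermost time, or `t` if there is none; the remaining propagators sit at this time.
  let l : (m : ℕ) → (Fin m → ℝ) → ℝ := fun m τ =>
    (Fin.cons t τ : Fin (m + 1) → ℝ) (Fin.last m)
  let q : (m : ℕ) → (Fin m → ℝ) → ℂ := fun m τ => ⟪V (l m τ) φ, F m τ (V (l m τ) ψ)⟫_ℂ
  let d : (m : ℕ) → (Fin (m + 1) → ℝ) → ℂ := fun m τ =>
    ⟪V (τ (Fin.last m)) φ, D m τ (V (τ (Fin.last m)) ψ)⟫_ℂ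
  have hq : ∀ m, Continuous (q m) := fun m =>
    (hVc _ φ (hlast m)).inner (continuous_apply_of_bounded (hFb m) (hB m).continuous
      (hVc _ ψ (hlast m)))
  have hd : ∀ m, Continuous (d m) := fun m =>
    (hVc _ φ (continuous_apply _)).inner (continuous_apply_of_bounded (hDb m) (hDc m)
      (hVc _ ψ (continuous_apply _)))
  have hlsnoc : ∀ m (τ : Fin m → ℝ) r, l (m + 1) (Fin.snoc (α := fun _ => ℝ) τ r) = r := by
    intro m τ r
    change (Fin.cons t (Fin.snoc (α := fun _ => ℝ) τ r) : Fin (m + 2) → ℝ) (Fin.last (m + 1)) = r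
    rw [← Fin.succ_last, Fin.cons_succ, Fin.snoc_last]
  -- One Duhamel step, the fundamental theorem of calculus on `[0, l m τ]`: the value at `0`, where
  -- `V = id`, integrates to `B m`, and the derivative splits into the next term and the defect.
  have hstep : ∀ m, timeOrdered m t (q m) =
      ⟪φ, B m ψ⟫_ℂ + timeOrdered (m + 1) t (q (m + 1)) + timeOrdered (m + 1) t (d m) := by
    intro m
    have e1 : ∀ τ, q m τ = ⟪φ, F m τ ψ⟫_ℂ +
        ∫ r in (0 : ℝ)..l m τ, (q (m + 1) (Fin.snoc (α := fun _ => ℝ) τ r) +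
          d m (Fin.snoc (α := fun _ => ℝ) τ r)) := by
      intro τ
      have hint : ∀ r, q (m + 1) (Fin.snoc (α := fun _ => ℝ) τ r) +
          d m (Fin.snoc (α := fun _ => ℝ) τ r) =
          ⟪V r φ, ((Complex.I / ħ) • (W r ∘L F m τ - F m τ ∘L W r)) (V r ψ)⟫_ℂ := by
        intro r
        simp only [q, d, D, hlsnoc, Fin.snoc_last, Fin.init_snoc]
        rw [← inner_add_right, ← add_apply, add_sub_cancel]
      have hc : Continuous fun r => q (m + 1) (Fin.snoc (α := fun _ => ℝ) τ r) +
          d m (Fin.snoc (α := fun _ => ℝ) τ r) :=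
        ((hq (m + 1)).comp (hsnoc m τ)).add ((hd m).comp (hsnoc m τ))
      have h2 := intervalIntegral.integral_eq_sub_of_hasDerivAt (a := 0) (b := l m τ)
        (fun r _ => (hV.hasDerivAt_inner hW (F m τ) φ ψ r).congr_deriv (hint r).symm)
        (hc.intervalIntegrable _ _)
      rw [h2, hV.zero]
      simp [q]
    have e2 : q m = fun τ => ⟪φ, F m τ ψ⟫_ℂ +
        ∫ r in (0 : ℝ)..l m τ, (q (m + 1) (Fin.snoc (α := fun _ => ℝ) τ r) +
          d m (Fin.snoc (α := fun _ => ℝ) τ r)) := funext e1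
    have c1 : Continuous fun τ => ⟪φ, F m τ ψ⟫_ℂ :=
      continuous_const.inner ((hB m).continuous ψ)
    have c2 : Continuous fun τ => ∫ r in (0 : ℝ)..l m τ,
        (q (m + 1) (Fin.snoc (α := fun _ => ℝ) τ r) +
          d m (Fin.snoc (α := fun _ => ℝ) τ r)) := by
      -- The integrand and the upper limit both depend on `τ`; continuity is read off from `e1`,
      -- where the integral is a difference of continuous functions.
      have : (fun τ => ∫ r in (0 : ℝ)..l m τ, (q (m + 1) (Fin.snoc (α := fun _ => ℝ) τ r) +
          d m (Fin.snoc (α := fun _ => ℝ) τ r))) = fun τ => q m τ - ⟪φ, F m τ ψ⟫_ℂ := by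
        funext τ; rw [e1 τ]; ring
      rw [this]
      exact (hq m).sub c1
    rw [e2, timeOrdered_add m t c1 c2, ← timeOrdered_succ_eq_snoc m t
      (fun τ => q (m + 1) τ + d m τ), timeOrdered_add _ t (hq _) (hd _), ← add_assoc,
      (hB m).apply_eq]
    congr 2
    exact (ContinuousLinearMap.map_timeOrdered ((innerSL ℂ φ).restrictScalars ℝ) m t
      ((hB m).continuous ψ)).symm
  have hsum : ∀ M, timeOrdered 0 t (q 0) = ∑ m ∈ Finset.range M, ⟪φ, B m ψ⟫_ℂ +
      timeOrdered M t (q M) + ∑ m ∈ Finset.range M, timeOrdered (m + 1) t (d m) := by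
    intro M
    induction M with
    | zero => simp
    | succ M ih => rw [ih, hstep M, Finset.sum_range_succ, Finset.sum_range_succ]; ring
  have h0 : timeOrdered 0 t (q 0) = ⟪φ, ((V t).adjoint ∘L F 0 Fin.elim0 ∘L V t) ψ⟫_ℂ := by
    simp only [ContinuousLinearMap.comp_apply, ContinuousLinearMap.adjoint_inner_right]
    rfl
  have hqM : timeOrdered M t (q M) = 0 := by
    have := norm_timeOrdered_le M t (f := q M) (M := 0) (fun τ => by simp [q, hM])
    simpa using this
  have hfin := hsum M
  rw [h0, hqM, add_zero] at hfin
  rw [sub_apply, inner_sub_right, hfin, sum_apply,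
    inner_sum, add_sub_cancel_left, Finset.sum_mul, Finset.sum_mul]
  refine (norm_sum_le _ _).trans (Finset.sum_le_sum fun m _ => ?_)
  rw [mul_assoc, mul_assoc]
  refine norm_timeOrdered_le (m + 1) t fun τ => ?_
  calc ‖d m τ‖ ≤ ‖V (τ (Fin.last m)) φ‖ * ‖D m τ (V (τ (Fin.last m)) ψ)‖ := norm_inner_le_norm _ _
    _ ≤ ‖φ‖ * (e m * ‖ψ‖) := by
      rw [hV.norm_apply]
      refine mul_le_mul_of_nonneg_left ?_ (norm_nonneg _)
      refine ((D m τ).le_opNorm _).trans ?_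
      rw [hV.norm_apply]
      exact mul_le_mul_of_nonneg_right (hDb m τ) (norm_nonneg _)
    _ = _ := by ring

end Expansion

/-! ### One-parameter unitary groups -/

section Group

variable {H : Type*} [NormedAddCommGroup H] [InnerProductSpace ℂ H] [CompleteSpace H]

/-- An isometry has its adjoint as left inverse; `U (-t)` is a right inverse, so the two coincide.
-/
theorem mem_unitary_of_group {U : ℝ → H →L[ℂ] H} (h0 : U 0 = ContinuousLinearMap.id ℂ H)
    (hadd : ∀ s t, U (s + t) = U s ∘L U t) (hn : ∀ t ψ, ‖U t ψ‖ = ‖ψ‖) (t : ℝ) :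
    U t ∈ unitary (H →L[ℂ] H) := by
  have h1 : star (U t) * U t = 1 := (U t).norm_map_iff_adjoint_comp_self.1 (hn t)
  have h2 : U t * U (-t) = 1 := by
    change U t ∘L U (-t) = 1
    rw [← hadd, add_neg_cancel, h0]; rfl
  exact Unitary.mem_iff.2 ⟨h1, by rwa [left_inv_eq_right_inv h1 h2]⟩

namespace IsUnitaryGroup

variable {ħ : ℝ} {T : H →ₗ.[ℂ] H} {U : ℝ → H →L[ℂ] H}

theorem norm_apply (h : IsUnitaryGroup ħ T U) (t : ℝ) (ψ : H) : ‖U t ψ‖ = ‖ψ‖ :=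
  (U t).norm_map_iff_adjoint_comp_self.2 (Unitary.mem_iff.1 (h.unitary t)).1 ψ

theorem norm_le (h : IsUnitaryGroup ħ T U) (t : ℝ) : ‖U t‖ ≤ 1 :=
  (U t).opNorm_le_bound zero_le_one fun ψ => by rw [h.norm_apply, one_mul]

theorem neg_apply_apply (h : IsUnitaryGroup ħ T U) (t : ℝ) (ψ : H) : U (-t) (U t ψ) = ψ := by
  rw [← ContinuousLinearMap.comp_apply, ← h.add, neg_add_cancel, h.zero]; rfl

theorem inner_neg_apply (h : IsUnitaryGroup ħ T U) (t : ℝ) (φ ψ : H) :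
    ⟪U (-t) φ, ψ⟫_ℂ = ⟪φ, U t ψ⟫_ℂ := by
  have h1 := ((U (-t)).inner_map_map_iff_adjoint_comp_self).2
    (Unitary.mem_iff.1 (h.unitary (-t))).1 φ (U t ψ)
  rwa [h.neg_apply_apply] at h1

theorem hasDerivAt (h : IsUnitaryGroup ħ T U) {ψ φ : H}
    (hψ : HasDerivAt (fun t => U t ψ) φ 0) (t : ℝ) : HasDerivAt (fun t => U t ψ) (U t φ) t := by
  have h1 : HasDerivAt (fun s => U (s - t) ψ) φ t := by
    have := HasDerivAt.scomp (x := t) (h := fun s => s - t) (h' := 1) (g₁ := fun t => U t ψ)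
      (g₁' := φ) (by simpa using hψ) ((hasDerivAt_id t).sub_const t)
    simpa [Function.comp_def] using this
  have h2 := ((U t).restrictScalars ℝ).hasFDerivAt.comp_hasDerivAt t h1
  refine h2.congr_of_eventuallyEq (Filter.Eventually.of_forall fun s => ?_)
  simp [← ContinuousLinearMap.comp_apply, ← h.add]

theorem hasDerivAt_apply (h : IsUnitaryGroup ħ T U) {ψ φ : H}
    (hψ : HasDerivAt (fun t => U t ψ) φ 0) (t : ℝ) :
    HasDerivAt (fun s => U s (U t ψ)) (U t φ) 0 := by
  have h2 := ((U t).restrictScalars ℝ).hasFDerivAt.comp_hasDerivAt 0 hψ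
  refine h2.congr_of_eventuallyEq (Filter.Eventually.of_forall fun s => ?_)
  simp [← ContinuousLinearMap.comp_apply, ← h.add, add_comm]

/-- The generator of a unitary group is skew-adjoint. -/
theorem inner_add_inner_eq_zero (h : IsUnitaryGroup ħ T U) {ψ φ ψ' φ' : H}
    (hψ : HasDerivAt (fun t => U t ψ) ψ' 0) (hφ : HasDerivAt (fun t => U t φ) φ' 0) :
    ⟪ψ, φ'⟫_ℂ + ⟪ψ', φ⟫_ℂ = 0 := by
  have h1 := hψ.inner ℂ hφ
  have h2 : (fun t => ⟪U t ψ, U t φ⟫_ℂ) = fun _ => ⟪ψ, φ⟫_ℂ := by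
    funext t
    exact ((U t).inner_map_map_iff_adjoint_comp_self).2 (Unitary.mem_iff.1 (h.unitary t)).1 ψ φ
  rw [h2] at h1
  have h3 := h1.unique (hasDerivAt_const 0 _)
  simpa [h.zero] using h3

/-- The domain of the generator is dense. -/
theorem dense_domain (h : IsUnitaryGroup ħ T U) :
    Dense {ψ : H | ∃ φ, HasDerivAt (fun t => U t ψ) φ 0} := by
  intro ψ
  -- Averages of an orbit lie in the domain, since applying `U t` only shifts the limits of
  -- integration, and they tend to `ψ`. The default value `m 0 = 0` is harmless.
  let m : ℝ → H := fun ε => ε⁻¹ • ∫ s in (0 : ℝ)..ε, U s ψ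
  have hint : ∀ a b, IntervalIntegrable (fun s => U s ψ) volume a b :=
    fun a b => (h.continuous ψ).intervalIntegrable a b
  have hF : ∀ x, HasDerivAt (fun u => ∫ s in (0 : ℝ)..u, U s ψ) (U x ψ) x := fun x =>
    intervalIntegral.integral_hasDerivAt_right (hint _ _)
      ((h.continuous ψ).stronglyMeasurableAtFilter _ _) (h.continuous ψ).continuousAt
  have hm : ∀ ε, m ε ∈ {ψ : H | ∃ φ, HasDerivAt (fun t => U t ψ) φ 0} := by
    intro ε
    refine ⟨ε⁻¹ • (U ε ψ - U 0 ψ), ?_⟩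
    have h1 : ∀ t, U t (m ε) = ε⁻¹ •
        ((∫ s in (0 : ℝ)..(t + ε), U s ψ) - ∫ s in (0 : ℝ)..t, U s ψ) := by
      intro t
      have e1 : U t (∫ s in (0 : ℝ)..ε, U s ψ) = ∫ s in (0 : ℝ)..ε, U (t + s) ψ := by
        rw [← ContinuousLinearMap.intervalIntegral_comp_comm _ (hint _ _)]
        simp [h.add]
      have e2 : U t (ε⁻¹ • ∫ s in (0 : ℝ)..ε, U s ψ) = ε⁻¹ • U t (∫ s in (0 : ℝ)..ε, U s ψ) :=
        ((U t).restrictScalars ℝ).map_smul _ _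
      rw [e2, e1, intervalIntegral.integral_comp_add_left (fun s => U s ψ), add_zero,
        ← intervalIntegral.integral_interval_sub_left (hint _ _) (hint _ _)]
    simp only [h1]
    refine HasDerivAt.const_smul _ (HasDerivAt.sub ?_ (hF 0))
    have h3 := HasDerivAt.comp_add_const (f := fun u => ∫ s in (0 : ℝ)..u, U s ψ) 0 ε
      (by simpa using hF ε)
    exact h3
  have hlim : Filter.Tendsto m (nhdsWithin 0 {0}ᶜ) (nhds ψ) := by
    have := (hF 0).tendsto_slope_zero
    simpa [h.zero] using this
  exact mem_closure_of_tendsto hlim (Filter.Eventually.of_forall hm)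

/-- For `ψ` in the domain `⟪U t ψ, U' t ψ⟫` is constant, the common generator being skew-symmetric;
as both groups are isometric, `‖U t ψ - U' t ψ‖ = 0`. Density of the domain concludes. -/
theorem eq_of_same_generator (h : IsUnitaryGroup ħ T U) {U' : ℝ → H →L[ℂ] H}
    (h' : IsUnitaryGroup ħ T U') : U = U' := by
  funext t
  refine ContinuousLinearMap.ext_on (h.dense_domain.mono Submodule.subset_span) ?_
  rintro ψ ⟨ψ', hψ⟩
  have hgen : ∀ χ χ' : H, HasDerivAt (fun t => U t χ) χ' 0 ↔ HasDerivAt (fun t => U' t χ) χ' 0 :=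
    fun χ χ' => (h.generator χ χ').trans (h'.generator χ χ').symm
  have hψ' := (hgen ψ ψ').1 hψ
  have hd : ∀ t, HasDerivAt (fun t => ⟪U t ψ, U' t ψ⟫_ℂ) 0 t := by
    intro t
    refine ((h.hasDerivAt hψ t).inner ℂ (h'.hasDerivAt hψ' t)).congr_deriv ?_
    exact h.inner_add_inner_eq_zero (h.hasDerivAt_apply hψ t)
      ((hgen _ _).2 (h'.hasDerivAt_apply hψ' t))
  have hc := is_const_of_deriv_eq_zero (fun t => (hd t).differentiableAt)
    (fun t => (hd t).deriv) t 0
  simp only [h.zero, h'.zero, ContinuousLinearMap.id_apply] at hc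
  have h1 : ‖U t ψ - U' t ψ‖ ^ 2 = 0 := by
    rw [@norm_sub_sq ℂ, hc, h.norm_apply, h'.norm_apply, inner_self_eq_norm_sq]
    ring
  exact sub_eq_zero.1 (norm_eq_zero.1 (pow_eq_zero_iff two_ne_zero |>.1 h1))

theorem unitaryGroup_eq (h : IsUnitaryGroup ħ T U) : unitaryGroup ħ T = U := by
  have hex : ∃ U, IsUnitaryGroup ħ T U := ⟨U, h⟩
  unfold unitaryGroup
  rw [dif_pos hex]
  exact eq_of_same_generator hex.choose_spec h

end IsUnitaryGroup

/-! ### The interaction picture -/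

theorem neg_I_div_inner_add {H : Type*} [NormedAddCommGroup H] [InnerProductSpace ℂ H] (ħ : ℝ)
    {W : H →L[ℂ] H} (hW : ∀ x y, ⟪W x, y⟫_ℂ = ⟪x, W y⟫_ℂ)
    (x : H) :
    ⟪x, (-Complex.I / ħ) • W x⟫_ℂ + ⟪(-Complex.I / ħ) • W x, x⟫_ℂ = 0 := by
  rw [inner_smul_left, inner_smul_right, hW]
  simp
  ring

/-- Skew-symmetry of `-(i/ħ) W s` makes `⟪x, x⟫` constant. Applied to a difference of solutions,
this is uniqueness for the linear equation. -/
theorem norm_eq_of_hasDerivAt {H : Type*} [NormedAddCommGroup H] [InnerProductSpace ℂ H] {ħ : ℝ}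
    {W : ℝ → H →L[ℂ] H}
    (hW : ∀ s x y, ⟪W s x, y⟫_ℂ = ⟪x, W s y⟫_ℂ) {x : ℝ → H}
    (hx : ∀ s, HasDerivAt x ((-Complex.I / ħ) • W s (x s)) s) (s : ℝ) : ‖x s‖ = ‖x 0‖ := by
  have hd : ∀ t, HasDerivAt (fun t => ⟪x t, x t⟫_ℂ) 0 t := fun t =>
    ((hx t).inner ℂ (hx t)).congr_deriv (neg_I_div_inner_add ħ (hW t) (x t))
  have hc := is_const_of_deriv_eq_zero (fun t => (hd t).differentiableAt)
    (fun t => (hd t).deriv) s 0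
  simp only [inner_self_eq_norm_sq_to_K] at hc
  exact (sq_eq_sq₀ (norm_nonneg _) (norm_nonneg _)).1 (by exact_mod_cast hc)

theorem eq_of_hasDerivAt {H : Type*} [NormedAddCommGroup H] [InnerProductSpace ℂ H] {ħ : ℝ}
    {W : ℝ → H →L[ℂ] H}
    (hW : ∀ s x y, ⟪W s x, y⟫_ℂ = ⟪x, W s y⟫_ℂ) {x y : ℝ → H}
    (hx : ∀ s, HasDerivAt x ((-Complex.I / ħ) • W s (x s)) s)
    (hy : ∀ s, HasDerivAt y ((-Complex.I / ħ) • W s (y s)) s) (h0 : x 0 = y 0) : x = y := by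
  funext s
  have h1 := norm_eq_of_hasDerivAt hW (x := fun s => x s - y s) (fun s => by
    refine ((hx s).sub (hy s)).congr_deriv ?_
    rw [map_sub, smul_sub]) s
  rw [h0, sub_self, norm_zero] at h1
  exact sub_eq_zero.1 (norm_eq_zero.1 h1)

/-- The product `A (τ 0) ∘ A (τ 1) ∘ ⋯` of the values of a family of operators. -/
def orderedProd {H : Type*} [NormedAddCommGroup H] [InnerProductSpace ℂ H]
    (A : ℝ → H →L[ℂ] H) : (n : ℕ) → (Fin n → ℝ) → H →L[ℂ] H
  | 0, _ => ContinuousLinearMap.id ℂ H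
  | n + 1, τ => A (τ 0) ∘L orderedProd A n (Fin.tail τ)

theorem norm_orderedProd_le {H : Type*} [NormedAddCommGroup H] [InnerProductSpace ℂ H] {A : ℝ → H →L[ℂ] H} {k : ℝ} (hk : ∀ s, ‖A s‖ ≤ k) (n : ℕ)
    (τ : Fin n → ℝ) : ‖orderedProd A n τ‖ ≤ k ^ n := by
  induction n with
  | zero => simpa [orderedProd] using ContinuousLinearMap.norm_id_le
  | succ n ih =>
    rw [pow_succ']
    exact (ContinuousLinearMap.opNorm_comp_le _ _).trans (mul_le_mul (hk _) (ih _)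
      (norm_nonneg _) ((norm_nonneg _).trans (hk 0)))

theorem continuous_orderedProd {H : Type*} [NormedAddCommGroup H] [InnerProductSpace ℂ H]
    {A : ℝ → H →L[ℂ] H} {k : ℝ} (hk : ∀ s, ‖A s‖ ≤ k)
    (hA : ∀ ψ, Continuous fun s => A s ψ) (n : ℕ) (ψ : H) :
    Continuous fun τ => orderedProd A n τ ψ := by
  induction n with
  | zero => exact continuous_const
  | succ n ih =>
    refine continuous_apply_of_bounded (T := fun τ : Fin (n + 1) → ℝ => A (τ 0))
      (fun τ => hk _) (fun ψ => (hA ψ).comp (continuous_apply 0))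
      (ih.comp (f := fun τ : Fin (n + 1) → ℝ => Fin.tail τ) ?_)
    exact continuous_pi fun i => by unfold Fin.tail; fun_prop

/-- The Dyson series solves `x' = A(t) x` for a bounded strongly continuous family `A`. -/
theorem exists_solution {A : ℝ → H →L[ℂ] H} {k : ℝ} (hk : ∀ s, ‖A s‖ ≤ k)
    (hA : ∀ ψ, Continuous fun s => A s ψ) :
    ∃ V : ℝ → H →L[ℂ] H, V 0 = ContinuousLinearMap.id ℂ H ∧
      ∀ ψ s, HasDerivAt (fun s => V s ψ) (A s (V s ψ)) s := by
  have hk0 : 0 ≤ k := (norm_nonneg _).trans (hk 0)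
  -- The Dyson terms. The simplex volume bounds the `n`-th by `(k|t|)^n/n!`, so the series converges
  -- in norm for every `t`, and each term is an antiderivative of `A` applied to the preceding one.
  choose B hB hBn using fun (n : ℕ) (t : ℝ) =>
    exists_isTimeOrderedIntegral t (norm_orderedProd_le hk n) (continuous_orderedProd hk hA n)
  have hBd : ∀ n ψ t, HasDerivAt (fun t => B (n + 1) t ψ) (A t (B n t ψ)) t := by
    intro n ψ t
    have e1 : (fun t => B (n + 1) t ψ) = fun t => ∫ s in (0 : ℝ)..t,
        timeOrdered n s fun τ => orderedProd A (n + 1) (Fin.cons s τ) ψ := by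
      funext t
      exact (hB (n + 1) t).apply_eq ψ
    have e2 : A t (B n t ψ) =
        timeOrdered n t fun τ => orderedProd A (n + 1) (Fin.cons t τ) ψ := by
      rw [(hB n t).apply_eq]
      exact ContinuousLinearMap.map_timeOrdered ((A t).restrictScalars ℝ) n t
        (continuous_orderedProd hk hA n ψ)
    have hc := continuous_timeOrdered_cons (continuous_orderedProd hk hA (n + 1) ψ)
    rw [e1, e2]
    exact intervalIntegral.integral_hasDerivAt_right (hc.intervalIntegrable _ _)
      (hc.stronglyMeasurableAtFilter _ _) hc.continuousAt
  have hB0 : ∀ t, B 0 t = ContinuousLinearMap.id ℂ H := fun t => by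
    ext ψ; exact (hB 0 t).apply_eq ψ
  have hBz : ∀ n, B (n + 1) 0 = 0 := fun n => by
    ext ψ
    rw [(hB (n + 1) 0).apply_eq]
    exact intervalIntegral.integral_same
  have hbound : ∀ n t, ‖B n t‖ ≤ (k * |t|) ^ n / n.factorial := fun n t =>
    (hBn n t).trans (le_of_eq (by rw [mul_pow]; ring))
  have hsum : ∀ t, Summable fun n => B n t := fun t =>
    Summable.of_norm_bounded (Real.summable_pow_div_factorial (k * |t|)) (hbound · t)
  refine ⟨fun t => ∑' n, B n t, ?_, fun ψ t => ?_⟩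
  · simp only
    rw [(hsum 0).tsum_eq_zero_add]
    simp [hBz, hB0]
  · have happ : ∀ t, (∑' n, B n t) ψ = ψ + ∑' n, B (n + 1) t ψ := by
      intro t
      have h1 := (hsum t).map_tsum (ContinuousLinearMap.apply ℂ H ψ)
        (ContinuousLinearMap.continuous _)
      have h2 : Summable fun n => B n t ψ :=
        (hsum t).map (ContinuousLinearMap.apply ℂ H ψ) (ContinuousLinearMap.continuous _)
      simp only [ContinuousLinearMap.apply_apply] at h1
      rw [h1, h2.tsum_eq_zero_add, hB0]
      rfl
    simp only [happ]
    have hderiv : A t (ψ + ∑' n, B (n + 1) t ψ) = ∑' n, A t (B n t ψ) := by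
      rw [← happ]
      exact (hsum t).map_tsum (A t ∘L ContinuousLinearMap.apply ℂ H ψ)
        (ContinuousLinearMap.continuous _)
    rw [hderiv]
    refine HasDerivAt.const_add ψ ?_
    -- A ball containing `0` and `t`, on which the differentiated series has one summable majorant.
    let R := |t| + 1
    have hR0 : 0 ≤ R := by positivity
    have hmem : ∀ y, y ∈ Metric.ball (0 : ℝ) R ↔ |y| < R := fun y => by simp
    have hu : Summable fun n : ℕ => k * ((k * R) ^ n / n.factorial * ‖ψ‖) :=
      ((Real.summable_pow_div_factorial (k * R)).mul_right _).mul_left _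
    have hle : ∀ n y, y ∈ Metric.ball (0 : ℝ) R →
        ‖A y (B n y ψ)‖ ≤ k * ((k * R) ^ n / n.factorial * ‖ψ‖) := by
      intro n y hy
      refine ((A y).le_opNorm _).trans (mul_le_mul (hk y) ?_ (norm_nonneg _) hk0)
      refine ((B n y).le_opNorm _).trans (mul_le_mul_of_nonneg_right ?_ (norm_nonneg _))
      refine (hbound n y).trans ?_
      have := ((hmem y).1 hy).le
      gcongr
    have hz : Summable fun n => B (n + 1) 0 ψ := by
      simp only [hBz, zero_apply]
      exact summable_zero
    exact hasDerivAt_tsum_of_isPreconnected hu Metric.isOpen_ball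
      (convex_ball (0 : ℝ) R).isPreconnected (fun n y _ => hBd n ψ y) hle
      ((hmem 0).2 (by rw [abs_zero]; positivity)) hz ((hmem t).2 (lt_add_one _))

theorem exists_isInteractionPropagator (ħ : ℝ) {W : ℝ → H →L[ℂ] H}
    (hW : ∀ s x y, ⟪W s x, y⟫_ℂ = ⟪x, W s y⟫_ℂ) {k : ℝ} (hk : ∀ s, ‖W s‖ ≤ k)
    (hWc : ∀ ψ, Continuous fun s => W s ψ) : ∃ V, IsInteractionPropagator ħ W V := by
  obtain ⟨V, h0, hV⟩ := exists_solution (A := fun s => (-Complex.I / (ħ : ℂ)) • W s)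
    (k := ‖-Complex.I / (ħ : ℂ)‖ * k)
    (fun s => (norm_smul_le _ _).trans (mul_le_mul_of_nonneg_left (hk s) (norm_nonneg _)))
    (fun ψ => (hWc ψ).const_smul _)
  refine ⟨V, h0, fun s ψ => ?_, hV⟩
  rw [norm_eq_of_hasDerivAt hW (hV ψ) s, h0]
  rfl

/-- Bounded perturbations of generators of unitary groups. -/
theorem IsUnitaryGroup.perturb {ħ : ℝ} {T₀ T : H →ₗ.[ℂ] H} {U₀ : ℝ → H →L[ℂ] H}
    (h : IsUnitaryGroup ħ T₀ U₀) {W : H →L[ℂ] H} (hW : ∀ x y, ⟪W x, y⟫_ℂ = ⟪x, W y⟫_ℂ)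
    (hdom : T.domain = T₀.domain)
    (hval : ∀ ψ hψ hψ', T ⟨ψ, hψ⟩ = T₀ ⟨ψ, hψ'⟩ + W ψ)
    {V : ℝ → H →L[ℂ] H}
    (hV : IsInteractionPropagator ħ (fun s => U₀ (-s) ∘L W ∘L U₀ s) V) :
    IsUnitaryGroup ħ T fun t => U₀ t ∘L V t := by
  have hWs : ∀ s x y, ⟪(U₀ (-s) ∘L W ∘L U₀ s) x, y⟫_ℂ = ⟪x, (U₀ (-s) ∘L W ∘L U₀ s) y⟫_ℂ := by
    intro s x y
    have := h.inner_neg_apply (-s)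
    simp only [neg_neg] at this
    simp only [ContinuousLinearMap.comp_apply, h.inner_neg_apply, hW, ← this]
  have h0 : U₀ 0 ∘L V 0 = ContinuousLinearMap.id ℂ H := by
    rw [h.zero, hV.zero]; rfl
  have hadd : ∀ t s, U₀ (t + s) ∘L V (t + s) = (U₀ t ∘L V t) ∘L (U₀ s ∘L V s) := by
    intro t s
    ext ψ
    -- The group law from uniqueness: `U₀ s (V (t + s) ψ)` and `V t (U₀ s (V s ψ))` solve the same
    -- equation in `t` and agree at `t = 0`.
    have hx : ∀ t, HasDerivAt (fun t => U₀ s (V (t + s) ψ))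
        ((-Complex.I / ħ) • (U₀ (-t) ∘L W ∘L U₀ t) (U₀ s (V (t + s) ψ))) t := by
      intro t
      have h1 := ((U₀ s).restrictScalars ℝ).hasFDerivAt.comp_hasDerivAt t
        ((hV.hasDerivAt ψ (t + s)).comp_add_const t s)
      refine h1.congr_deriv ?_
      simp only [ContinuousLinearMap.coe_restrictScalars', map_smul,
        ContinuousLinearMap.comp_apply]
      congr 1
      rw [← ContinuousLinearMap.comp_apply (U₀ s), ← h.add, h.add t s,
        ContinuousLinearMap.comp_apply (U₀ t)]
      congr 2
      ring
    have h2 := eq_of_hasDerivAt hWs hx (hV.hasDerivAt (U₀ s (V s ψ)))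
      (by simp [hV.zero])
    have h3 := congrFun h2 t
    simp only [ContinuousLinearMap.comp_apply]
    rw [← h3, h.add]
    rfl
  have hn : ∀ t ψ, ‖(U₀ t ∘L V t) ψ‖ = ‖ψ‖ := fun t ψ => by
    rw [ContinuousLinearMap.comp_apply, h.norm_apply, hV.norm_apply]
  refine ⟨h0, hadd, mem_unitary_of_group h0 hadd hn, fun ψ => ?_, fun ψ φ => ?_⟩
  · exact continuous_apply_of_bounded h.norm_le h.continuous (hV.continuous ψ)
  -- The two orbits differ by a function differentiable at `0` for every `ψ`, in the domain or not.
  -- Hence one orbit is differentiable there exactly when the other is, and the generator is exactly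
  -- `T`.
  · have hdiff : HasDerivAt (fun t => (U₀ t ∘L V t) ψ - U₀ t ψ) ((-Complex.I / ħ) • W ψ) 0 := by
      have h1 := (hV.hasDerivAt ψ 0).tendsto_slope_zero
      rw [hasDerivAt_iff_tendsto_slope_zero]
      have h2 : ContinuousAt (fun z : ℝ × H => U₀ z.1 z.2) (0, (-Complex.I / ħ) • W ψ) :=
        (continuous_apply_of_bounded (T := fun z : ℝ × H => U₀ z.1) (fun z => h.norm_le _)
          (fun ψ => (h.continuous ψ).comp continuous_fst) continuous_snd).continuousAt
      have h3 : Filter.Tendsto (fun t : ℝ => (t, t⁻¹ • (V (0 + t) ψ - V 0 ψ)))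
          (nhdsWithin 0 {0}ᶜ) (nhds (0, (-Complex.I / ħ) • W ψ)) := by
        refine (Filter.tendsto_id.mono_left nhdsWithin_le_nhds).prodMk_nhds ?_
        simpa [hV.zero, h.zero] using h1
      have h4 := h2.tendsto.comp h3
      simp only [h.zero, ContinuousLinearMap.id_apply] at h4
      refine h4.congr fun t => ?_
      simp only [Function.comp_apply, zero_add, ContinuousLinearMap.comp_apply, hV.zero, h.zero,
        ContinuousLinearMap.id_apply, sub_self, sub_zero]
      rw [← map_sub]
      exact ((U₀ t).restrictScalars ℝ).map_smul _ _
    have key : HasDerivAt (fun t => (U₀ t ∘L V t) ψ) φ 0 ↔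
        HasDerivAt (fun t => U₀ t ψ) (φ - (-Complex.I / ħ) • W ψ) 0 := by
      constructor
      · intro h1
        refine (h1.sub hdiff).congr_of_eventuallyEq (Filter.Eventually.of_forall fun t => ?_)
        simp
      · intro h1
        refine ((h1.add hdiff).congr_of_eventuallyEq
          (Filter.Eventually.of_forall fun t => ?_)).congr_deriv ?_
        · simp
        · simp
    rw [key, h.generator]
    constructor
    · rintro ⟨hψ, e⟩
      refine ⟨hdom ▸ hψ, ?_⟩
      rw [hval ψ _ hψ, smul_add, ← e, sub_add_cancel]
    · rintro ⟨hψ, e⟩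
      refine ⟨hdom ▸ hψ, ?_⟩
      rw [e, hval ψ hψ (hdom ▸ hψ), smul_add, add_sub_cancel_right]

end Group

/-! ### Multiplication operators -/

section Multiplication

variable {N : ℕ}

theorem norm_mulOp_le {f : Config N → ℂ} (hf : MemLp f ∞ volume) {k : ℝ} (hk0 : 0 ≤ k)
    (hk : ∀ᵐ x, ‖f x‖ ≤ k) : ‖mulOp hf‖ ≤ k := by
  refine (mulOp hf).opNorm_le_bound hk0 fun ψ => ?_
  refine Lp.norm_le_mul_norm_of_ae_le_mul ?_
  filter_upwards [mulOp_coe hf ψ, hk] with x h1 h2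
  rw [h1, norm_mul]
  exact mul_le_mul_of_nonneg_right h2 (norm_nonneg _)

theorem norm_mulOp_apply {f : Config N → ℂ} (hf : MemLp f ∞ volume) (hk : ∀ x, ‖f x‖ = 1)
    (ψ : L2 N) : ‖mulOp hf ψ‖ = ‖ψ‖ := by
  rw [Lp.norm_def, Lp.norm_def]
  congr 1
  refine eLpNorm_congr_norm_ae ?_
  filter_upwards [mulOp_coe hf ψ] with x h1
  rw [h1, norm_mul, hk, one_mul]

theorem inner_mulOp {f : Config N → ℝ} (hf : MemLp (fun x => (f x : ℂ)) ∞ volume) (φ ψ : L2 N) :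
    ⟪mulOp hf φ, ψ⟫_ℂ = ⟪φ, mulOp hf ψ⟫_ℂ := by
  rw [L2.inner_def, L2.inner_def]
  refine integral_congr_ae ?_
  filter_upwards [mulOp_coe hf φ, mulOp_coe hf ψ] with x h1 h2
  rw [h1, h2]
  simp
  ring

theorem mulOp_mulOp {f g k : Config N → ℂ} (hf : MemLp f ∞ volume) (hg : MemLp g ∞ volume)
    (hk : MemLp k ∞ volume) (h : ∀ x, k x = f x * g x) (ψ : L2 N) :
    mulOp hf (mulOp hg ψ) = mulOp hk ψ := by
  refine Lp.ext ?_
  filter_upwards [mulOp_coe hf (mulOp hg ψ), mulOp_coe hg ψ, mulOp_coe hk ψ] with x h1 h2 h3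
  rw [h1, h2, h3, h, mul_assoc]

theorem mulOp_congr {f g : Config N → ℂ} (hf : MemLp f ∞ volume) (hg : MemLp g ∞ volume)
    (h : f =ᵐ[volume] g) : mulOp hf = mulOp hg := by
  ext1 ψ
  refine Lp.ext ?_
  filter_upwards [mulOp_coe hf ψ, mulOp_coe hg ψ, h] with x h1 h2 h3
  rw [h1, h2, h3]

end Multiplication

/-! ### Permutations -/

section Permutations

variable {N : ℕ}

theorem permOp_coe (σ : Equiv.Perm (Fin N)) (ψ : L2 N) :
    permOp σ ψ =ᵐ[volume] fun x => ψ (permConfig σ x) :=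
  Lp.coeFn_compMeasurePreserving ψ (permConfig σ).measurePreserving

theorem permConfig_permConfig (σ τ : Equiv.Perm (Fin N)) (x : Config N) :
    permConfig σ (permConfig τ x) = permConfig (τ * σ) x := by
  ext ⟨i, k⟩
  simp [permConfig_apply]

theorem quasi_permConfig (σ : Equiv.Perm (Fin N)) :
    Measure.QuasiMeasurePreserving (permConfig σ) volume volume :=
  (permConfig σ).measurePreserving.quasiMeasurePreserving

theorem permOp_permOp (σ τ : Equiv.Perm (Fin N)) (ψ : L2 N) :
    permOp σ (permOp τ ψ) = permOp (σ * τ) ψ := by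
  refine Lp.ext ?_
  filter_upwards [permOp_coe σ (permOp τ ψ), (quasi_permConfig σ).ae (permOp_coe τ ψ),
    permOp_coe (σ * τ) ψ] with x h1 h2 h3
  rw [h1, h2, h3, permConfig_permConfig]

theorem permOp_one (ψ : L2 N) : permOp 1 ψ = ψ := by
  refine Lp.ext ?_
  filter_upwards [permOp_coe 1 ψ] with x h1
  rw [h1]
  congr 1

theorem permOp_permOp_inv (σ : Equiv.Perm (Fin N)) (ψ : L2 N) : permOp σ (permOp σ⁻¹ ψ) = ψ := by
  rw [permOp_permOp, mul_inv_cancel, permOp_one]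

theorem permOp_mulOp (σ : Equiv.Perm (Fin N)) {f g : Config N → ℂ} (hf : MemLp f ∞ volume)
    (hg : MemLp g ∞ volume) (h : ∀ x, g x = f (permConfig σ x)) (ψ : L2 N) :
    permOp σ (mulOp hf ψ) = mulOp hg (permOp σ ψ) := by
  refine Lp.ext ?_
  filter_upwards [permOp_coe σ (mulOp hf ψ), (quasi_permConfig σ).ae (mulOp_coe hf ψ),
    mulOp_coe hg (permOp σ ψ), permOp_coe σ ψ] with x h1 h2 h3 h4
  rw [h1, h2, h3, h4, h]

end Permutations

/-! ### The Fourier transform -/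

section Fourier

open FourierTransform SchwartzMap

/-- Tested against a smooth compactly supported `g`, both transforms can be moved onto `g`: the `L²`
one by duality of tempered distributions, the integral one by Fubini. Explicit computations on a
dense set thus carry over to `L²`. -/
theorem fourierL2_toLp {N : ℕ} {f : Config N → ℂ} (hf : MemLp f 2 volume) (hi : Integrable f) :
    fourierL2 N (hf.toLp f) =ᵐ[volume] 𝓕 f := by
  have hc : Continuous (𝓕 f) :=
    VectorFourier.fourierIntegral_continuous Real.continuous_fourierChar
      (by exact continuous_inner) hi
  refine ae_eq_of_integral_contDiff_smul_eq
    ((Lp.memLp _).locallyIntegrable (by norm_num)) hc.locallyIntegrable fun g hg hgs => ?_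
  let G : 𝓢(Config N, ℂ) := HasCompactSupport.toSchwartzMap (f := fun x => (g x : ℂ))
    (hgs.comp_left (g := fun r : ℝ => (r : ℂ)) Complex.ofReal_zero)
    (Complex.ofRealCLM.contDiff.comp hg)
  have hG : ∀ x, G x = g x := fun x => rfl
  have h2 := congrArg (fun T : 𝓢'(Config N, ℂ) => T G)
    (Lp.fourier_toTemperedDistribution_eq (hf.toLp f))
  simp only [TemperedDistribution.fourier_apply, Lp.toTemperedDistribution_apply] at h2
  have h3 : ∫ x, g x • fourierL2 N (hf.toLp f) x = ∫ x, G x • (𝓕 (hf.toLp f)) x := by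
    refine integral_congr_ae (Filter.Eventually.of_forall fun x => ?_)
    simp only [hG, Complex.coe_smul]
    rfl
  have h4 : ∫ x, g x • 𝓕 f x = ∫ x, G x • 𝓕 f x := by
    refine integral_congr_ae (Filter.Eventually.of_forall fun x => ?_)
    simp only [hG, Complex.coe_smul]
  have h5 : ∫ x, (𝓕 G) x • (hf.toLp f : Config N → ℂ) x = ∫ x, (𝓕 G) x • f x := by
    refine integral_congr_ae ?_
    filter_upwards [hf.coeFn_toLp] with x hx
    rw [hx]
  rw [h3, h4, ← h2, h5]
  have h6 := VectorFourier.integral_fourierIntegral_smul_eq_flip (L := innerₗ (Config N))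
    (μ := volume) (ν := volume) Real.continuous_fourierChar
    (by exact continuous_inner) G.integrable hi
  rw [flip_innerₗ] at h6
  exact h6

theorem denseRange_schwartz (N : ℕ) :
    DenseRange (fun f : 𝓢(Config N, ℂ) => (f.toLp 2 : L2 N)) :=
  SchwartzMap.denseRange_toLpCLM (p := 2) (μ := (volume : Measure (Config N))) (by norm_num)

/-- On Schwartz functions the Fourier integral commutes with linear isometries, and these functions
are dense. -/
theorem fourierL2_permOp {N : ℕ} (σ : Equiv.Perm (Fin N)) (ψ : L2 N) :
    fourierL2 N (permOp σ ψ) = permOp σ (fourierL2 N ψ) := by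
  refine DenseRange.induction_on (denseRange_schwartz N) ψ
    (isClosed_eq ((fourierL2 N).continuous.comp (permOp σ).continuous)
      ((permOp σ).continuous.comp (fourierL2 N).continuous)) fun f => ?_
  have h1 : permOp σ (f.toLp 2) = ((f.memLp 2).comp_measurePreserving
      (permConfig σ).measurePreserving).toLp (f ∘ permConfig σ) :=
    Lp.toLp_compMeasurePreserving (f.memLp 2) (permConfig σ).measurePreserving
  rw [h1]
  refine Lp.ext ?_
  filter_upwards [fourierL2_toLp ((f.memLp 2).comp_measurePreserving
      (permConfig σ).measurePreserving)
      ((permConfig σ).measurePreserving.integrable_comp_of_integrable f.integrable),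
    permOp_coe σ (fourierL2 N (f.toLp 2)),
    (quasi_permConfig σ).ae (fourierL2_toLp (f.memLp 2) f.integrable)] with x h2 h3 h4
  rw [h2, h3, Real.fourier_comp_linearIsometry]
  exact h4.symm

/-- The tensor product as a continuous bilinear map. -/
def tensorL {q N : ℕ} (h : q ≤ N) : L2 q →L[ℂ] L2 (N - q) →L[ℂ] L2 N :=
  (tensorLin h).mkContinuous₂ 1 fun f g => by
    rw [one_mul]
    exact (norm_tensor h f g).le

theorem tensorL_apply {q N : ℕ} (h : q ≤ N) (f : L2 q) (g : L2 (N - q)) :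
    tensorL h f g = tensor h f g := rfl

theorem continuous_tensor_left {q N : ℕ} (h : q ≤ N) (g : L2 (N - q)) :
    Continuous fun f => tensor h f g :=
  ((tensorL h).flip g).continuous

theorem continuous_tensor_right {q N : ℕ} (h : q ≤ N) (f : L2 q) :
    Continuous fun g => tensor h f g :=
  (tensorL h f).continuous

/-- The particles as the union of the first `q` and the last `N - q` ones. -/
def headTailEquiv {q N : ℕ} (h : q ≤ N) : Fin q ⊕ Fin (N - q) ≃ Fin N :=
  finSumFinEquiv.trans (finCongr (Nat.add_sub_cancel' h))

/-- The index in the whole system of a particle of the tail. -/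
def tailIdx {q N : ℕ} (h : q ≤ N) (j : Fin (N - q)) : Fin N :=
  Fin.cast (Nat.add_sub_cancel' h) (Fin.natAdd q j)

theorem headTailEquiv_inl {q N : ℕ} (h : q ≤ N) (i : Fin q) :
    headTailEquiv h (Sum.inl i) = Fin.castLE h i := rfl

theorem headTailEquiv_inr {q N : ℕ} (h : q ≤ N) (j : Fin (N - q)) :
    headTailEquiv h (Sum.inr j) = tailIdx h j := rfl

theorem sum_head_tail {q N : ℕ} (h : q ≤ N) {M : Type*} [AddCommMonoid M] (F : Fin N → M) :
    ∑ i, F i = ∑ i : Fin q, F (Fin.castLE h i) + ∑ j : Fin (N - q), F (tailIdx h j) := by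
  rw [← (headTailEquiv h).sum_comp, Fintype.sum_sum_type]
  rfl

theorem inner_head_tail {q N : ℕ} (h : q ≤ N) (x y : Config N) :
    ⟪x, y⟫_ℝ = ⟪headPart h x, headPart h y⟫_ℝ + ⟪tailPart h x, tailPart h y⟫_ℝ := by
  simp only [PiLp.inner_apply, Fintype.sum_prod_type]
  exact sum_head_tail h _

theorem norm_sq_head_tail {q N : ℕ} (h : q ≤ N) (x : Config N) :
    ‖x‖ ^ 2 = ‖headPart h x‖ ^ 2 + ‖tailPart h x‖ ^ 2 := by
  simp only [← real_inner_self_eq_norm_sq]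
  exact inner_head_tail h x x

/-- The inner product is a sum over head and tail, so the character factorises and Fubini applies.
-/
theorem fourier_tensor {q N : ℕ} (h : q ≤ N) {f : Config q → ℂ} {g : Config (N - q) → ℂ}
    (hf : Integrable f) (hg : Integrable g) (ξ : Config N) :
    𝓕 (fun x => f (headPart h x) * g (tailPart h x)) ξ =
      𝓕 f (headPart h ξ) * 𝓕 g (tailPart h ξ) := by
  have hmp := measurePreserving_headPart_tailPart h
  simp only [Real.fourier_eq]
  rw [← integral_prod_mul, ← hmp.map_eq, integral_map hmp.measurable.aemeasurable]
  · refine integral_congr_ae (Filter.Eventually.of_forall fun x => ?_)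
    simp only [inner_head_tail h x ξ, neg_add, AddChar.map_add_eq_mul, Circle.smul_def,
      Circle.coe_mul, smul_eq_mul]
    ring
  · rw [hmp.map_eq]
    have h1 : ∀ {n : ℕ} (η : Config n), Continuous fun x : Config n =>
        ((Real.fourierChar (-⟪x, η⟫_ℝ) : Circle) : ℂ) := fun η =>
      continuous_subtype_val.comp (Real.continuous_fourierChar.comp (by fun_prop))
    simp only [Circle.smul_def, smul_eq_mul]
    exact ((h1 _).aestronglyMeasurable.mul hf.1).comp_fst.mul
      ((h1 _).aestronglyMeasurable.mul hg.1).comp_snd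

theorem fourierL2_tensor_toLp {q N : ℕ} (h : q ≤ N) {f : Config q → ℂ} {g : Config (N - q) → ℂ}
    (hf : MemLp f 2 volume) (hg : MemLp g 2 volume) (hfi : Integrable f) (hgi : Integrable g) :
    fourierL2 N (tensor h (hf.toLp f) (hg.toLp g)) =
      tensor h (fourierL2 q (hf.toLp f)) (fourierL2 (N - q) (hg.toLp g)) := by
  have hmp := measurePreserving_headPart_tailPart h
  have hae : (fun x : Config N => hf.toLp f (headPart h x) * hg.toLp g (tailPart h x)) =ᵐ[volume]
      fun x => f (headPart h x) * g (tailPart h x) := by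
    filter_upwards [(quasi_head h).ae hf.coeFn_toLp, (quasi_tail h).ae hg.coeFn_toLp]
      with x h1 h2
    rw [h1, h2]
  have hm : MemLp (fun x : Config N => f (headPart h x) * g (tailPart h x)) 2 volume :=
    (memLp_congr_ae hae).1 (memLp_tensor h _ _)
  have hi : Integrable (fun x : Config N => f (headPart h x) * g (tailPart h x)) :=
    hmp.integrable_comp_of_integrable (hfi.mul_prod hgi)
  have e1 : tensor h (hf.toLp f) (hg.toLp g) = hm.toLp _ := MemLp.toLp_congr _ _ hae
  rw [e1]
  refine Lp.ext ?_
  filter_upwards [fourierL2_toLp hm hi, tensor_coe h (fourierL2 q (hf.toLp f))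
    (fourierL2 (N - q) (hg.toLp g)), (quasi_head h).ae (fourierL2_toLp hf hfi),
    (quasi_tail h).ae (fourierL2_toLp hg hgi)] with x h1 h2 h3 h4
  rw [h1, h2, fourier_tensor h hfi hgi, h3, h4]

theorem fourierL2_tensor {q N : ℕ} (h : q ≤ N) (f : L2 q) (g : L2 (N - q)) :
    fourierL2 N (tensor h f g) = tensor h (fourierL2 q f) (fourierL2 (N - q) g) := by
  have c1 : Continuous fun f => fourierL2 N (tensor h f g) :=
    (fourierL2 N).continuous.comp (continuous_tensor_left h g)
  have c2 : Continuous fun f => tensor h (fourierL2 q f) (fourierL2 (N - q) g) :=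
    (continuous_tensor_left h _).comp (fourierL2 q).continuous
  refine (denseRange_schwartz q).induction_on f (isClosed_eq c1 c2) fun f => ?_
  have c3 : Continuous fun g => fourierL2 N (tensor h (f.toLp 2) g) :=
    (fourierL2 N).continuous.comp (continuous_tensor_right h _)
  have c4 : Continuous fun g => tensor h (fourierL2 q (f.toLp 2)) (fourierL2 (N - q) g) :=
    (continuous_tensor_right h _).comp (fourierL2 (N - q)).continuous
  refine (denseRange_schwartz (N - q)).induction_on g (isClosed_eq c3 c4) fun g => ?_
  exact fourierL2_tensor_toLp h (f.memLp 2) (g.memLp 2) f.integrable g.integrable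

end Fourier

/-! ### The free evolution -/

section Free

variable {N : ℕ}

/-- Multiplication by `e^{-i t h(ξ) / ħ}`, where `h` is the kinetic symbol. -/
def phaseOp (ħ : ℝ) (N : ℕ) (t : ℝ) : L2 N →L[ℂ] L2 N := mulOp (memLp_freePhase ħ N t)

theorem phaseOp_coe (ħ t : ℝ) (f : L2 N) : phaseOp ħ N t f =ᵐ[volume] fun ξ =>
    Complex.exp (-Complex.I * (t / ħ * kineticSymbol ħ N ξ : ℝ)) * f ξ :=
  mulOp_coe _ f

theorem fourierL2_free (ħ t : ℝ) (ψ : L2 N) :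
    fourierL2 N (free ħ N t ψ) = phaseOp ħ N t (fourierL2 N ψ) :=
  (fourierL2 N).apply_symm_apply _

theorem free_eq (ħ t : ℝ) (ψ : L2 N) :
    free ħ N t ψ = (fourierL2 N).symm (phaseOp ħ N t (fourierL2 N ψ)) := rfl

theorem norm_phase (r : ℝ) : ‖Complex.exp (-Complex.I * (r : ℝ))‖ = 1 := by
  rw [show -Complex.I * (r : ℂ) = ((-r : ℝ) : ℂ) * Complex.I by push_cast; ring,
    Complex.norm_exp_ofReal_mul_I]

theorem phaseOp_zero (ħ : ℝ) (f : L2 N) : phaseOp ħ N 0 f = f := by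
  refine Lp.ext ?_
  filter_upwards [phaseOp_coe ħ 0 f] with x h1
  rw [h1]
  simp

theorem phaseOp_add (ħ s t : ℝ) (f : L2 N) :
    phaseOp ħ N (s + t) f = phaseOp ħ N s (phaseOp ħ N t f) := by
  refine (mulOp_mulOp _ _ _ (fun ξ => ?_) f).symm
  rw [← Complex.exp_add]
  congr 1
  push_cast
  ring

theorem norm_phaseOp_apply (ħ t : ℝ) (f : L2 N) : ‖phaseOp ħ N t f‖ = ‖f‖ :=
  norm_mulOp_apply _ (fun _ => norm_phase _) f

theorem free_zero (ħ : ℝ) : free ħ N 0 = ContinuousLinearMap.id ℂ (L2 N) := by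
  ext1 ψ
  rw [free_eq, phaseOp_zero]
  exact (fourierL2 N).symm_apply_apply ψ

theorem free_add (ħ s t : ℝ) : free ħ N (s + t) = free ħ N s ∘L free ħ N t := by
  ext1 ψ
  rw [ContinuousLinearMap.comp_apply, free_eq, free_eq, fourierL2_free, phaseOp_add]

theorem norm_free_apply (ħ t : ℝ) (ψ : L2 N) : ‖free ħ N t ψ‖ = ‖ψ‖ := by
  rw [← (fourierL2 N).norm_map, fourierL2_free, norm_phaseOp_apply, (fourierL2 N).norm_map]

theorem norm_free_le (ħ t : ℝ) : ‖free ħ N t‖ ≤ 1 :=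
  (free ħ N t).opNorm_le_bound zero_le_one fun ψ => by rw [norm_free_apply, one_mul]

theorem kineticSymbol_head_tail (ħ : ℝ) {q : ℕ} (h : q ≤ N) (ξ : Config N) :
    kineticSymbol ħ N ξ =
      kineticSymbol ħ q (headPart h ξ) + kineticSymbol ħ (N - q) (tailPart h ξ) := by
  simp only [kineticSymbol, mul_pow, norm_sq_head_tail h ξ]
  ring

/-- The kinetic symbol is additive over head and tail, so its phase is a product. Free evolution is
therefore compatible with `b ↦ b ⊗ I`. -/
theorem free_tensor (ħ t : ℝ) {q : ℕ} (h : q ≤ N) (f : L2 q) (g : L2 (N - q)) :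
    free ħ N t (tensor h f g) = tensor h (free ħ q t f) (free ħ (N - q) t g) := by
  apply (fourierL2 N).injective
  rw [fourierL2_free, fourierL2_tensor, fourierL2_tensor, fourierL2_free, fourierL2_free]
  refine Lp.ext ?_
  filter_upwards [phaseOp_coe ħ t (tensor h (fourierL2 q f) (fourierL2 (N - q) g)),
    tensor_coe h (fourierL2 q f) (fourierL2 (N - q) g),
    tensor_coe h (phaseOp ħ q t (fourierL2 q f)) (phaseOp ħ (N - q) t (fourierL2 (N - q) g)),
    (quasi_head h).ae (phaseOp_coe ħ t (fourierL2 q f)),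
    (quasi_tail h).ae (phaseOp_coe ħ t (fourierL2 (N - q) g))] with ξ h1 h2 h3 h4 h5
  rw [h1, h2, h3, h4, h5, kineticSymbol_head_tail ħ h, mul_add, Complex.ofReal_add, mul_add,
    Complex.exp_add]
  ring

theorem free_permOp (ħ t : ℝ) (σ : Equiv.Perm (Fin N)) (ψ : L2 N) :
    free ħ N t (permOp σ ψ) = permOp σ (free ħ N t ψ) := by
  apply (fourierL2 N).injective
  rw [fourierL2_free, fourierL2_permOp, fourierL2_permOp, fourierL2_free]
  refine (permOp_mulOp σ _ _ (fun ξ => ?_) _).symm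
  simp [kineticSymbol]

/-- Dominated convergence in `L²`. -/
theorem tendsto_zero_of_dominated {ι : Type*} {l : Filter ι} [l.IsCountablyGenerated]
    {G : ι → L2 N} {u : ι → Config N → ℂ} (hG : ∀ i, G i =ᵐ[volume] u i) {b : Config N → ℝ}
    (hb : MemLp b 2 volume) (hub : ∀ i, ∀ᵐ ξ, ‖u i ξ‖ ≤ b ξ)
    (hlim : ∀ ξ, Filter.Tendsto (fun i => u i ξ) l (nhds 0)) :
    Filter.Tendsto G l (nhds 0) := by
  rw [tendsto_zero_iff_norm_tendsto_zero]
  have hn : ∀ i, ‖G i‖ ^ 2 = ∫ ξ, ‖u i ξ‖ ^ 2 := by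
    intro i
    have h1 : ⟪G i, G i⟫_ℂ = ∫ ξ, ((‖u i ξ‖ ^ 2 : ℝ) : ℂ) := by
      rw [L2.inner_def]
      refine integral_congr_ae ?_
      filter_upwards [hG i] with ξ h
      rw [inner_self_eq_norm_sq_to_K, h]
      push_cast
      rfl
    rw [inner_self_eq_norm_sq_to_K, integral_complex_ofReal] at h1
    refine Complex.ofReal_injective (Eq.trans ?_ h1)
    push_cast
    rfl
  have h0 : Filter.Tendsto (fun i => ∫ ξ, ‖u i ξ‖ ^ 2) l (nhds (∫ _ξ : Config N, (0 : ℝ))) := by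
    refine tendsto_integral_filter_of_dominated_convergence (fun ξ => b ξ ^ 2)
      (Filter.Eventually.of_forall fun i => ?_) (Filter.Eventually.of_forall fun i => ?_)
      hb.integrable_sq (Filter.Eventually.of_forall fun ξ => ?_)
    · exact (((Lp.aestronglyMeasurable (G i)).congr (hG i)).norm.pow 2)
    · filter_upwards [hub i] with ξ h
      rw [Real.norm_of_nonneg (by positivity)]
      exact pow_le_pow_left₀ (norm_nonneg _) h 2
    · simpa using ((hlim ξ).norm.pow 2)
  rw [integral_zero] at h0
  have h1 := h0.sqrt
  simp only [← hn, Real.sqrt_sq (norm_nonneg _), Real.sqrt_zero] at h1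
  exact h1

theorem continuous_phaseOp (ħ : ℝ) (f : L2 N) : Continuous fun t => phaseOp ħ N t f := by
  refine continuous_iff_continuousAt.2 fun t₀ => ?_
  have h := tendsto_zero_of_dominated (N := N) (l := nhds t₀)
    (G := fun t => phaseOp ħ N t f - phaseOp ħ N t₀ f)
    (u := fun t ξ => (Complex.exp (-Complex.I * (t / ħ * kineticSymbol ħ N ξ : ℝ)) -
      Complex.exp (-Complex.I * (t₀ / ħ * kineticSymbol ħ N ξ : ℝ))) * f ξ)
    (b := fun ξ => 2 * ‖f ξ‖)
    (fun t => by
      filter_upwards [phaseOp_coe ħ t f, phaseOp_coe ħ t₀ f,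
        Lp.coeFn_sub (phaseOp ħ N t f) (phaseOp ħ N t₀ f)] with ξ h1 h2 h3
      rw [h3, Pi.sub_apply, h1, h2, sub_mul])
    ((Lp.memLp f).norm.const_mul 2)
    (fun t => Filter.Eventually.of_forall fun ξ => by
      rw [norm_mul]
      refine mul_le_mul_of_nonneg_right ?_ (norm_nonneg _)
      refine (norm_sub_le _ _).trans ?_
      rw [norm_phase, norm_phase]
      norm_num)
    (fun ξ => by
      have : Continuous fun t : ℝ =>
          (Complex.exp (-Complex.I * (t / ħ * kineticSymbol ħ N ξ : ℝ)) -
          Complex.exp (-Complex.I * (t₀ / ħ * kineticSymbol ħ N ξ : ℝ))) * f ξ := by fun_prop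
      simpa using this.tendsto t₀)
  exact tendsto_sub_nhds_zero_iff.1 h

theorem continuous_free (ħ : ℝ) (ψ : L2 N) : Continuous fun t => free ħ N t ψ :=
  (fourierL2 N).symm.continuous.comp (continuous_phaseOp ħ (fourierL2 N ψ))

theorem slope_phase_tendsto (ħ m : ℝ) :
    Filter.Tendsto (fun t : ℝ => t⁻¹ • (Complex.exp (-Complex.I * (t / ħ * m : ℝ)) - 1))
      (nhdsWithin 0 {0}ᶜ) (nhds (-Complex.I / ħ * m)) := by
  have h1 : HasDerivAt (fun t : ℝ => Complex.exp (-Complex.I * (t / ħ * m : ℝ)))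
      (-Complex.I / ħ * m) 0 := by
    have h2 : HasDerivAt (fun t : ℝ => -Complex.I * ((t / ħ * m : ℝ) : ℂ))
        (-Complex.I * ((1 / ħ * m : ℝ) : ℂ)) 0 :=
      ((((hasDerivAt_id (0 : ℝ)).div_const ħ).mul_const m).ofReal_comp).const_mul _
    refine h2.cexp.congr_deriv ?_
    simp
    ring
  simpa using h1.tendsto_slope_zero

theorem norm_slope_phase_le (ħ m t : ℝ) :
    ‖t⁻¹ • (Complex.exp (-Complex.I * (t / ħ * m : ℝ)) - 1)‖ ≤ ‖(-Complex.I / ħ * m : ℂ)‖ := by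
  have h1 := Real.norm_exp_I_mul_ofReal_sub_one_le (x := -(t / ħ * m))
  rw [show Complex.I * ((-(t / ħ * m) : ℝ) : ℂ) = -Complex.I * ((t / ħ * m : ℝ) : ℂ) by
    push_cast; ring] at h1
  rw [norm_smul]
  rcases eq_or_ne t 0 with rfl | ht
  · simp
    positivity
  · calc ‖t⁻¹‖ * _ ≤ ‖t⁻¹‖ * ‖-(t / ħ * m)‖ := mul_le_mul_of_nonneg_left h1 (norm_nonneg _)
      _ = _ := by
        have : |t| ≠ 0 := abs_ne_zero.2 ht
        simp only [norm_neg, norm_mul, norm_div, norm_inv, Complex.norm_I, Complex.norm_real,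
          Real.norm_eq_abs]
        field_simp

theorem slope_phaseOp_coe (ħ t : ℝ) (f : L2 N) :
    (t⁻¹ • (phaseOp ħ N (0 + t) f - phaseOp ħ N 0 f) : L2 N) =ᵐ[volume] fun ξ =>
      t⁻¹ • (Complex.exp (-Complex.I * (t / ħ * kineticSymbol ħ N ξ : ℝ)) - 1) * f ξ := by
  rw [zero_add, phaseOp_zero]
  filter_upwards [Lp.coeFn_smul t⁻¹ (phaseOp ħ N t f - f), Lp.coeFn_sub (phaseOp ħ N t f) f,
    phaseOp_coe ħ t f] with ξ h1 h2 h3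
  rw [h1, Pi.smul_apply, h2, Pi.sub_apply, h3, smul_mul_assoc, sub_mul, one_mul]

/-- The bound `|e^{ix} - 1| ≤ |x|` dominates the difference quotients by a multiple of the symbol
times `f`, which is in `L²` by hypothesis. -/
theorem hasDerivAt_phaseOp {ħ : ℝ} {f : L2 N}
    (hf : MemLp (fun ξ => (kineticSymbol ħ N ξ : ℂ) * f ξ) 2 volume) :
    HasDerivAt (fun t => phaseOp ħ N t f) ((-Complex.I / ħ) • hf.toLp _) 0 := by
  rw [hasDerivAt_iff_tendsto_slope_zero, ← tendsto_sub_nhds_zero_iff]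
  refine tendsto_zero_of_dominated
    (u := fun t ξ => (t⁻¹ • (Complex.exp (-Complex.I * (t / ħ * kineticSymbol ħ N ξ : ℝ)) - 1) -
      -Complex.I / ħ * kineticSymbol ħ N ξ) * f ξ)
    (b := fun ξ => 2 * ‖(-Complex.I / ħ : ℂ)‖ * ‖(kineticSymbol ħ N ξ : ℂ) * f ξ‖)
    (fun t => ?_) (hf.norm.const_mul _) (fun t => Filter.Eventually.of_forall fun ξ => ?_)
    (fun ξ => ?_)
  · filter_upwards [slope_phaseOp_coe ħ t f,
      Lp.coeFn_sub (t⁻¹ • (phaseOp ħ N (0 + t) f - phaseOp ħ N 0 f)) ((-Complex.I / ħ) • hf.toLp _),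
      Lp.coeFn_smul (-Complex.I / ħ : ℂ) (hf.toLp _), hf.coeFn_toLp] with ξ h1 h2 h3 h4
    rw [h2, Pi.sub_apply, h1, h3, Pi.smul_apply, h4, sub_mul, smul_eq_mul, mul_assoc (_ / _)]
  · rw [norm_mul]
    calc _ ≤ (‖(-Complex.I / ħ * kineticSymbol ħ N ξ : ℂ)‖ +
          ‖(-Complex.I / ħ * kineticSymbol ħ N ξ : ℂ)‖) * ‖f ξ‖ :=
          mul_le_mul_of_nonneg_right ((norm_sub_le _ _).trans
            (add_le_add_left (norm_slope_phase_le _ _ _) _)) (norm_nonneg _)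
      _ = _ := by rw [norm_mul, norm_mul]; ring
  · have h1 := (slope_phase_tendsto ħ (kineticSymbol ħ N ξ)).sub_const
      (-Complex.I / ħ * kineticSymbol ħ N ξ)
    simpa using h1.mul_const (f ξ)

/-- A subsequence of the `L²`-convergent difference quotients converges almost everywhere, and the
pointwise limit is explicit. This forces a vector with differentiable orbit into the maximal domain.
-/
theorem ae_eq_of_hasDerivAt_phaseOp {ħ : ℝ} {f φ : L2 N}
    (h : HasDerivAt (fun t => phaseOp ħ N t f) φ 0) :
    φ =ᵐ[volume] fun ξ => -Complex.I / ħ * kineticSymbol ħ N ξ * f ξ := by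
  obtain ⟨u, -, hu⟩ : ∃ u : ℕ → ℝ, (∀ n, u n ≠ 0) ∧
      Filter.Tendsto u Filter.atTop (nhdsWithin 0 {0}ᶜ) := by
    refine ⟨fun n => 1 / ((n : ℝ) + 1), fun n => by positivity,
      tendsto_nhdsWithin_iff.2 ⟨tendsto_one_div_add_atTop_nhds_zero_nat,
        Filter.Eventually.of_forall fun n => ?_⟩⟩
    have : (1 / ((n : ℝ) + 1)) ≠ 0 := by positivity
    exact this
  have h1 := h.tendsto_slope_zero.comp hu
  obtain ⟨ns, hns, hae⟩ := (tendstoInMeasure_of_tendsto_Lp h1).exists_seq_tendsto_ae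
  filter_upwards [hae, ae_all_iff.2 fun n => slope_phaseOp_coe ħ (u n) f] with ξ h2 h3
  have h4 := ((slope_phase_tendsto ħ (kineticSymbol ħ N ξ)).comp
    (hu.comp hns.tendsto_atTop)).mul_const (f ξ)
  refine tendsto_nhds_unique h2 (h4.congr fun n => ?_)
  exact (h3 (ns n)).symm

theorem free_isUnitaryGroup {ħ : ℝ} (hħ : ħ ≠ 0) (N : ℕ) :
    IsUnitaryGroup ħ (kinetic ħ N) (free ħ N) := by
  refine ⟨free_zero ħ, free_add ħ, mem_unitary_of_group (free_zero ħ) (free_add ħ)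
    (norm_free_apply ħ), continuous_free ħ, fun ψ φ => ⟨fun h => ?_, ?_⟩⟩
  · have h1 : HasDerivAt (fun t => phaseOp ħ N t (fourierL2 N ψ)) (fourierL2 N φ) 0 := by
      have h2 := ((fourierL2 N).toContinuousLinearEquiv.toContinuousLinearMap.restrictScalars
        ℝ).hasFDerivAt.comp_hasDerivAt 0 h
      refine h2.congr_of_eventuallyEq (Filter.Eventually.of_forall fun t => ?_)
      exact (fourierL2_free ħ t ψ).symm
    have h3 := ae_eq_of_hasDerivAt_phaseOp h1
    have hc : (ħ : ℂ) ≠ 0 := Complex.ofReal_ne_zero.2 hħ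
    -- Since `ħ ≠ 0`, the identity `h3` can be solved for the symbol times `𝓕ψ`, namely `iħ 𝓕φ`.
    have hmem : MemLp (fun ξ => (kineticSymbol ħ N ξ : ℂ) * fourierL2 N ψ ξ) 2 volume := by
      refine (memLp_congr_ae ?_).1 ((Lp.memLp (fourierL2 N φ)).const_mul (ħ * Complex.I))
      filter_upwards [h3] with ξ hξ
      rw [hξ]
      field_simp
      linear_combination (-(kineticSymbol ħ N ξ : ℂ) * fourierL2 N ψ ξ) * Complex.I_sq
    refine ⟨hmem, ?_⟩
    have h4 := h1.unique (hasDerivAt_phaseOp hmem)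
    apply (fourierL2 N).injective
    rw [h4, map_smul]
    congr 1
    exact ((fourierL2 N).apply_symm_apply _).symm
  · rintro ⟨hψ, rfl⟩
    have h1 := hasDerivAt_phaseOp (ħ := ħ) (f := fourierL2 N ψ) hψ
    have h2 := ((fourierL2 N).symm.toContinuousLinearEquiv.toContinuousLinearMap.restrictScalars
      ℝ).hasFDerivAt.comp_hasDerivAt 0 h1
    refine h2.congr_deriv ?_
    exact map_smul (fourierL2 N).symm _ _

end Free

/-! ### Density of the tensor products -/

section Density

/-- A locally integrable function on a product whose integrals over rectangles vanish is zero. -/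
theorem ae_eq_zero_of_setIntegral_rectangle {X Y : Type*} [MeasurableSpace X] [MeasurableSpace Y]
    {μ : Measure X} {ν : Measure Y} [SigmaFinite μ] [SigmaFinite ν] {u : X × Y → ℂ}
    (hu : ∀ s t, MeasurableSet s → MeasurableSet t → μ s < ∞ → ν t < ∞ →
      IntegrableOn u (s ×ˢ t) (μ.prod ν))
    (h0 : ∀ s t, MeasurableSet s → MeasurableSet t → μ s < ∞ → ν t < ∞ →
      ∫ z in s ×ˢ t, u z ∂(μ.prod ν) = 0) :
    u =ᵐ[μ.prod ν] 0 := by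
  have key : ∀ n, u =ᵐ[(μ.prod ν).restrict (spanningSets μ n ×ˢ spanningSets ν n)] 0 := by
    intro n
    have hmX := measurableSet_spanningSets μ n
    have hmY := measurableSet_spanningSets ν n
    have hfX := measure_spanningSets_lt_top μ n
    have hfY := measure_spanningSets_lt_top ν n
    have hi := hu _ _ hmX hmY hfX hfY
    refine Integrable.ae_eq_zero_of_forall_setIntegral_eq_zero hi fun S hS hSf => ?_
    -- The π-λ induction runs over all measurable sets, so finiteness of the measure is dropped;
    -- integrability on the finite rectangle (`hi`) handles complements and unions.
    clear hSf
    induction S, hS using MeasurableSpace.induction_on_inter generateFrom_prod.symm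
      isPiSystem_prod with
    | empty => simp
    | basic S hS =>
      obtain ⟨s, hs, t, ht, rfl⟩ := hS
      rw [Measure.restrict_restrict (MeasurableSet.prod hs ht), Set.prod_inter_prod]
      exact h0 _ _ (MeasurableSet.inter hs hmX) (MeasurableSet.inter ht hmY)
        ((measure_mono Set.inter_subset_right).trans_lt hfX)
        ((measure_mono Set.inter_subset_right).trans_lt hfY)
    | compl S hS ih =>
      have h1 := integral_add_compl hS hi
      rw [ih, zero_add, h0 _ _ hmX hmY hfX hfY] at h1
      exact h1
    | iUnion f hd hm ih =>
      rw [integral_iUnion hm hd hi.integrableOn]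
      simp [ih]
  have hcover : (⋃ n, spanningSets μ n ×ˢ spanningSets ν n) = Set.univ := by
    rw [Set.eq_univ_iff_forall]
    rintro ⟨x, y⟩
    have hx := mem_spanningSetsIndex μ x
    have hy := mem_spanningSetsIndex ν y
    refine Set.mem_iUnion.2 ⟨max (spanningSetsIndex μ x) (spanningSetsIndex ν y), ?_, ?_⟩
    · exact monotone_spanningSets μ (le_max_left _ _) hx
    · exact monotone_spanningSets ν (le_max_right _ _) hy
  rw [← Measure.restrict_univ (μ := μ.prod ν), ← hcover]
  exact (ae_restrict_iUnion_iff _ _).2 key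

/-- Joining a configuration of the head and one of the tail. -/
def joinConfig {q N : ℕ} (h : q ≤ N) (z : Config q × Config (N - q)) : Config N :=
  WithLp.toLp 2 fun ik => Sum.elim (fun i => z.1 (i, ik.2)) (fun j => z.2 (j, ik.2))
    ((headTailEquiv h).symm ik.1)

/-- A configuration as a pair of a head and a tail. -/
def splitHomeomorph {q N : ℕ} (h : q ≤ N) : Config N ≃ₜ Config q × Config (N - q) where
  toFun x := (headPart h x, tailPart h x)
  invFun := joinConfig h
  left_inv x := by
    ext ⟨i, k⟩
    obtain ⟨s, rfl⟩ := (headTailEquiv h).surjective i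
    cases s with
    | inl i => simp [joinConfig]; rfl
    | inr j => simp [joinConfig]; rfl
  right_inv z := by
    refine Prod.ext ?_ ?_
    · ext ⟨i, k⟩
      change Sum.elim _ _ ((headTailEquiv h).symm (headTailEquiv h (Sum.inl i))) = _
      rw [Equiv.symm_apply_apply]
      rfl
    · ext ⟨j, k⟩
      change Sum.elim _ _ ((headTailEquiv h).symm (headTailEquiv h (Sum.inr j))) = _
      rw [Equiv.symm_apply_apply]
      rfl
  continuous_toFun := by
    unfold headPart tailPart
    fun_prop
  continuous_invFun := by
    refine (PiLp.continuous_toLp 2 _).comp (continuous_pi fun ik => ?_)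
    cases (headTailEquiv h).symm ik.1 with
    | inl i => simp only [Sum.elim_inl]; fun_prop
    | inr j => simp only [Sum.elim_inr]; fun_prop

/-- Products of indicators of sets of finite measure turn the hypothesis into vanishing integrals of
`u` over rectangles. -/
theorem eq_zero_of_inner_tensor {q N : ℕ} (h : q ≤ N) {u : L2 N}
    (hu : ∀ f g, ⟪tensor h f g, u⟫_ℂ = 0) : u = 0 := by
  have hmp := measurePreserving_headPart_tailPart h
  have he : MeasurableEmbedding fun x : Config N => (headPart h x, tailPart h x) :=
    (splitHomeomorph h).toMeasurableEquiv.measurableEmbedding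
  let u' : Config q × Config (N - q) → ℂ := fun z => u ((splitHomeomorph h).symm z)
  have hu' : ∀ x, u' (headPart h x, tailPart h x) = u x := fun x =>
    congrArg u ((splitHomeomorph h).symm_apply_apply x)
  have hmeas : ∀ s t, MeasurableSet s → MeasurableSet t →
      MeasurableSet ((fun x : Config N => (headPart h x, tailPart h x)) ⁻¹' (s ×ˢ t)) :=
    fun s t hs ht => hmp.measurable (hs.prod ht)
  have hzero : u' =ᵐ[(volume : Measure (Config q)).prod volume] 0 := by
    refine ae_eq_zero_of_setIntegral_rectangle (fun s t hs ht hsf htf => ?_)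
      (fun s t hs ht hsf htf => ?_)
    · rw [← hmp.integrableOn_comp_preimage he]
      have : u' ∘ (fun x : Config N => (headPart h x, tailPart h x)) = u := funext hu'
      rw [this]
      have : IsFiniteMeasure (volume.restrict
          ((fun x : Config N => (headPart h x, tailPart h x)) ⁻¹' (s ×ˢ t))) := by
        refine ⟨?_⟩
        rw [Measure.restrict_apply_univ, hmp.measure_preimage (hs.prod ht).nullMeasurableSet,
          Measure.prod_prod]
        exact ENNReal.mul_lt_top hsf htf
      exact ((Lp.memLp u).restrict _).integrable (by norm_num)
    · rw [← hmp.setIntegral_preimage_emb he]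
      simp only [hu']
      have h1 := hu (indicatorConstLp 2 hs hsf.ne 1) (indicatorConstLp 2 ht htf.ne 1)
      rw [L2.inner_def] at h1
      rw [← h1, ← integral_indicator (hmeas s t hs ht)]
      refine integral_congr_ae ?_
      filter_upwards [tensor_coe h (indicatorConstLp 2 hs hsf.ne (1 : ℂ))
          (indicatorConstLp 2 ht htf.ne 1),
        (quasi_head h).ae (indicatorConstLp_coeFn (p := 2) (hs := hs) (hμs := hsf.ne) (c := (1 : ℂ))),
        (quasi_tail h).ae (indicatorConstLp_coeFn (p := 2) (hs := ht) (hμs := htf.ne) (c := (1 : ℂ)))]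
        with x h2 h3 h4
      rw [h2, h3, h4]
      by_cases hx : headPart h x ∈ s <;> by_cases hy : tailPart h x ∈ t <;>
        simp [Set.indicator, hx, hy]
  refine Lp.ext ?_
  filter_upwards [hmp.quasiMeasurePreserving.ae hzero, Lp.coeFn_zero ℂ 2 (volume : Measure (Config N))]
    with x h1 h2
  rw [h2, ← hu', h1]
  rfl

theorem dense_span_tensor {q N : ℕ} (h : q ≤ N) :
    Dense (Submodule.span ℂ {u : L2 N | ∃ f g, u = tensor h f g} : Set (L2 N)) := by
  rw [Submodule.dense_iff_topologicalClosure_eq_top, Submodule.topologicalClosure_eq_top_iff,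
    Submodule.eq_bot_iff]
  intro u hu
  refine eq_zero_of_inner_tensor h fun f g => ?_
  exact (Submodule.mem_orthogonal _ _).1 hu _ (Submodule.subset_span ⟨f, g, rfl⟩)

theorem ext_tensor {q N : ℕ} (h : q ≤ N) {E : Type*} [NormedAddCommGroup E] [NormedSpace ℂ E]
    {S T : L2 N →L[ℂ] E} (hST : ∀ f g, S (tensor h f g) = T (tensor h f g)) : S = T := by
  refine ContinuousLinearMap.ext_on (dense_span_tensor h) ?_
  rintro _ ⟨f, g, rfl⟩
  exact hST f g

end Density

/-! ### The amplification as a homomorphism of C⋆-algebras -/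

section Amplify

variable {q N : ℕ} (h : q ≤ N)

/-- Density makes the chosen operator unique; the algebraic rules below follow by checking product
functions. -/
theorem amplify_eq_of_tensor {b : L2 q →L[ℂ] L2 q} {T : L2 N →L[ℂ] L2 N}
    (hT : ∀ f g, T (tensor h f g) = tensor h (b f) g) : amplify h b = T :=
  ext_tensor h fun f g => by rw [amplify_tensor, hT]

theorem amplify_comp (b c : L2 q →L[ℂ] L2 q) :
    amplify h (b ∘L c) = amplify h b ∘L amplify h c :=
  amplify_eq_of_tensor h fun f g => by simp [amplify_tensor]

theorem amplify_add (b c : L2 q →L[ℂ] L2 q) : amplify h (b + c) = amplify h b + amplify h c :=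
  amplify_eq_of_tensor h fun f g => by
    simp only [add_apply, amplify_tensor]
    simp only [← tensorL_apply, map_add, add_apply]

theorem amplify_smul (z : ℂ) (b : L2 q →L[ℂ] L2 q) : amplify h (z • b) = z • amplify h b :=
  amplify_eq_of_tensor h fun f g => by
    simp only [smul_apply, amplify_tensor]
    simp only [← tensorL_apply, map_smul, smul_apply]

theorem amplify_sub (b c : L2 q →L[ℂ] L2 q) : amplify h (b - c) = amplify h b - amplify h c :=
  amplify_eq_of_tensor h fun f g => by
    simp only [sub_apply, amplify_tensor]
    simp only [← tensorL_apply, map_sub, sub_apply]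

theorem amplify_zero : amplify h (0 : L2 q →L[ℂ] L2 q) = 0 :=
  amplify_eq_of_tensor h fun f g => by
    simp only [zero_apply, ← tensorL_apply, map_zero]

theorem amplify_sum {ι : Type*} (s : Finset ι) (b : ι → L2 q →L[ℂ] L2 q) :
    amplify h (∑ i ∈ s, b i) = ∑ i ∈ s, amplify h (b i) := by
  classical
  induction s using Finset.induction_on with
  | empty => simp [amplify_zero]
  | insert i s hi ih => rw [Finset.sum_insert hi, Finset.sum_insert hi, amplify_add, ih]

theorem amplify_adjoint (b : L2 q →L[ℂ] L2 q) :
    amplify h b.adjoint = (amplify h b).adjoint := by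
  refine amplify_eq_of_tensor h fun f g => ?_
  have h1 : innerSL ℂ ((amplify h b).adjoint (tensor h f g)) =
      innerSL ℂ (tensor h (b.adjoint f) g) := by
    refine ext_tensor h fun f' g' => ?_
    rw [innerSL_apply_apply, innerSL_apply_apply, ContinuousLinearMap.adjoint_inner_left,
      amplify_tensor, inner_tensor, inner_tensor, ContinuousLinearMap.adjoint_inner_left]
  exact ext_inner_right ℂ fun u => congrArg (fun T : L2 N →L[ℂ] ℂ => T u) h1

/-- `b ↦ b ⊗ I` as a homomorphism of C⋆-algebras. -/
def amplifyHom : (L2 q →L[ℂ] L2 q) →⋆ₙₐ[ℂ] (L2 N →L[ℂ] L2 N) where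
  toFun := amplify h
  map_smul' := amplify_smul h
  map_zero' := amplify_zero h
  map_add' := amplify_add h
  map_mul' := amplify_comp h
  map_star' := amplify_adjoint h

/-- Homomorphisms of C⋆-algebras are automatically contractive, so the construction of `amplify`
need not be reopened. -/
theorem norm_amplify_le (b : L2 q →L[ℂ] L2 q) : ‖amplify h b‖ ≤ ‖b‖ :=
  NonUnitalStarAlgHom.norm_apply_le (amplifyHom h) b

theorem continuous_amplify {Y : Type*} [TopologicalSpace Y] {b : Y → L2 q →L[ℂ] L2 q} {M : ℝ}
    (hM : ∀ y, ‖b y‖ ≤ M) (hb : ∀ f, Continuous fun y => b y f) (ψ : L2 N) :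
    Continuous fun y => amplify h (b y) ψ := by
  refine continuous_apply_of_dense (fun y => (norm_amplify_le h (b y)).trans (hM y))
    (dense_span_tensor h) ?_ ψ
  rintro _ ⟨f, g, rfl⟩
  simp only [amplify_tensor]
  exact (continuous_tensor_left h g).comp (hb f)

/-- Transport between `N - q - (m - q)` and `N - m` particles, numbers which are equal only
propositionally. -/
theorem exists_castCoe {a b : ℕ} (hab : b = a) (g : L2 a) :
    ∃ g' : L2 b, g' =ᵐ[volume] fun x =>
      g (WithLp.toLp 2 fun ik : Fin a × Fin 3 => x (Fin.cast hab.symm ik.1, ik.2)) := by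
  subst hab
  exact ⟨g, Filter.EventuallyEq.rfl⟩

/-- Associativity with `v = f' ⊗ g` up to reindexing. Only the independence of `v` from `f` matters
for `amplify_amplify`. -/
theorem exists_tensor_assoc {q m N : ℕ} (hqm : q ≤ m) (hmN : m ≤ N) (f' : L2 (m - q))
    (g : L2 (N - m)) :
    ∃ v : L2 (N - q), ∀ f, tensor hmN (tensor hqm f f') g = tensor (hqm.trans hmN) f v := by
  have h1 : m - q ≤ N - q := Nat.sub_le_sub_right hmN q
  have h2 : N - q - (m - q) = N - m := by omega
  obtain ⟨g', hg'⟩ := exists_castCoe h2 g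
  refine ⟨tensor h1 f' g', fun f => Lp.ext ?_⟩
  filter_upwards [tensor_coe hmN (tensor hqm f f') g, (quasi_head hmN).ae (tensor_coe hqm f f'),
    tensor_coe (hqm.trans hmN) f (tensor h1 f' g'),
    (quasi_tail (hqm.trans hmN)).ae (tensor_coe h1 f' g'),
    (quasi_tail (hqm.trans hmN)).ae ((quasi_tail h1).ae hg')] with x e1 e2 e3 e4 e5
  have c1 : headPart hqm (headPart hmN x) = headPart (hqm.trans hmN) x := rfl
  have c2 : tailPart hqm (headPart hmN x) = headPart h1 (tailPart (hqm.trans hmN) x) := rfl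
  have c3 : tailPart hmN x = WithLp.toLp 2 fun ik : Fin (N - m) × Fin 3 =>
      tailPart h1 (tailPart (hqm.trans hmN) x) (Fin.cast h2.symm ik.1, ik.2) := by
    ext ⟨i, k⟩
    simp only [tailPart]
    refine congrArg (fun l => x (l, k)) (Fin.ext ?_)
    simp
    omega
  rw [e1, e2, e3, e4, e5, mul_assoc, c1, c2, c3]

theorem amplify_amplify {q m N : ℕ} (hqm : q ≤ m) (hmN : m ≤ N) (b : L2 q →L[ℂ] L2 q) :
    amplify hmN (amplify hqm b) = amplify (hqm.trans hmN) b := by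
  refine amplify_eq_of_tensor hmN fun F g => ?_
  have key : amplify (hqm.trans hmN) b ∘L (tensorL hmN).flip g =
      (tensorL hmN).flip g ∘L amplify hqm b := by
    refine ext_tensor hqm fun f f' => ?_
    obtain ⟨v, hv⟩ := exists_tensor_assoc hqm hmN f' g
    simp only [ContinuousLinearMap.comp_apply, ContinuousLinearMap.flip_apply, tensorL_apply,
      amplify_tensor, hv]
  exact congrArg (fun T : L2 m →L[ℂ] L2 N => T F) key

theorem free_neg_free (ħ t : ℝ) (ψ : L2 N) : free ħ N (-t) (free ħ N t ψ) = ψ := by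
  rw [← ContinuousLinearMap.comp_apply, ← free_add, neg_add_cancel, free_zero]; rfl

/-- The tail evolves freely forwards and backwards, which cancels. -/
theorem amplify_free_conj (ħ t : ℝ) (b : L2 q →L[ℂ] L2 q) :
    amplify h (free ħ q (-t) ∘L b ∘L free ħ q t) =
      free ħ N (-t) ∘L amplify h b ∘L free ħ N t :=
  amplify_eq_of_tensor h fun f g => by
    simp only [ContinuousLinearMap.comp_apply, free_tensor, amplify_tensor, free_neg_free]

end Amplify

/-! ### The pair interaction -/

section Pair

variable {q N : ℕ} (h : q ≤ N) (w : Potential)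

theorem tailIdx_injective : Function.Injective (tailIdx h) := by
  intro i j hij
  simpa [tailIdx, Fin.ext_iff] using hij

theorem pairOp_castLE_tensor (i j : Fin q) (f : L2 q) (g : L2 (N - q)) :
    pairOp w (Fin.castLE h i) (Fin.castLE h j) (tensor h f g) = tensor h (pairOp w i j f) g := by
  by_cases hij : i = j
  · subst hij
    simp only [pairOp, ne_eq, not_true_eq_false, dite_false, zero_apply]
    rw [← tensorL_apply, map_zero]; rfl
  · have hij' : Fin.castLE h i ≠ Fin.castLE h j := fun e => hij (Fin.castLE_injective h e)
    simp only [pairOp, ne_eq, hij, hij', not_false_eq_true, dite_true]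
    refine Lp.ext ?_
    filter_upwards [mulOp_coe (memLp_pair w hij') (tensor h f g), tensor_coe h f g,
      tensor_coe h (mulOp (memLp_pair w hij) f) g,
      (quasi_head h).ae (mulOp_coe (memLp_pair w hij) f)] with x h1 h2 h3 h4
    rw [h1, h2, h3, h4, mul_assoc]
    rfl

theorem pairOp_tailIdx_tensor (i j : Fin (N - q)) (f : L2 q) (g : L2 (N - q)) :
    pairOp w (tailIdx h i) (tailIdx h j) (tensor h f g) = tensor h f (pairOp w i j g) := by
  by_cases hij : i = j
  · subst hij
    simp only [pairOp, ne_eq, not_true_eq_false, dite_false, zero_apply]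
    rw [← tensorL_apply, map_zero]
  · have hij' : tailIdx h i ≠ tailIdx h j := fun e => hij (tailIdx_injective h e)
    simp only [pairOp, ne_eq, hij, hij', not_false_eq_true, dite_true]
    refine Lp.ext ?_
    filter_upwards [mulOp_coe (memLp_pair w hij') (tensor h f g), tensor_coe h f g,
      tensor_coe h f (mulOp (memLp_pair w hij) g),
      (quasi_tail h).ae (mulOp_coe (memLp_pair w hij) g)] with x h1 h2 h3 h4
    rw [h1, h2, h3, h4, mul_left_comm]
    rfl

theorem amplify_pairOpAt (ħ s : ℝ) (i j : Fin q) :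
    amplify h (pairOpAt ħ w i j s) = pairOpAt ħ w (Fin.castLE h i) (Fin.castLE h j) s := by
  unfold pairOpAt
  rw [amplify_free_conj, amplify_eq_of_tensor h (pairOp_castLE_tensor h w i j)]

theorem pairOpAt_tailIdx_tensor (ħ s : ℝ) (i j : Fin (N - q)) (f : L2 q) (g : L2 (N - q)) :
    pairOpAt ħ w (tailIdx h i) (tailIdx h j) s (tensor h f g) =
      tensor h f (pairOpAt ħ w i j s g) := by
  simp only [pairOpAt, ContinuousLinearMap.comp_apply, free_tensor, pairOp_tailIdx_tensor,
    free_neg_free]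

theorem amplify_comm_pairOpAt_tailIdx (ħ s : ℝ) (b : L2 q →L[ℂ] L2 q) (i j : Fin (N - q)) :
    amplify h b ∘L pairOpAt ħ w (tailIdx h i) (tailIdx h j) s =
      pairOpAt ħ w (tailIdx h i) (tailIdx h j) s ∘L amplify h b :=
  ext_tensor h fun f g => by
    simp only [ContinuousLinearMap.comp_apply, pairOpAt_tailIdx_tensor, amplify_tensor]

theorem norm_potential_ae : ∀ᵐ y : Pt, ‖w y‖ ≤ ‖w‖ := by
  filter_upwards [ae_le_eLpNormEssSup (f := w) (μ := (volume : Measure Pt))] with y hy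
  rw [Lp.norm_def, eLpNorm_exponent_top, ← toReal_enorm]
  refine ENNReal.toReal_mono ?_ hy
  rw [← eLpNorm_exponent_top]
  exact (Lp.memLp w).2.ne

theorem quasi_relPos {i j : Fin N} (hij : i ≠ j) :
    Measure.QuasiMeasurePreserving (relPos i j) (volume : Measure (Config N)) volume := by
  have hsurj : Function.Surjective (relPos i j) := by
    intro y
    refine ⟨WithLp.toLp 2 fun ik => if ik.1 = i then y ik.2 else 0, ?_⟩
    ext k
    simp [relPos, hij.symm]
  refine ⟨(relPos i j).continuous_of_finiteDimensional.measurable, ?_⟩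
  obtain ⟨c, -, -, hc⟩ := (relPos i j).exists_map_addHaar_eq_smul_addHaar'
    (volume : Measure (Config N)) (volume : Measure Pt) hsurj
  rw [hc]
  exact Measure.smul_absolutelyContinuous

theorem norm_pairOp_le (i j : Fin N) : ‖pairOp w i j‖ ≤ ‖w‖ := by
  unfold pairOp
  split_ifs with hij
  · refine norm_mulOp_le _ (norm_nonneg _) ?_
    filter_upwards [(quasi_relPos hij).ae (norm_potential_ae w)] with x hx
    simpa using hx
  · simp

theorem norm_pairOpAt_le (ħ s : ℝ) (i j : Fin N) : ‖pairOpAt ħ w i j s‖ ≤ ‖w‖ := by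
  refine ContinuousLinearMap.opNorm_le_bound _ (norm_nonneg _) fun ψ => ?_
  simp only [pairOpAt, ContinuousLinearMap.comp_apply, norm_free_apply]
  refine ((pairOp w i j).le_opNorm _).trans ?_
  rw [norm_free_apply]
  exact mul_le_mul_of_nonneg_right (norm_pairOp_le w i j) (norm_nonneg _)

theorem continuous_pairOpAt (ħ : ℝ) (i j : Fin N) (ψ : L2 N) :
    Continuous fun s => pairOpAt ħ w i j s ψ :=
  continuous_apply_of_bounded (T := fun s => free ħ N (-s)) (fun s => norm_free_le ħ (-s))
    (fun ψ => (continuous_free ħ ψ).comp continuous_neg)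
    ((pairOp w i j).continuous.comp (continuous_free ħ ψ))

theorem inner_pairOp (i j : Fin N) (φ ψ : L2 N) :
    ⟪pairOp w i j φ, ψ⟫_ℂ = ⟪φ, pairOp w i j ψ⟫_ℂ := by
  unfold pairOp
  split_ifs with hij
  · exact inner_mulOp _ φ ψ
  · simp

theorem pairOp_self (i : Fin N) : pairOp w i i = 0 := by simp [pairOp]

/-- The one place where the evenness of `w` acts directly. -/
theorem pairOp_comm (hw : ∀ᵐ x : Pt, w (-x) = w x) (i j : Fin N) :
    pairOp w i j = pairOp w j i := by
  by_cases hij : i = j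
  · rw [hij]
  · have hji : j ≠ i := Ne.symm hij
    simp only [pairOp, ne_eq, hij, hji, not_false_eq_true, dite_true]
    refine mulOp_congr _ _ ?_
    filter_upwards [(quasi_relPos hji).ae hw] with x hx
    rw [← hx]
    congr 3
    ext k
    simp [relPos]

theorem permOp_pairOp (σ : Equiv.Perm (Fin N)) (i j : Fin N) (ψ : L2 N) :
    permOp σ (pairOp w i j ψ) = pairOp w (σ i) (σ j) (permOp σ ψ) := by
  by_cases hij : i = j
  · subst hij
    simp [pairOp]
  · have hij' : σ i ≠ σ j := fun e => hij (σ.injective e)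
    simp only [pairOp, ne_eq, hij, hij', not_false_eq_true, dite_true]
    refine permOp_mulOp σ _ _ (fun x => ?_) ψ
    have e : relPos (σ i) (σ j) x = relPos i j (permConfig σ x) := by
      ext k
      simp [relPos, permConfig_apply]
    rw [e]

theorem permOp_pairOpAt (ħ s : ℝ) (σ : Equiv.Perm (Fin N)) (i j : Fin N) (ψ : L2 N) :
    permOp σ (pairOpAt ħ w i j s ψ) = pairOpAt ħ w (σ i) (σ j) s (permOp σ ψ) := by
  simp only [pairOpAt, ContinuousLinearMap.comp_apply, ← free_permOp, permOp_pairOp]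

theorem permOp_tensor {σ : Equiv.Perm (Fin N)} {σ' : Equiv.Perm (Fin (N - q))}
    (hhead : ∀ i, σ (Fin.castLE h i) = Fin.castLE h i)
    (htail : ∀ j, σ (tailIdx h j) = tailIdx h (σ' j)) (f : L2 q) (g : L2 (N - q)) :
    permOp σ (tensor h f g) = tensor h f (permOp σ' g) := by
  refine Lp.ext ?_
  filter_upwards [permOp_coe σ (tensor h f g), (quasi_permConfig σ).ae (tensor_coe h f g),
    tensor_coe h f (permOp σ' g), (quasi_tail h).ae (permOp_coe σ' g)] with x h1 h2 h3 h4
  have e1 : headPart h (permConfig σ x) = headPart h x := by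
    ext ⟨i, k⟩
    simp only [headPart, permConfig_apply, hhead]
  have e2 : tailPart h (permConfig σ x) = permConfig σ' (tailPart h x) := by
    ext ⟨j, k⟩
    rw [permConfig_apply]
    change permConfig σ x (tailIdx h j, k) = x (tailIdx h (σ' j), k)
    rw [permConfig_apply, htail]
  rw [h1, h2, h3, h4, e1, e2]

/-- A permutation of the tail acts on the second tensor factor only. -/
theorem permOp_swap_amplify (b : L2 q →L[ℂ] L2 q) (j k : Fin (N - q)) (ψ : L2 N) :
    permOp (Equiv.swap (tailIdx h j) (tailIdx h k)) (amplify h b ψ) =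
      amplify h b (permOp (Equiv.swap (tailIdx h j) (tailIdx h k)) ψ) := by
  have hne : ∀ i j, Fin.castLE h i ≠ tailIdx h j := fun i j => by
    rw [← headTailEquiv_inl, ← headTailEquiv_inr, Ne, (headTailEquiv h).injective.eq_iff]
    exact Sum.inl_ne_inr
  have ht := permOp_tensor h (σ := Equiv.swap (tailIdx h j) (tailIdx h k))
    (σ' := Equiv.swap j k) (fun i => Equiv.swap_apply_of_ne_of_ne (hne i j) (hne i k))
    (fun l => (tailIdx_injective h).swap_apply j k l)
  have key : (permOp (Equiv.swap (tailIdx h j) (tailIdx h k))).toContinuousLinearMap ∘L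
      amplify h b = amplify h b ∘L
      (permOp (Equiv.swap (tailIdx h j) (tailIdx h k))).toContinuousLinearMap :=
    ext_tensor h fun f g => by
      simp [amplify_tensor, ht]
  exact congrArg (fun T : L2 N →L[ℂ] L2 N => T ψ) key

end Pair

/-! ### Compression to the symmetric subspace -/

section Symmetric

variable {N : ℕ}

theorem inner_symProj (u : L2 N) (χ : L2S N) : ⟪symProj N u, χ⟫_ℂ = ⟪u, incl N χ⟫_ℂ := by
  have h : (incl N).adjoint = symProj N := Submodule.adjoint_subtypeL _
  rw [← h, ContinuousLinearMap.adjoint_inner_left]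

theorem symProj_incl (χ : L2S N) : symProj N (incl N χ) = χ :=
  Submodule.orthogonalProjectionOnto_mem_subspace_eq_self χ

theorem permOp_incl (σ : Equiv.Perm (Fin N)) (χ : L2S N) : permOp σ (incl N χ) = incl N χ :=
  (mem_symmetric _).1 χ.2 σ

/-- Permutations are isometries fixing every symmetric vector, so both sides have the same inner
products with such vectors. -/
theorem symProj_permOp (σ : Equiv.Perm (Fin N)) (u : L2 N) :
    symProj N (permOp σ u) = symProj N u := by
  refine ext_inner_right ℂ fun χ => ?_
  rw [inner_symProj, inner_symProj, ← permOp_incl σ χ, LinearIsometry.inner_map_map, permOp_incl]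

theorem norm_symProj_le : ‖symProj N‖ ≤ 1 := Submodule.orthogonalProjectionOnto_norm_le _

theorem norm_compress_le (T : L2 N →L[ℂ] L2 N) : ‖compress T‖ ≤ ‖T‖ := by
  refine ContinuousLinearMap.opNorm_le_bound _ (norm_nonneg _) fun ψ => ?_
  refine ((symProj N).le_of_opNorm_le norm_symProj_le _).trans ?_
  rw [one_mul]
  exact (T.le_opNorm _).trans_eq rfl

theorem norm_extendOp_le (a : L2S N →L[ℂ] L2S N) : ‖extendOp a‖ ≤ ‖a‖ := by
  refine ContinuousLinearMap.opNorm_le_bound _ (norm_nonneg a) fun ψ => ?_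
  change ‖a (symProj N ψ)‖ ≤ _
  refine (a.le_opNorm _).trans (mul_le_mul_of_nonneg_left ?_ (norm_nonneg a))
  simpa using (symProj N).le_of_opNorm_le norm_symProj_le ψ

/-- Operators that commute with the permutations of the particles. -/
def IsPermInvariant (T : L2 N →L[ℂ] L2 N) : Prop :=
  ∀ (σ : Equiv.Perm (Fin N)) (ψ : L2 N), permOp σ (T ψ) = T (permOp σ ψ)

theorem IsPermInvariant.incl_compress {T : L2 N →L[ℂ] L2 N} (hT : IsPermInvariant T)
    (χ : L2S N) : incl N (compress T χ) = T (incl N χ) := by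
  have h : T (incl N χ) ∈ symmetric N := (mem_symmetric _).2 fun σ => by rw [hT, permOp_incl]
  exact congrArg (incl N) (symProj_incl ⟨_, h⟩)

theorem IsPermInvariant.adjoint {T : L2 N →L[ℂ] L2 N} (hT : IsPermInvariant T) :
    IsPermInvariant T.adjoint := by
  intro σ ψ
  refine ext_inner_right ℂ fun φ => ?_
  rw [ContinuousLinearMap.adjoint_inner_left, ← permOp_permOp_inv σ φ,
    LinearIsometry.inner_map_map, ← hT, LinearIsometry.inner_map_map,
    ContinuousLinearMap.adjoint_inner_left]

/-- The adjoint of `S` preserves the symmetric subspace, so `P_S S = P_S S P_S`. Compression is not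
multiplicative in general; one invariant factor suffices. -/
theorem IsPermInvariant.compress_comp {S T : L2 N →L[ℂ] L2 N} (hS : IsPermInvariant S) :
    compress (S ∘L T) = compress S ∘L compress T := by
  ext1 ψ
  refine ext_inner_right ℂ fun χ => ?_
  change ⟪symProj N (S (T (incl N ψ))), χ⟫_ℂ =
    ⟪symProj N (S (incl N (symProj N (T (incl N ψ))))), χ⟫_ℂ
  rw [inner_symProj, inner_symProj, ← ContinuousLinearMap.adjoint_inner_right S,
    ← ContinuousLinearMap.adjoint_inner_right S, ← hS.adjoint.incl_compress, ← inner_symProj,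
    ← inner_symProj, symProj_incl]

theorem IsPermInvariant.compress_comp' {S T : L2 N →L[ℂ] L2 N} (hT : IsPermInvariant T) :
    compress (S ∘L T) = compress S ∘L compress T := by
  ext1 ψ
  change symProj N (S (T (incl N ψ))) = symProj N (S (incl N (compress T ψ)))
  rw [hT.incl_compress]

theorem IsPermInvariant.comp {S T : L2 N →L[ℂ] L2 N} (hS : IsPermInvariant S)
    (hT : IsPermInvariant T) : IsPermInvariant (S ∘L T) := fun σ ψ => by
  simp only [ContinuousLinearMap.comp_apply, hS σ, hT σ]

theorem isPermInvariant_free (ħ t : ℝ) : IsPermInvariant (free ħ N t) := fun σ ψ =>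
  (free_permOp ħ t σ ψ).symm

/-- Compression does not see conjugation by permutations. This is how bosonic symmetry identifies
the tail particles. -/
theorem compress_conj_perm (σ : Equiv.Perm (Fin N)) {S T : L2 N →L[ℂ] L2 N}
    (h : ∀ ψ, permOp σ (S ψ) = T (permOp σ ψ)) : compress S = compress T := by
  ext1 ψ
  change symProj N (S (incl N ψ)) = symProj N (T (incl N ψ))
  rw [← symProj_permOp σ (S _), h, permOp_incl]

/-- The compression as a linear map. -/
def compressL (N : ℕ) : (L2 N →L[ℂ] L2 N) →ₗ[ℂ] (L2S N →L[ℂ] L2S N) where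
  toFun := compress
  map_add' S T := by ext1 ψ; simp [compress]
  map_smul' c T := by ext1 ψ; simp [compress]

/-- The compressed commutator with a fixed operator `G`, as a linear map. -/
def compressCommL (G : L2 N →L[ℂ] L2 N) : (L2 N →L[ℂ] L2 N) →ₗ[ℂ] (L2S N →L[ℂ] L2S N) :=
  compressL N ∘ₗ (LinearMap.mulRight ℂ G - LinearMap.mulLeft ℂ G)

theorem compressCommL_apply (G X : L2 N →L[ℂ] L2 N) :
    compressCommL G X = compress (X ∘L G - G ∘L X) := rfl

theorem norm_compressCommL_le (G X : L2 N →L[ℂ] L2 N) :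
    ‖compressCommL G X‖ ≤ 2 * ‖X‖ * ‖G‖ := by
  rw [compressCommL_apply]
  refine (norm_compress_le _).trans ((norm_sub_le _ _).trans ?_)
  have h1 := X.opNorm_comp_le G
  have h2 := G.opNorm_comp_le X
  linarith

end Symmetric

/-! ### The interaction -/

section Interaction

variable {N : ℕ} (w : Potential)

theorem sum_sum_eq_two_smul {M : Type*} [AddCommMonoid M] {F : Fin N → Fin N → M}
    (hsymm : ∀ i j, F i j = F j i) (hdiag : ∀ i, F i i = 0) :
    ∑ i, ∑ j, F i j = 2 • ∑ j, ∑ i ∈ Finset.Iio j, F i j := by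
  have h1 : ∀ j, ∑ i ∈ Finset.Iio j, F i j = ∑ i, if i < j then F i j else 0 := by
    intro j
    rw [← Finset.sum_filter]
    congr 1
    ext i
    simp
  have h2 : ∀ i j, F i j = (if i < j then F i j else 0) + (if j < i then F j i else 0) := by
    intro i j
    rcases lt_trichotomy i j with h | h | h
    · simp [h, h.not_gt]
    · simp [h, hdiag]
    · simp [h, h.not_gt, hsymm i j]
  simp only [h1]
  calc ∑ i, ∑ j, F i j = ∑ i, ∑ j, ((if i < j then F i j else 0) +
        (if j < i then F j i else 0)) :=
        Finset.sum_congr rfl fun i _ => Finset.sum_congr rfl fun j _ => h2 i j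
    _ = _ := by
      simp only [Finset.sum_add_distrib]
      rw [two_smul]
      congr 1
      exact Finset.sum_comm

/-- Unrestricted sums, with vanishing diagonal, allow each index to be permuted or split into head
and tail separately. -/
theorem interaction_eq (hw : ∀ᵐ x : Pt, w (-x) = w x) :
    interaction w N = (1 / (2 * N : ℂ)) • ∑ i : Fin N, ∑ j : Fin N, pairOp w i j := by
  rw [sum_sum_eq_two_smul (pairOp_comm w hw) (pairOp_self w), interaction, ← Nat.cast_smul_eq_nsmul
    ℂ, smul_smul]
  congr 1
  push_cast
  field_simp

theorem inner_interaction (φ ψ : L2 N) :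
    ⟪interaction w N φ, ψ⟫_ℂ = ⟪φ, interaction w N ψ⟫_ℂ := by
  simp only [interaction, smul_apply, sum_apply, inner_smul_left, inner_smul_right, sum_inner,
    inner_sum, inner_pairOp]
  simp

/-- The interaction in the interaction picture. -/
def interactionAt (ħ : ℝ) (w : Potential) (N : ℕ) (s : ℝ) : L2 N →L[ℂ] L2 N :=
  free ħ N (-s) ∘L interaction w N ∘L free ħ N s

theorem interactionAt_eq (hw : ∀ᵐ x : Pt, w (-x) = w x) (ħ s : ℝ) :
    interactionAt ħ w N s =
      (1 / (2 * N : ℂ)) • ∑ i : Fin N, ∑ j : Fin N, pairOpAt ħ w i j s := by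
  ext1 ψ
  simp only [interactionAt, interaction_eq w hw, pairOpAt, ContinuousLinearMap.comp_apply,
    smul_apply, sum_apply, map_smul, map_sum]

theorem isPermInvariant_interaction (hw : ∀ᵐ x : Pt, w (-x) = w x) :
    IsPermInvariant (interaction w N) := by
  intro σ ψ
  simp only [interaction_eq w hw, smul_apply, sum_apply, map_smul, map_sum, permOp_pairOp]
  congr 1
  rw [Equiv.sum_comp σ fun i => ∑ j, pairOp w i (σ j) (permOp σ ψ)]
  exact Finset.sum_congr rfl fun i _ => Equiv.sum_comp σ fun j => pairOp w i j (permOp σ ψ)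

theorem isPermInvariant_interactionAt (hw : ∀ᵐ x : Pt, w (-x) = w x) (ħ s : ℝ) :
    IsPermInvariant (interactionAt ħ w N s) :=
  (isPermInvariant_free ħ (-s)).comp ((isPermInvariant_interaction w hw).comp
    (isPermInvariant_free ħ s))

end Interaction

/-! ### The unitary groups on the symmetric subspace -/

section Propagator

/-- The free propagator on `L²_S`. -/
def freeS (ħ : ℝ) (N : ℕ) (t : ℝ) : L2S N →L[ℂ] L2S N := compress (free ħ N t)

/-- The kinetic energy on `L²_S`. -/
def kineticS (ħ : ℝ) (N : ℕ) : L2S N →ₗ.[ℂ] L2S N where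
  domain := (kinetic ħ N).domain.comap (incl N).toLinearMap
  toFun := (symProj N).toLinearMap ∘ₗ (kinetic ħ N).toFun ∘ₗ
    (incl N).toLinearMap.submoduleComap _

theorem incl_freeS (ħ : ℝ) {N : ℕ} (t : ℝ) (ψ : L2S N) :
    incl N (freeS ħ N t ψ) = free ħ N t (incl N ψ) :=
  (isPermInvariant_free ħ t).incl_compress ψ

/-- The inclusion intertwines the two free groups, so differentiability of orbits passes up by the
inclusion and down by the projection. -/
theorem freeS_isUnitaryGroup {ħ : ℝ} (hħ : ħ ≠ 0) (N : ℕ) :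
    IsUnitaryGroup ħ (kineticS ħ N) (freeS ħ N) := by
  have hfree := free_isUnitaryGroup hħ N
  have hinj : ∀ {x y : L2S N}, incl N x = incl N y → x = y := fun h => Subtype.ext h
  have h0 : freeS ħ N 0 = ContinuousLinearMap.id ℂ (L2S N) := by
    ext1 ψ
    apply hinj
    rw [incl_freeS, free_zero]
    rfl
  have hadd : ∀ s t, freeS ħ N (s + t) = freeS ħ N s ∘L freeS ħ N t := fun s t => by
    ext1 ψ
    apply hinj
    rw [ContinuousLinearMap.comp_apply, incl_freeS, incl_freeS, incl_freeS, free_add]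
    rfl
  have hn : ∀ t ψ, ‖freeS ħ N t ψ‖ = ‖ψ‖ := fun t ψ => by
    change ‖incl N (freeS ħ N t ψ)‖ = ‖incl N ψ‖
    rw [incl_freeS, norm_free_apply]
  refine ⟨h0, hadd, mem_unitary_of_group h0 hadd hn,
    fun ψ => (symProj N).continuous.comp (continuous_free ħ (incl N ψ)), fun ψ φ => ⟨fun h => ?_, ?_⟩⟩
  · have h1 : HasDerivAt (fun t => free ħ N t (incl N ψ)) (incl N φ) 0 := by
      refine (((incl N).restrictScalars ℝ).hasFDerivAt.comp_hasDerivAt 0 h).congr_of_eventuallyEq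
        (Filter.Eventually.of_forall fun t => ?_)
      exact (incl_freeS ħ t ψ).symm
    obtain ⟨hψ, e⟩ := (hfree.generator _ _).1 h1
    refine ⟨hψ, ?_⟩
    rw [← symProj_incl φ, e, map_smul]
    rfl
  · rintro ⟨hψ, rfl⟩
    have h1 := (hfree.generator (incl N ψ) _).2 ⟨hψ, rfl⟩
    refine (((symProj N).restrictScalars ℝ).hasFDerivAt.comp_hasDerivAt 0 h1).congr_deriv ?_
    exact map_smul (symProj N) _ _

theorem inner_compress_interaction (w : Potential) {N : ℕ} (φ ψ : L2S N) :
    ⟪compress (interaction w N) φ, ψ⟫_ℂ = ⟪φ, compress (interaction w N) ψ⟫_ℂ := by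
  rw [← inner_conj_symm φ]
  change ⟪symProj N (interaction w N (incl N φ)), ψ⟫_ℂ =
    starRingEnd ℂ ⟪symProj N (interaction w N (incl N ψ)), φ⟫_ℂ
  rw [inner_symProj, inner_symProj, inner_conj_symm, inner_interaction]

theorem freeS_conj_interaction (ħ : ℝ) (w : Potential) {N : ℕ} (s : ℝ) :
    freeS ħ N (-s) ∘L compress (interaction w N) ∘L freeS ħ N s =
      compress (interactionAt ħ w N s) := by
  rw [interactionAt, (isPermInvariant_free ħ (-s)).compress_comp,
    (isPermInvariant_free ħ s).compress_comp']
  rfl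

theorem continuous_compress_interactionAt {ħ : ℝ} (w : Potential) {N : ℕ} (ψ : L2S N) :
    Continuous fun s => compress (interactionAt ħ w N s) ψ := by
  refine (symProj N).continuous.comp ?_
  exact continuous_apply_of_bounded (T := fun s => free ħ N (-s)) (fun s => norm_free_le ħ (-s))
    (fun ψ => (continuous_free ħ ψ).comp continuous_neg)
    ((interaction w N).continuous.comp (continuous_free ħ (incl N ψ)))

theorem norm_compress_interactionAt_le (ħ : ℝ) (w : Potential) {N : ℕ} (s : ℝ) :
    ‖compress (interactionAt ħ w N s)‖ ≤ ‖interaction w N‖ := by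
  refine (norm_compress_le _).trans ?_
  refine ContinuousLinearMap.opNorm_le_bound _ (norm_nonneg _) fun ψ => ?_
  simp only [interactionAt, ContinuousLinearMap.comp_apply, norm_free_apply]
  exact ((interaction w N).le_opNorm _).trans_eq (by rw [norm_free_apply])

theorem inner_compress_interactionAt {ħ : ℝ} (hħ : ħ ≠ 0) (w : Potential) {N : ℕ} (s : ℝ)
    (φ ψ : L2S N) :
    ⟪compress (interactionAt ħ w N s) φ, ψ⟫_ℂ = ⟪φ, compress (interactionAt ħ w N s) ψ⟫_ℂ := by
  have h := freeS_isUnitaryGroup hħ N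
  have h1 := h.inner_neg_apply (-s)
  simp only [neg_neg] at h1
  simp only [← freeS_conj_interaction, ContinuousLinearMap.comp_apply, h.inner_neg_apply,
    inner_compress_interaction, ← h1]

/-- The propagator is the free propagator times the propagator in the interaction picture. -/
theorem exists_propagator_eq {ħ : ℝ} (hħ : ħ ≠ 0) (w : Potential) (N : ℕ) :
    ∃ V, IsInteractionPropagator ħ (fun s => compress (interactionAt ħ w N s)) V ∧
      IsUnitaryGroup ħ (hamiltonian ħ w N) (propagator ħ w N) ∧
      propagator ħ w N = fun t => freeS ħ N t ∘L V t := by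
  obtain ⟨V, hV⟩ := exists_isInteractionPropagator ħ (inner_compress_interactionAt hħ w (N := N))
    (norm_compress_interactionAt_le ħ w) (continuous_compress_interactionAt w)
  have hU : IsUnitaryGroup ħ (hamiltonian ħ w N) fun t => freeS ħ N t ∘L V t := by
    refine (freeS_isUnitaryGroup hħ N).perturb (T := hamiltonian ħ w N) (W := compress (interaction w N))
      (inner_compress_interaction w) rfl (fun ψ hψ hψ' => ?_)
      (by simpa only [freeS_conj_interaction] using hV)
    exact map_add (symProj N) _ _
  have he : propagator ħ w N = fun t => freeS ħ N t ∘L V t := hU.unitaryGroup_eq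
  exact ⟨V, hV, he ▸ hU, he⟩

end Propagator

/-! ### Estimates for commutators -/

section Abstract

variable {H : Type*} [NormedAddCommGroup H] [InnerProductSpace ℂ H]

theorem comp_smul_sub_smul_comp (W A : H →L[ℂ] H) (c : ℂ) :
    W ∘L (c • A) - (c • A) ∘L W = c • (W ∘L A - A ∘L W) := by
  rw [ContinuousLinearMap.comp_smul, ContinuousLinearMap.smul_comp, smul_sub]

theorem norm_smul_sum_sum_le {ι : Type*} [Fintype ι] {X : ι → ι → H →L[ℂ] H} {M : ℝ}
    (h : ∀ i j, ‖X i j‖ ≤ M) (c : ℂ) :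
    ‖c • ∑ i, ∑ j, X i j‖ ≤ ‖c‖ * (Fintype.card ι * (Fintype.card ι * M)) := by
  refine (ContinuousLinearMap.opNorm_smul_le c _).trans
    (mul_le_mul_of_nonneg_left ?_ (norm_nonneg c))
  refine (norm_sum_le_of_le _ fun i _ => norm_sum_le_of_le _ fun j _ => h i j).trans ?_
  simp

theorem smul_sum_sum_isEmpty {ι κ : Type*} [Fintype ι] [Fintype κ] [IsEmpty κ] (c : ℂ)
    (X : ι → κ → H →L[ℂ] H) : c • ∑ i, ∑ j, X i j = 0 := by
  simp

theorem continuous_smul_apply {Y : Type*} [TopologicalSpace Y] {T : Y → H →L[ℂ] H} (c : ℂ) {ψ : H}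
    (hT : Continuous fun y => T y ψ) : Continuous fun y => (c • T y) ψ :=
  hT.const_smul c

theorem norm_smul_commutator_zero (W : H →L[ℂ] H) (c : ℂ) :
    ‖c • (W ∘L (0 : H →L[ℂ] H) - (0 : H →L[ℂ] H) ∘L W) - 0‖ = 0 := by
  simp

theorem norm_smul_sum_commutator_le {ι : Type*} [Fintype ι] {W : ι → H →L[ℂ] H} {G : H →L[ℂ] H}
    {k M : ℝ} (hW : ∀ i, ‖W i‖ ≤ k) (hG : ‖G‖ ≤ M) (c : ℂ) :
    ‖c • ∑ i, (W i ∘L G - G ∘L W i)‖ ≤ ‖c‖ * (Fintype.card ι * (2 * k * M)) := by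
  have h1 : ∀ i, ‖W i ∘L G - G ∘L W i‖ ≤ 2 * k * M := fun i => by
    have hk : 0 ≤ k := (norm_nonneg _).trans (hW i)
    have hM : 0 ≤ M := (norm_nonneg _).trans hG
    have h2 : ‖W i‖ * ‖G‖ ≤ k * M := mul_le_mul (hW i) hG (norm_nonneg _) hk
    have h3 := (W i).opNorm_comp_le G
    have h4 := G.opNorm_comp_le (W i)
    have h5 := norm_sub_le (W i ∘L G) (G ∘L W i)
    linarith
  refine (ContinuousLinearMap.opNorm_smul_le c _).trans
    (mul_le_mul_of_nonneg_left ?_ (norm_nonneg c))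
  refine (norm_sum_le_of_le _ fun i _ => h1 i).trans ?_
  simp

theorem continuous_smul_sum_commutator {Y ι : Type*} [TopologicalSpace Y] [Fintype ι]
    {W : ι → Y → H →L[ℂ] H} {G : Y → H →L[ℂ] H} {k M : ℝ} (hWb : ∀ i y, ‖W i y‖ ≤ k)
    (hGb : ∀ y, ‖G y‖ ≤ M) (hW : ∀ i ψ, Continuous fun y => W i y ψ)
    (hG : ∀ ψ, Continuous fun y => G y ψ) (c : ℂ) (ψ : H) :
    Continuous fun y => (c • ∑ i, (W i y ∘L G y - G y ∘L W i y)) ψ := by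
  simp only [smul_apply, sum_apply, sub_apply, ContinuousLinearMap.comp_apply]
  exact Continuous.const_smul (continuous_finsetSum _ fun i _ =>
    (continuous_apply_of_bounded (hWb i) (hW i) (hG ψ)).sub
      (continuous_apply_of_bounded hGb hG (hW i ψ))) c

theorem isTimeOrderedIntegral_eq_zero {n : ℕ} {t : ℝ} {F : (Fin n → ℝ) → H →L[ℂ] H}
    {B : H →L[ℂ] H} (hB : IsTimeOrderedIntegral t F B) (hF : ∀ τ, F τ = 0) : B = 0 := by
  ext1 ψ
  have := norm_timeOrdered_le n t (f := fun τ => F τ ψ) (M := 0) (fun τ => by rw [hF]; simp)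
  rw [hB.apply_eq]
  simpa using this

theorem summable_norm_of_eq_zero {B : ℕ → H →L[ℂ] H} {M : ℕ} (hB : ∀ n, M ≤ n → B n = 0) :
    Summable fun n => ‖B n‖ :=
  summable_of_ne_finset_zero (s := Finset.range M) fun n hn => by
    rw [hB n (by simpa using hn), norm_zero]

theorem sum_range_succ_eq_tsum {B : ℕ → H →L[ℂ] H} {M : ℕ} (hB : ∀ n, M < n → B n = 0) :
    ∑ m ∈ Finset.range (M + 1), B m = B 0 + ∑' n, B (n + 1) := by
  rw [Finset.sum_range_succ', add_comm, tsum_eq_sum (s := Finset.range M)]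
  intro n hn
  rw [Finset.mem_range, not_lt] at hn
  exact hB (n + 1) (by omega)

end Abstract

/-! ### Commutators of the interaction with observables -/

section Commutator

variable {N : ℕ} (ħ : ℝ) (w : Potential)

/-- The contraction of an operator on `q` particles with one additional particle. -/
def treeStep {q : ℕ} (b : L2 q →L[ℂ] L2 q) (s : ℝ) : L2 (q + 1) →L[ℂ] L2 (q + 1) :=
  (Complex.I / ħ) • ∑ i : Fin q,
    (pairOpAt ħ w i.castSucc (Fin.last q) s ∘L amplify (Nat.le_succ q) b -
      amplify (Nat.le_succ q) b ∘L pairOpAt ħ w i.castSucc (Fin.last q) s)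

theorem treeAmplitude_succ {p : ℕ} (a : L2S p →L[ℂ] L2S p) (t : ℝ) (n : ℕ) (τ : Fin (n + 1) → ℝ) :
    treeAmplitude ħ w a t (n + 1) τ =
      treeStep ħ w (treeAmplitude ħ w a t n (Fin.init τ)) (τ (Fin.last n)) := rfl

theorem pairOpAt_comm (hw : ∀ᵐ x : Pt, w (-x) = w x) (s : ℝ) (i j : Fin N) :
    pairOpAt ħ w i j s = pairOpAt ħ w j i s := by
  rw [pairOpAt, pairOp_comm w hw, pairOpAt]

/-- Exchanging the tail particles `j` and `k` conjugates one commutator into the other and leaves `b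
⊗ I` and the head particle fixed. -/
theorem compressCommL_amplify_tail {q : ℕ} (h : q ≤ N) (b : L2 q →L[ℂ] L2 q) (s : ℝ) (i : Fin q)
    (j k : Fin (N - q)) :
    compressCommL (amplify h b) (pairOpAt ħ w (Fin.castLE h i) (tailIdx h j) s) =
      compressCommL (amplify h b) (pairOpAt ħ w (Fin.castLE h i) (tailIdx h k) s) := by
  rw [compressCommL_apply, compressCommL_apply]
  refine compress_conj_perm (Equiv.swap (tailIdx h j) (tailIdx h k)) fun ψ => ?_
  have hne : ∀ j, Fin.castLE h i ≠ tailIdx h j := fun j => by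
    rw [← headTailEquiv_inl, ← headTailEquiv_inr, Ne, (headTailEquiv h).injective.eq_iff]
    exact Sum.inl_ne_inr
  simp only [sub_apply, ContinuousLinearMap.comp_apply, map_sub, permOp_pairOpAt,
    permOp_swap_amplify, Equiv.swap_apply_of_ne_of_ne (hne j) (hne k), Equiv.swap_apply_left]

theorem compressCommL_amplify_first_tail {q : ℕ} (h : q + 1 ≤ N) (b : L2 q →L[ℂ] L2 q) (s : ℝ)
    (i : Fin q) (j : Fin (N - q)) :
    compressCommL (amplify ((Nat.le_succ q).trans h) b)
        (pairOpAt ħ w (Fin.castLE ((Nat.le_succ q).trans h) i)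
          (tailIdx ((Nat.le_succ q).trans h) j) s) =
      compress (amplify h (pairOpAt ħ w i.castSucc (Fin.last q) s ∘L amplify (Nat.le_succ q) b -
        amplify (Nat.le_succ q) b ∘L pairOpAt ħ w i.castSucc (Fin.last q) s)) := by
  -- The first tail particle is the last of the first `q + 1`, where the tree amplitude attaches its
  -- new particle.
  rw [compressCommL_amplify_tail ħ w _ b s i j ⟨0, by omega⟩, amplify_sub, amplify_comp,
    amplify_comp, amplify_amplify, amplify_pairOpAt, compressCommL_apply]
  rfl

/-- Tail-tail pairs commute with `b ⊗ I`. Each head-tail pair occurs in both orders, which changes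
`1/(2N)` into `1/N`. -/
theorem compressCommL_interactionAt (hw : ∀ᵐ x : Pt, w (-x) = w x) {q : ℕ} (h : q ≤ N)
    (b : L2 q →L[ℂ] L2 q) (s : ℝ) :
    compressCommL (amplify h b) (interactionAt ħ w N s) =
      (1 / (2 * N : ℂ)) • ∑ i : Fin q, ∑ j : Fin q, compressCommL (amplify h b)
        (pairOpAt ħ w (Fin.castLE h i) (Fin.castLE h j) s) +
      (1 / (N : ℂ)) • ∑ i : Fin q, ∑ j : Fin (N - q), compressCommL (amplify h b)
        (pairOpAt ħ w (Fin.castLE h i) (tailIdx h j) s) := by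
  have htail : ∀ i j, compressCommL (amplify h b)
      (pairOpAt ħ w (tailIdx h i) (tailIdx h j) s) = 0 := fun i j => by
    rw [compressCommL_apply, amplify_comm_pairOpAt_tailIdx, sub_self]
    exact map_zero (compressL N)
  have hswap : ∑ i : Fin (N - q), ∑ j : Fin q, compressCommL (amplify h b)
      (pairOpAt ħ w (tailIdx h i) (Fin.castLE h j) s) =
      ∑ i : Fin q, ∑ j : Fin (N - q), compressCommL (amplify h b)
        (pairOpAt ħ w (Fin.castLE h i) (tailIdx h j) s) := by
    rw [Finset.sum_comm]
    refine Finset.sum_congr rfl fun i _ => Finset.sum_congr rfl fun j _ => ?_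
    rw [pairOpAt_comm ħ w hw]
  rw [interactionAt_eq w hw, map_smul]
  simp only [map_sum]
  rw [sum_head_tail h]
  simp only [sum_head_tail h (fun j => compressCommL (amplify h b) (pairOpAt ħ w _ j s)), htail,
    Finset.sum_const_zero, add_zero, Finset.sum_add_distrib]
  rw [hswap, add_assoc, ← two_smul ℂ (∑ i : Fin q, ∑ j : Fin (N - q), _), smul_add, smul_smul]
  congr 2
  field_simp

theorem norm_descFactorial_div_pow_le (N q : ℕ) : ‖(N.descFactorial q : ℂ) / (N : ℂ) ^ q‖ ≤ 1 := by
  rw [norm_div, norm_pow, Complex.norm_natCast, Complex.norm_natCast]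
  refine div_le_one_of_le₀ ?_ (by positivity)
  exact_mod_cast Nat.descFactorial_le_pow N q

theorem norm_observable_le {q : ℕ} (b : L2 q →L[ℂ] L2 q) : ‖observable N b‖ ≤ ‖b‖ := by
  unfold observable
  split_ifs with h
  · refine (ContinuousLinearMap.opNorm_smul_le _ _).trans ?_
    refine (mul_le_of_le_one_left (norm_nonneg (compress (amplify h b)))
      (norm_descFactorial_div_pow_le N q)).trans ?_
    exact (norm_compress_le _).trans (norm_amplify_le h b)
  · rw [ContinuousLinearMap.opNorm_zero]
    exact norm_nonneg b

theorem observable_eq_zero {q : ℕ} (h : N < q) (b : L2 q →L[ℂ] L2 q) : observable N b = 0 :=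
  dif_neg (by omega)

theorem interactionAt_comm_observable (hw : ∀ᵐ x : Pt, w (-x) = w x) {q : ℕ} (h : q ≤ N)
    (b : L2 q →L[ℂ] L2 q) (s : ℝ) :
    compress (interactionAt ħ w N s) ∘L observable N b -
        observable N b ∘L compress (interactionAt ħ w N s) =
      ((N.descFactorial q : ℂ) / (N : ℂ) ^ q) •
        compressCommL (amplify h b) (interactionAt ħ w N s) := by
  have hinv := isPermInvariant_interactionAt (N := N) w hw ħ s
  have e : observable N b = ((N.descFactorial q : ℂ) / (N : ℂ) ^ q) • compress (amplify h b) :=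
    dif_pos h
  rw [e, comp_smul_sub_smul_comp, ← hinv.compress_comp, ← hinv.compress_comp',
    compressCommL_apply]
  exact congrArg _ (map_sub (compressL N) _ _).symm

theorem compress_amplify_treeStep {q : ℕ} (h : q + 1 ≤ N) (b : L2 q →L[ℂ] L2 q) (s : ℝ) :
    compress (amplify h (treeStep ħ w b s)) = (Complex.I / ħ) • ∑ i : Fin q,
      compress (amplify h (pairOpAt ħ w i.castSucc (Fin.last q) s ∘L
        amplify (Nat.le_succ q) b - amplify (Nat.le_succ q) b ∘L
          pairOpAt ħ w i.castSucc (Fin.last q) s)) := by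
  rw [treeStep, amplify_smul, amplify_sum]
  exact (map_smul (compressL N) _ _).trans (congrArg _ (map_sum (compressL N) _ _))

theorem sum_sum_eq_smul_sum {M : Type*} [AddCommGroup M] [Module ℂ M] {q m : ℕ}
    {X : Fin q → Fin m → M} {Y : Fin q → M} (h : ∀ i j, X i j = Y i) :
    ∑ i, ∑ j, X i j = (m : ℂ) • ∑ i, Y i := by
  simp only [h, Finset.sum_const, Finset.card_univ, Fintype.card_fin]
  rw [← Finset.smul_sum, Nat.cast_smul_eq_nsmul]

/-- The sum over the tail is `N - q` equal terms, and `N - q` over `N` is exactly the ratio of the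
prefactors of orders `q + 1` and `q`. No error arises here. -/
theorem observable_treeStep (hN : 1 ≤ N) {q : ℕ} (h : q ≤ N)
    (b : L2 q →L[ℂ] L2 q) (s : ℝ) :
    observable N (treeStep ħ w b s) = ((N.descFactorial q : ℂ) / N ^ q * (Complex.I / ħ) *
      (1 / N)) • ∑ i : Fin q, ∑ j : Fin (N - q), compressCommL (amplify h b)
        (pairOpAt ħ w (Fin.castLE h i) (tailIdx h j) s) := by
  have hNC : (N : ℂ) ≠ 0 := by exact_mod_cast (by omega : N ≠ 0)
  rcases h.lt_or_eq with hlt | heq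
  · have h' : q + 1 ≤ N := hlt
    have e : observable N (treeStep ħ w b s) = ((N.descFactorial (q + 1) : ℂ) /
        (N : ℂ) ^ (q + 1)) • compress (amplify h' (treeStep ħ w b s)) := dif_pos h'
    rw [e, compress_amplify_treeStep,
      sum_sum_eq_smul_sum (fun i j => compressCommL_amplify_first_tail ħ w h' b s i j),
      smul_smul, smul_smul, Nat.descFactorial_succ]
    congr 1
    push_cast
    rw [pow_succ]
    field_simp
  -- For `q = N` the tail is empty and order `N + 1` vanishes, so both sides are zero.
  · have : IsEmpty (Fin (N - q)) := by rw [heq, Nat.sub_self]; infer_instance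
    rw [observable_eq_zero (by omega)]
    exact (smul_sum_sum_isEmpty _ _).symm

theorem commutator_observable (hN : 1 ≤ N) (hw : ∀ᵐ x : Pt, w (-x) = w x) {q : ℕ} (h : q ≤ N)
    (b : L2 q →L[ℂ] L2 q) (s : ℝ) :
    (Complex.I / ħ) • (compress (interactionAt ħ w N s) ∘L observable N b -
        observable N b ∘L compress (interactionAt ħ w N s)) - observable N (treeStep ħ w b s) =
      ((N.descFactorial q : ℂ) / N ^ q * (Complex.I / ħ) * (1 / (2 * N))) •
        ∑ i : Fin q, ∑ j : Fin q, compressCommL (amplify h b)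
          (pairOpAt ħ w (Fin.castLE h i) (Fin.castLE h j) s) := by
  rw [interactionAt_comm_observable ħ w hw h, observable_treeStep ħ w hN h,
    compressCommL_interactionAt ħ w hw h, smul_smul, smul_add, smul_smul, smul_smul,
    mul_comm (Complex.I / (ħ : ℂ)), add_sub_cancel_right]

theorem norm_I_div {ħ : ℝ} (hħ : 0 < ħ) : ‖(Complex.I / ħ : ℂ)‖ = 1 / ħ := by
  rw [norm_div, Complex.norm_I, Complex.norm_real, Real.norm_of_nonneg hħ.le]

/-- Only the loop terms survive: `q²` ordered pairs, each of norm at most `2‖w‖‖b‖`, with the factor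
`1/(2Nħ)`. For `q > N` everything vanishes. -/
theorem norm_commutator_observable_sub_le {ħ : ℝ} (hħ : 0 < ħ) (hN : 1 ≤ N)
    (hw : ∀ᵐ x : Pt, w (-x) = w x) {q : ℕ} (b : L2 q →L[ℂ] L2 q) (s : ℝ) :
    ‖(Complex.I / ħ) • (compress (interactionAt ħ w N s) ∘L observable N b -
        observable N b ∘L compress (interactionAt ħ w N s)) -
        observable N (treeStep ħ w b s)‖ ≤ q ^ 2 * (‖w‖ / ħ) * ‖b‖ / N := by
  have hN0 : (0 : ℝ) < N := by exact_mod_cast hN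
  rcases le_or_gt q N with h | h
  · rw [commutator_observable ħ w hN hw h]
    have h1 : ∀ i j : Fin q, ‖compressCommL (amplify h b)
        (pairOpAt ħ w (Fin.castLE h i) (Fin.castLE h j) s)‖ ≤ 2 * ‖w‖ * ‖b‖ := fun i j => by
      refine (norm_compressCommL_le _ _).trans ?_
      have := norm_pairOpAt_le w ħ s (Fin.castLE h i) (Fin.castLE h j)
      have := norm_amplify_le h b
      gcongr
    have hc : ‖(N.descFactorial q : ℂ) / N ^ q * (Complex.I / ħ) * (1 / (2 * N) : ℂ)‖ ≤
        1 * (1 / ħ) * (1 / (2 * N)) := by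
      rw [norm_mul, norm_mul]
      have h3 : ‖(1 / (2 * N) : ℂ)‖ = 1 / (2 * N) := by simp
      rw [norm_I_div hħ, h3]
      have := norm_descFactorial_div_pow_le N q
      gcongr
    refine (norm_smul_sum_sum_le h1 _).trans
      ((mul_le_mul_of_nonneg_right hc (by positivity)).trans (le_of_eq ?_))
    rw [Fintype.card_fin]
    field_simp
  · rw [observable_eq_zero h, observable_eq_zero (h.trans (Nat.lt_succ_self q)),
      norm_smul_commutator_zero]
    positivity

end Commutator

/-! ### Tree amplitudes -/

section Tree

variable {ħ : ℝ} (w : Potential)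

theorem norm_treeStep_le (hħ : 0 < ħ) {q : ℕ} (b : L2 q →L[ℂ] L2 q) (s : ℝ) :
    ‖treeStep ħ w b s‖ ≤ q * (2 * ‖w‖ / ħ) * ‖b‖ := by
  refine (norm_smul_sum_commutator_le
    (fun i : Fin q => norm_pairOpAt_le w ħ s i.castSucc (Fin.last q))
    (norm_amplify_le (Nat.le_succ q) b) _).trans (le_of_eq ?_)
  rw [norm_I_div hħ, Fintype.card_fin]
  field_simp

/-- The bound on the tree amplitudes. -/
def treeBound (ħ : ℝ) (w : Potential) (p : ℕ) (A : ℝ) (n : ℕ) : ℝ :=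
  p.ascFactorial n * (2 * ‖w‖ / ħ) ^ n * A

/-- Attaching particle `p + n + 1` costs `p + n` commutators, each at most `2‖w‖/ħ` times the
previous norm; the counts multiply to a rising factorial. -/
theorem norm_treeAmplitude_le (hħ : 0 < ħ) {p : ℕ} (a : L2S p →L[ℂ] L2S p) (t : ℝ) (n : ℕ)
    (τ : Fin n → ℝ) : ‖treeAmplitude ħ w a t n τ‖ ≤ treeBound ħ w p ‖a‖ n := by
  induction n with
  | zero =>
    simp only [treeBound, Nat.ascFactorial_zero, Nat.cast_one, pow_zero, one_mul]
    refine le_trans ?_ (norm_extendOp_le a)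
    refine ContinuousLinearMap.opNorm_le_bound _ (norm_nonneg _) fun ψ => ?_
    simp only [treeAmplitude, ContinuousLinearMap.comp_apply, norm_free_apply]
    exact ((extendOp a).le_opNorm _).trans_eq (by rw [norm_free_apply])
  | succ n ih =>
    rw [treeAmplitude_succ]
    refine (norm_treeStep_le w hħ _ _).trans ?_
    refine (mul_le_mul_of_nonneg_left (ih _) (by positivity)).trans (le_of_eq ?_)
    simp only [treeBound, Nat.ascFactorial_succ, pow_succ]
    push_cast
    ring

theorem continuous_treeAmplitude (hħ : 0 < ħ) {p : ℕ} (a : L2S p →L[ℂ] L2S p) (t : ℝ) (n : ℕ)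
    (ψ : L2 (p + n)) : Continuous fun τ => treeAmplitude ħ w a t n τ ψ := by
  induction n with
  | zero => exact continuous_const
  | succ n ih =>
    have hinit : Continuous fun τ : Fin (n + 1) → ℝ => Fin.init τ := by
      refine continuous_pi fun i => ?_
      unfold Fin.init
      fun_prop
    have hb : ∀ τ : Fin (n + 1) → ℝ,
        ‖treeAmplitude ħ w a t n (Fin.init τ)‖ ≤ treeBound ħ w p ‖a‖ n := fun τ =>
      norm_treeAmplitude_le w hħ a t n (Fin.init τ)
    have hG : ∀ ψ, Continuous fun τ : Fin (n + 1) → ℝ => amplify (Nat.le_succ (p + n))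
        (treeAmplitude ħ w a t n (Fin.init τ)) ψ :=
      continuous_amplify (b := fun τ : Fin (n + 1) → ℝ => treeAmplitude ħ w a t n (Fin.init τ))
        (Nat.le_succ (p + n)) hb fun f => (ih f).comp hinit
    have hGb : ∀ τ : Fin (n + 1) → ℝ, ‖amplify (Nat.le_succ (p + n))
        (treeAmplitude ħ w a t n (Fin.init τ))‖ ≤ treeBound ħ w p ‖a‖ n := fun τ =>
      (norm_amplify_le _ _).trans (norm_treeAmplitude_le w hħ a t n _)
    have hW : ∀ (i : Fin (p + n)) ψ, Continuous fun τ : Fin (n + 1) → ℝ =>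
        pairOpAt ħ w i.castSucc (Fin.last (p + n)) (τ (Fin.last n)) ψ := fun i ψ =>
      (continuous_pairOpAt w ħ _ _ ψ).comp (continuous_apply _)
    exact continuous_smul_sum_commutator (fun i τ => norm_pairOpAt_le w ħ _ _ _) hGb hW hG _ ψ

theorem continuous_observable {Y : Type*} [TopologicalSpace Y] {q : ℕ} (N : ℕ)
    {b : Y → L2 q →L[ℂ] L2 q} {M : ℝ} (hM : ∀ y, ‖b y‖ ≤ M)
    (hb : ∀ f, Continuous fun y => b y f) (ψ : L2S N) :
    Continuous fun y => observable N (b y) ψ := by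
  unfold observable
  split_ifs with h
  · have h1 : Continuous fun y => compress (amplify h (b y)) ψ :=
      (symProj N).continuous.comp (continuous_amplify h hM hb (incl N ψ))
    exact continuous_smul_apply _ h1
  · exact continuous_const

theorem observable_free_conj (ħ : ℝ) {p N : ℕ} (b : L2 p →L[ℂ] L2 p) (t : ℝ) :
    observable N (free ħ p (-t) ∘L b ∘L free ħ p t) =
      freeHeisenberg ħ N t (observable N b) := by
  unfold observable freeHeisenberg
  split_ifs with h
  · rw [amplify_free_conj, (isPermInvariant_free ħ (-t)).compress_comp,
      (isPermInvariant_free ħ t).compress_comp', ContinuousLinearMap.smul_comp,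
      ContinuousLinearMap.comp_smul]
  · simp

/-- Replacing `p` by `p + 1` gives `n!` times the binomial coefficient of `p + n` over `n`. -/
theorem ascFactorial_le_two_pow (p n : ℕ) :
    (p.ascFactorial n : ℝ) ≤ n.factorial * 2 ^ (p + n) := by
  have h1 := Nat.ascFactorial_le n (Nat.le_succ p)
  rw [Nat.succ_eq_add_one, Nat.ascFactorial_eq_factorial_mul_choose] at h1
  have h2 : n.factorial * (p + n).choose n ≤ n.factorial * 2 ^ (p + n) :=
    Nat.mul_le_mul_left _ (Nat.choose_le_two_pow _ _)
  exact_mod_cast h1.trans h2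

/-- The simplex volume cancels `n!`, and the `2^n` from the binomial bound turns `2‖w‖` into `4‖w‖`.
This fixes the radius of convergence. -/
theorem pow_div_factorial_mul_treeBound_le (hħ : 0 < ħ) (p n : ℕ) {A : ℝ} (hA : 0 ≤ A) (t : ℝ) :
    |t| ^ n / n.factorial * treeBound ħ w p A n ≤ 2 ^ p * A * (4 * ‖w‖ / ħ * |t|) ^ n := by
  have h1 := ascFactorial_le_two_pow p n
  have h0 : (0 : ℝ) < n.factorial := by positivity
  calc |t| ^ n / n.factorial * treeBound ħ w p A n
      = |t| ^ n / n.factorial * (2 * ‖w‖ / ħ) ^ n * A * p.ascFactorial n := by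
        unfold treeBound; ring
    _ ≤ |t| ^ n / n.factorial * (2 * ‖w‖ / ħ) ^ n * A * (n.factorial * 2 ^ (p + n)) := by gcongr
    _ = 2 ^ p * A * (2 * (2 * ‖w‖ / ħ) * |t|) ^ n := by
        rw [pow_add, mul_pow, mul_pow]
        field_simp
    _ = _ := by ring_nf

theorem summable_error (p : ℕ) {κ : ℝ} (h0 : 0 ≤ κ) (hκ : κ < 1) :
    Summable fun m : ℕ => 2 ^ p * ((p + m : ℕ) : ℝ) ^ 2 * κ ^ (m + 1) := by
  have hn : ‖κ‖ < 1 := by rwa [Real.norm_of_nonneg h0]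
  have s0 := summable_pow_mul_geometric_of_norm_lt_one 0 hn
  have s1 := summable_pow_mul_geometric_of_norm_lt_one 1 hn
  have s2 := summable_pow_mul_geometric_of_norm_lt_one 2 hn
  refine ((((s0.mul_left ((p : ℝ) ^ 2)).add (s1.mul_left (2 * (p : ℝ)))).add s2).mul_left
    (2 ^ p * κ)).congr fun m => ?_
  push_cast
  ring

end Tree

end MeanField

end

/-! ### The mean-field expansion of the Heisenberg evolution -/

theorem proposition2p2 (p : ℕ) (κ : ℝ) (hκ : κ < 1) :
    ∃ C : ℝ, ∀ (ħ : ℝ) (_ : 0 < ħ) (w : Potential) (_ : ∀ᵐ x : Pt, w (-x) = w x)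
      (t : ℝ) (_ : 4 * ‖w‖ / ħ * |t| ≤ κ) (a : L2S p →L[ℂ] L2S p)
      (N : ℕ) (_ : 1 ≤ N) (_ : p ≤ N),
      IsUnitaryGroup ħ (hamiltonian ħ w N) (propagator ħ w N) ∧
      ∃ B : ℕ → (L2S N →L[ℂ] L2S N),
        (∀ n, IsTimeOrderedIntegral t
          (fun τ : Fin n → ℝ => observable N (treeAmplitude ħ w a t n τ)) (B n)) ∧
        (∀ n, 1 ≤ n → ‖B n‖ ≤ 2 ^ p * ‖a‖ * (4 * ‖w‖ / ħ * |t|) ^ n) ∧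
        Summable (fun n => ‖B (n + 1)‖) ∧
        ‖heisenberg ħ w N t (observable N (extendOp a)) -
            (freeHeisenberg ħ N t (observable N (extendOp a)) + ∑' n, B (n + 1))‖
          ≤ C * ‖a‖ / N := by
  -- The summands bound the loop errors of the successive Duhamel steps: `(p + m)²` pairs, a tree
  -- amplitude of order `m`, and one extra interaction giving the additional `κ`.
  refine ⟨∑' m : ℕ, 2 ^ p * ((p + m : ℕ) : ℝ) ^ 2 * κ ^ (m + 1), ?_⟩
  intro ħ hħ w hw t ht a N hN hpN
  have hN0 : (0 : ℝ) < N := by exact_mod_cast hN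
  have hx0 : 0 ≤ 4 * ‖w‖ / ħ * |t| := by positivity
  have hκ0 : 0 ≤ κ := hx0.trans ht
  obtain ⟨V, hV, hU, hprop⟩ := exists_propagator_eq hħ.ne' w N
  let F : (n : ℕ) → (Fin n → ℝ) → L2S N →L[ℂ] L2S N :=
    fun n τ => observable N (treeAmplitude ħ w a t n τ)
  have hFb : ∀ n τ, ‖F n τ‖ ≤ treeBound ħ w p ‖a‖ n := fun n τ =>
    (norm_observable_le _).trans (norm_treeAmplitude_le w hħ a t n τ)
  have hFc : ∀ n ψ, Continuous fun τ => F n τ ψ := fun n ψ =>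
    continuous_observable N (norm_treeAmplitude_le w hħ a t n)
      (continuous_treeAmplitude w hħ a t n) ψ
  choose B hB hBn using fun n => exists_isTimeOrderedIntegral t (hFb n) (hFc n)
  have hF0 : ∀ n, N < p + n → ∀ τ, F n τ = 0 := fun n hn τ => observable_eq_zero hn _
  have hB0 : ∀ n, N < p + n → B n = 0 := fun n hn =>
    isTimeOrderedIntegral_eq_zero (hB n) (hF0 n hn)
  -- For fixed `N` only finitely many `B n` are nonzero, so summability is immediate; the uniformity
  -- in `N` lies in the norm bound.
  refine ⟨hU, B, hB, fun n _ => (hBn n).trans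
    (pow_div_factorial_mul_treeBound_le w hħ p n (norm_nonneg a) t),
    summable_norm_of_eq_zero (M := N - p) fun n hn => hB0 (n + 1) (by omega), ?_⟩
  have he : ∀ m τ s, ‖(Complex.I / ħ) • (compress (interactionAt ħ w N s) ∘L F m τ -
      F m τ ∘L compress (interactionAt ħ w N s)) -
      F (m + 1) (Fin.snoc (α := fun _ => ℝ) τ s)‖ ≤
      ((p + m : ℕ) : ℝ) ^ 2 * (‖w‖ / ħ) * treeBound ħ w p ‖a‖ m / N := by
    intro m τ s
    have h1 := norm_commutator_observable_sub_le w hħ hN hw (treeAmplitude ħ w a t m τ) s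
    simp only [F, treeAmplitude_succ, Fin.init_snoc, Fin.snoc_last]
    refine h1.trans ?_
    have := norm_treeAmplitude_le w hħ a t m τ
    gcongr
  -- After `N - p + 1` steps the order is `N + 1`, where observables vanish.
  have hmain := norm_sub_sum_timeOrderedIntegral_le hV
    (inner_compress_interactionAt hħ.ne' w) (continuous_compress_interactionAt w)
    (norm_compress_interactionAt_le ħ w) t F hFb B hB he (M := N - p + 1)
    (hF0 _ (by omega))
  have hF00 : F 0 Fin.elim0 = freeHeisenberg ħ N t (observable N (extendOp a)) :=
    observable_free_conj ħ (extendOp a) t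
  have hB00 : B 0 = freeHeisenberg ħ N t (observable N (extendOp a)) := by
    rw [← hF00]
    ext1 ψ
    exact (hB 0).apply_eq ψ
  -- The free factors of the propagator turn the observable into its free Heisenberg evolution,
  -- leaving `V t` on either side.
  have hheis : heisenberg ħ w N t (observable N (extendOp a)) =
      (V t).adjoint ∘L F 0 Fin.elim0 ∘L V t := by
    rw [hF00]
    ext1 ψ
    refine ext_inner_left ℂ fun φ => ?_
    have h1 := (freeS_isUnitaryGroup hħ.ne' N).inner_neg_apply (-t)
    rw [neg_neg] at h1
    have h2 := hU.inner_neg_apply (-t)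
    rw [neg_neg] at h2
    simp only [heisenberg, freeHeisenberg, ContinuousLinearMap.comp_apply,
      ContinuousLinearMap.adjoint_inner_right]
    rw [← h2, hprop]
    exact h1 _ _
  have hsum : ∑ m ∈ Finset.range (N - p + 1), B m =
      freeHeisenberg ħ N t (observable N (extendOp a)) + ∑' n, B (n + 1) := by
    rw [sum_range_succ_eq_tsum fun n hn => hB0 n (by omega), hB00]
  rw [hheis, ← hsum]
  refine hmain.trans ?_
  have hs := summable_error p hκ0 hκ
  have hterm : ∀ m : ℕ, |t| ^ (m + 1) / (m + 1).factorial *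
      (((p + m : ℕ) : ℝ) ^ 2 * (‖w‖ / ħ) * treeBound ħ w p ‖a‖ m / N) ≤
      2 ^ p * ((p + m : ℕ) : ℝ) ^ 2 * κ ^ (m + 1) * (‖a‖ / N) := by
    intro m
    have h1 := pow_div_factorial_mul_treeBound_le w hħ p m (norm_nonneg a) t
    -- The error is integrated over `m + 1` times but its tree amplitude has order `m`: the surplus
    -- `1/(m + 1)` is discarded and the surplus `‖w‖|t|/ħ` bounded by `κ`.
    have h2 : ((m + 1).factorial : ℝ)⁻¹ ≤ (m.factorial : ℝ)⁻¹ := by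
      gcongr
      omega
    have hT : 0 ≤ treeBound ħ w p ‖a‖ m := by unfold treeBound; positivity
    have h3 : ‖w‖ / ħ * |t| ≤ κ := by
      have : 0 ≤ ‖w‖ / ħ * |t| := by positivity
      calc ‖w‖ / ħ * |t| ≤ 4 * (‖w‖ / ħ * |t|) := by linarith
        _ = 4 * ‖w‖ / ħ * |t| := by ring
        _ ≤ κ := ht
    calc _ = ((p + m : ℕ) : ℝ) ^ 2 * (‖w‖ / ħ * |t|) *
          (|t| ^ m * ((m + 1).factorial : ℝ)⁻¹ * treeBound ħ w p ‖a‖ m) / N := by ring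
      _ ≤ ((p + m : ℕ) : ℝ) ^ 2 * κ *
          (|t| ^ m * (m.factorial : ℝ)⁻¹ * treeBound ħ w p ‖a‖ m) / N := by gcongr
      _ ≤ ((p + m : ℕ) : ℝ) ^ 2 * κ * (2 ^ p * ‖a‖ * κ ^ m) / N := by
          rw [← div_eq_mul_inv]
          have h4 : (4 * ‖w‖ / ħ * |t|) ^ m ≤ κ ^ m := pow_le_pow_left₀ hx0 ht m
          have h5 := h1.trans (mul_le_mul_of_nonneg_left h4 (by positivity))
          gcongr
      _ = _ := by ring
  refine (Finset.sum_le_sum fun m _ => hterm m).trans ?_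
  rw [← Finset.sum_mul, mul_div_assoc]
  exact mul_le_mul_of_nonneg_right (hs.sum_le_tsum _ fun m _ => by positivity) (by positivity)
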